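/- For even $n$ and an integer $d\ge 0$, let $\mathcal{M}_d^{\cup}=\mathcal{M}_d^{\cup}(n)$ denote the random simple graph on $[n]=\{1,\dots,n\}$ obtained as the union of $d$ independent uniformly random perfect matchings on $[n]$, and let $\mathcal{G}(n,p)$ denote the binomial random graph on $[n]$ with edge probability $p\in[0,1]$. All asymptotics are as $n\to\infty$ along even integers. There is a continuous and strictly increasing function $g:[1,\infty)\to[0,\infty)$ with $g(1)=0$ and $\lim_{x\to\infty}g(x)=1/4$ such that the following holds. Let $\varepsilon>0$ be fixed, let $x=x(n)\ge 1+\varepsilon$, and suppose that $p=p(n)=x\log n/n$ satisfies $p\le 1$. Then for every sequence of integers $d=d(n)\ge 0$ with $d\le (g(x)+o(1))\,pn$, i.e. $d(n)\le (g(x(n))+\delta(n))\,p(n)\,n$ for some real sequence $\delta(n)\to 0$, there exists, for each even $n$, a coupling $(H_*,G^*)$ such that \[ H_*\sim \mathcal{M}_{d}^{\cup},\qquad G^*\sim \mathcal{G}(n,p),\qquad \mathbb{P}(H_*\subseteq G^*)=1-o(1). \] -/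

import Mathlib

open MeasureTheory ProbabilityTheory Filter Topology

/-- The perfect matchings on the vertex set `Fin n`, as graphs on `Fin n`: those graphs which,
regarded as a subgraph of themselves, are a perfect matching. -/
def perfectMatchings (n : ℕ) : Set (SimpleGraph (Fin n)) :=
  {M | (⊤ : M.Subgraph).IsPerfectMatching}

/-- The law of the union (as a simple graph on `Fin n`) of `d` independent uniformly random
perfect matchings on `Fin n`. It is meant for even `n`, where perfect matchings exist. -/
noncomputable def matchingUnion (n d : ℕ) : Measure (SimpleGraph (Fin n)) :=
  (Measure.pi fun _ : Fin d => uniformOn (perfectMatchings n)).map fun M => ⨆ i, M i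

/-- The filter "`n → ∞` with `n` even". -/
def evenAtTop : Filter ℕ := atTop ⊓ 𝓟 {n | Even n}

/-!
The law of the union of the matchings is compared with the binomial random graph through the
expectations of monotone `[0, 1]`-valued functions: if these never exceed the expectations under
`G(n, p)` by more than `e`, then Strassen's theorem (`exists_coupling_of_expect_le`, obtained from
the separation of compact convex sets) provides a coupling that fails with probability at most `e`.

The comparison rests on *planting* (`planting`). Write the random graph with intensities, an edge
being present with probability `1 - exp (-lam e)`, so that independent unions add intensities. If
every element of a set `W` has intensity at least `L / |W|`, then a uniformly random element of `W`
may be added to the random graph at the price of lowering the intensities on `W` by `C / |W|`. The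
reason is that the two sides differ only in the size of the random subset of `W`: the ratio of the
two size distributions is log-concave, so above the first size where it reaches `1` it crosses `1`
only once, and there monotone functions prefer the unplanted side (`planting_core`). Smaller sizes
have a small probability when `L` is large. The constant `C` is of order `1`, and it has to exceed
`2 log 2` if half the mean size is used as cutoff; a larger `C` works with a smaller `L`.

A perfect matching is planted edge by edge (`plant_round`). In a random ordering of the vertices,
`T` times the next vertex is paired with a uniform later vertex; each of the remaining
`u = n - 2 T` vertices makes `155` uniform choices among these `u` vertices. By Tutte's theorem
and a union bound over the sets trapped by a violator, the graph of choices has a perfect matching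
with probability `1 - O(u ^ (-4))` (`expect_no_perfectMatching_le`). The symmetric group acts
transitively on perfect matchings, so the random ordering turns the resulting matching into a
uniform one (`expect_comap_eq`), and `d` independent rounds dominate `d` independent uniform perfect
matchings (`expect_matchings_le`) as long as the total cost of each pair stays below its intensity.

Two choices of parameters suffice. Near the threshold, for `p = (1 + ε) log n / n`, no pairs are
used, `C` is of order `1 / ε` and the cost is bounded deterministically by `O(d / (ε n))`, which
allows `d` of order `ε ^ 2 log n` (`exists_matchingsDominated_near`). For `p ≥ 10 ^ 9 log n / n`
almost all vertices are paired, `C = 3 / 2`, and the cost of a pair is close to its mean, about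
`C d / n`, up to a factor `2` by Chernoff's inequality, which allows `d = 0.26 p n`
(`exists_matchingsDominated_far`). A function `g` that grows quadratically and very slowly from
`g 1 = 0` to the limit `1 / 4` stays below both.
-/

/-! ### Random subsets with independent elements -/

/-- The expectation of `f S`, where `S` is the random subset of `s` containing each `e ∈ s`
independently with probability `w e`. -/
noncomputable def bernE {E : Type*} [DecidableEq E] (s : Finset E) (w : E → ℝ)
    (f : Finset E → ℝ) : ℝ :=
  ∑ S ∈ s.powerset, (∏ e ∈ s, if e ∈ S then w e else 1 - w e) * f S

section Bern

variable {E : Type*} [DecidableEq E]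

theorem bernE_empty (w : E → ℝ) (f : Finset E → ℝ) : bernE ∅ w f = f ∅ := by
  simp [bernE]

theorem bernE_insert {a : E} {s : Finset E} (ha : a ∉ s) (w : E → ℝ) (f : Finset E → ℝ) :
    bernE (insert a s) w f =
      (1 - w a) * bernE s w f + w a * bernE s w (fun S => f (insert a S)) := by
  unfold bernE
  rw [Finset.sum_powerset_insert ha, Finset.mul_sum, Finset.mul_sum]
  congr 1
  · refine Finset.sum_congr rfl fun S hS => ?_
    have haS : a ∉ S := fun h => ha (Finset.mem_powerset.1 hS h)
    rw [Finset.prod_insert ha, if_neg haS, mul_assoc]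
  · refine Finset.sum_congr rfl fun S hS => ?_
    rw [Finset.prod_insert ha, if_pos (Finset.mem_insert_self _ _), mul_assoc]
    congr 2
    refine Finset.prod_congr rfl fun e he => ?_
    have : e ≠ a := fun h => ha (h ▸ he)
    simp [this]

theorem bernE_add (s : Finset E) (w : E → ℝ) (f g : Finset E → ℝ) :
    bernE s w (fun S => f S + g S) = bernE s w f + bernE s w g := by
  simp [bernE, mul_add, Finset.sum_add_distrib]

theorem bernE_const_mul (s : Finset E) (w : E → ℝ) (c : ℝ) (f : Finset E → ℝ) :
    bernE s w (fun S => c * f S) = c * bernE s w f := by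
  simp only [bernE, Finset.mul_sum]
  exact Finset.sum_congr rfl fun S _ => by ring

theorem bernE_sum {ι : Type*} (t : Finset ι) (s : Finset E) (w : E → ℝ)
    (f : ι → Finset E → ℝ) :
    bernE s w (fun S => ∑ i ∈ t, f i S) = ∑ i ∈ t, bernE s w (f i) := by
  simp only [bernE, Finset.mul_sum]
  exact Finset.sum_comm

theorem bernE_one (s : Finset E) (w : E → ℝ) : bernE s w (fun _ => 1) = 1 := by
  induction s using Finset.induction_on with
  | empty => simp [bernE_empty]
  | insert a s ha ih => rw [bernE_insert ha, ih]; ring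

theorem bernE_const (s : Finset E) (w : E → ℝ) (c : ℝ) : bernE s w (fun _ => c) = c := by
  have := bernE_const_mul s w c (fun _ => 1)
  simpa [bernE_one] using this

theorem bernE_congr {s : Finset E} {w w' : E → ℝ} {f : Finset E → ℝ}
    (h : ∀ e ∈ s, w e = w' e) : bernE s w f = bernE s w' f := by
  unfold bernE
  refine Finset.sum_congr rfl fun S _ => ?_
  congr 1
  exact Finset.prod_congr rfl fun e he => by rw [h e he]

theorem bernE_weight_nonneg {s : Finset E} {w : E → ℝ} (h0 : ∀ e ∈ s, 0 ≤ w e)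
    (h1 : ∀ e ∈ s, w e ≤ 1) (S : Finset E) :
    0 ≤ ∏ e ∈ s, if e ∈ S then w e else 1 - w e := by
  refine Finset.prod_nonneg fun e he => ?_
  split_ifs
  · exact h0 e he
  · linarith [h1 e he]

theorem bernE_mono {s : Finset E} {w : E → ℝ} (h0 : ∀ e ∈ s, 0 ≤ w e)
    (h1 : ∀ e ∈ s, w e ≤ 1) {f g : Finset E → ℝ} (hfg : ∀ S, f S ≤ g S) :
    bernE s w f ≤ bernE s w g :=
  Finset.sum_le_sum fun S _ =>
    mul_le_mul_of_nonneg_left (hfg S) (bernE_weight_nonneg h0 h1 S)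

/-- Superposition: the union of two independent random subsets is a random subset of the same
kind. -/
theorem bernE_union (s : Finset E) (w w' : E → ℝ) (f : Finset E → ℝ) :
    bernE s w (fun S => bernE s w' (fun S' => f (S ∪ S'))) =
      bernE s (fun e => w e + w' e - w e * w' e) f := by
  induction s using Finset.induction_on generalizing f with
  | empty => simp [bernE_empty]
  | insert a s ha ih =>
    rw [bernE_insert ha, bernE_insert ha]
    simp only [bernE_insert ha]
    rw [bernE_add, bernE_add]
    simp only [bernE_const_mul, Finset.insert_union, Finset.union_insert, Finset.insert_idem]
    have h1 := ih f
    have h2 := ih (fun S => f (insert a S))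
    rw [h1, h2]
    ring

theorem bernE_le_of_le {s : Finset E} {w w' : E → ℝ} (h0 : ∀ e ∈ s, 0 ≤ w e)
    (hle : ∀ e ∈ s, w e ≤ w' e) (h1 : ∀ e ∈ s, w' e ≤ 1) {f : Finset E → ℝ} (hf : Monotone f) :
    bernE s w f ≤ bernE s w' f := by
  induction s using Finset.induction_on generalizing f with
  | empty => simp [bernE_empty]
  | insert a s ha ih =>
    rw [bernE_insert ha, bernE_insert ha]
    have i1 := ih (fun e he => h0 e (Finset.mem_insert_of_mem he))
      (fun e he => hle e (Finset.mem_insert_of_mem he))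
      (fun e he => h1 e (Finset.mem_insert_of_mem he)) hf
    have hf' : Monotone fun S => f (insert a S) := fun S S' h =>
      hf (Finset.insert_subset_insert _ h)
    have i2 := ih (fun e he => h0 e (Finset.mem_insert_of_mem he))
      (fun e he => hle e (Finset.mem_insert_of_mem he))
      (fun e he => h1 e (Finset.mem_insert_of_mem he)) hf'
    have i3 : bernE s w f ≤ bernE s w (fun S => f (insert a S)) :=
      bernE_mono (fun e he => h0 e (Finset.mem_insert_of_mem he))
        (fun e he => (hle e (Finset.mem_insert_of_mem he)).trans
          (h1 e (Finset.mem_insert_of_mem he))) fun S => hf (Finset.subset_insert _ _)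
    have ha0 := h0 a (Finset.mem_insert_self _ _)
    have ha1 := hle a (Finset.mem_insert_self _ _)
    have ha2 := h1 a (Finset.mem_insert_self _ _)
    nlinarith [mul_nonneg (sub_nonneg.2 ha2) (sub_nonneg.2 i1),
      mul_nonneg (ha0.trans ha1) (sub_nonneg.2 i2), mul_nonneg (sub_nonneg.2 ha1)
        (sub_nonneg.2 i3)]

/-- Elements of probability zero may be discarded. -/
theorem bernE_restrict {W s : Finset E} (hW : W ⊆ s) {w : E → ℝ}
    (h : ∀ e ∈ s, e ∉ W → w e = 0) (f : Finset E → ℝ) : bernE s w f = bernE W w f := by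
  induction s using Finset.induction_on generalizing W f with
  | empty => rw [Finset.subset_empty.1 hW]
  | insert a s ha ih =>
    have hs : W.erase a ⊆ s := fun x hx =>
      (Finset.mem_insert.1 (hW (Finset.mem_of_mem_erase hx))).resolve_left
        (Finset.ne_of_mem_erase hx)
    have key : ∀ g : Finset E → ℝ, bernE s w g = bernE (W.erase a) w g := fun g =>
      ih hs (fun e he heW => h e (Finset.mem_insert_of_mem he) fun h' =>
        heW (Finset.mem_erase.2 ⟨fun hea => ha (hea ▸ he), h'⟩)) g
    by_cases haW : a ∈ W
    · conv_rhs => rw [← Finset.insert_erase haW]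
      rw [bernE_insert ha, bernE_insert (Finset.notMem_erase a W), key, key]
    · rw [bernE_insert ha, h a (Finset.mem_insert_self _ _) haW, key, Finset.erase_eq_of_notMem haW]
      ring

theorem bernE_const_prob (W : Finset E) (p : ℝ) (f : Finset E → ℝ) :
    bernE W (fun _ => p) f =
      ∑ S ∈ W.powerset, p ^ S.card * (1 - p) ^ (W.card - S.card) * f S := by
  unfold bernE
  refine Finset.sum_congr rfl fun S hS => ?_
  have hS' := Finset.mem_powerset.1 hS
  congr 1
  rw [Finset.prod_ite, Finset.prod_const, Finset.prod_const]
  congr 2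
  · congr 1
    ext e
    simp only [Finset.mem_filter]
    exact ⟨fun h => h.2, fun h => ⟨hS' h, h⟩⟩
  · rw [← Finset.card_sdiff_of_subset hS', Finset.sdiff_eq_filter]

/-! ### Planting one uniform element -/

/-- Adding a uniformly random element of `W` to a random subset of `W` weights each
`T ⊆ W` by the number of elements it may have received. -/
theorem sum_bernE_insert (W : Finset E) (p : ℝ) (f : Finset E → ℝ) :
    ∑ u ∈ W, bernE W (fun _ => p) (fun S => f (insert u S)) =
      ∑ T ∈ W.powerset,
        (T.card : ℝ) * (p ^ (T.card - 1) * (1 - p) ^ (W.card - T.card)) * f T := by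
  have h1 : ∀ u ∈ W, bernE W (fun _ => p) (fun S => f (insert u S)) =
      ∑ T ∈ W.powerset, if u ∈ T then
        p ^ (T.card - 1) * (1 - p) ^ (W.card - T.card) * f T else 0 := by
    intro u hu
    have h2 : bernE W (fun _ => p) (fun S => f (insert u S)) =
        bernE (W.erase u) (fun _ => p) (fun S => f (insert u S)) := by
      conv_lhs => rw [← Finset.insert_erase hu]
      rw [bernE_insert (Finset.notMem_erase u W)]
      simp only [Finset.insert_idem]
      ring
    rw [h2, bernE_const_prob]
    conv_rhs => rw [← Finset.insert_erase hu]
    rw [Finset.sum_powerset_insert (Finset.notMem_erase u W)]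
    rw [Finset.sum_eq_zero (s := (W.erase u).powerset) (f := fun T => if u ∈ T then _ else _),
      zero_add]
    · refine Finset.sum_congr rfl fun S hS => ?_
      have huS : u ∉ S := fun h => Finset.notMem_erase u W (Finset.mem_powerset.1 hS h)
      rw [if_pos (Finset.mem_insert_self _ _), Finset.card_insert_of_notMem huS,
        Finset.card_erase_of_mem hu, Finset.insert_erase hu, Nat.add_sub_cancel,
        Nat.sub_sub, Nat.add_comm 1]
    · intro S hS
      have huS : u ∉ S := fun h => Finset.notMem_erase u W (Finset.mem_powerset.1 hS h)
      rw [if_neg huS]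
  rw [Finset.sum_congr rfl h1, Finset.sum_comm]
  refine Finset.sum_congr rfl fun T hT => ?_
  rw [← Finset.sum_filter, Finset.filter_mem_eq_inter,
    Finset.inter_eq_right.2 (Finset.mem_powerset.1 hT), Finset.sum_const, nsmul_eq_mul]
  ring

/-- Double counting: the average of a monotone function over the subsets of a given size
increases with the size. -/
theorem sum_powersetCard_mul_le {W : Finset E} {f : Finset E → ℝ} (hf : Monotone f) {j : ℕ}
    (hj : j < W.card) :
    (∑ S ∈ W.powersetCard j, f S) * (W.card - j : ℝ) ≤
      (∑ T ∈ W.powersetCard (j + 1), f T) * (j + 1 : ℝ) := by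
  have h1 : (∑ S ∈ W.powersetCard j, f S) * (W.card - j : ℝ) =
      ∑ S ∈ W.powersetCard j, ∑ u ∈ W \ S, f S := by
    rw [Finset.sum_mul]
    refine Finset.sum_congr rfl fun S hS => ?_
    obtain ⟨hS1, hS2⟩ := Finset.mem_powersetCard.1 hS
    rw [Finset.sum_const, nsmul_eq_mul, Finset.card_sdiff_of_subset hS1, hS2,
      Nat.cast_sub hj.le, mul_comm]
  have h2 : (∑ T ∈ W.powersetCard (j + 1), f T) * (j + 1 : ℝ) =
      ∑ T ∈ W.powersetCard (j + 1), ∑ u ∈ T, f T := by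
    rw [Finset.sum_mul]
    refine Finset.sum_congr rfl fun S hS => ?_
    obtain ⟨hS1, hS2⟩ := Finset.mem_powersetCard.1 hS
    rw [Finset.sum_const, nsmul_eq_mul, hS2, mul_comm]
    push_cast
    rfl
  rw [h1, h2]
  calc ∑ S ∈ W.powersetCard j, ∑ u ∈ W \ S, f S
      ≤ ∑ S ∈ W.powersetCard j, ∑ u ∈ W \ S, f (insert u S) :=
        Finset.sum_le_sum fun S _ => Finset.sum_le_sum fun u _ => hf (Finset.subset_insert _ _)
    _ = ∑ T ∈ W.powersetCard (j + 1), ∑ u ∈ T, f T := by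
        rw [Finset.sum_sigma', Finset.sum_sigma']
        refine Finset.sum_bij' (fun x _ => ⟨insert x.2 x.1, x.2⟩)
          (fun x _ => ⟨x.1.erase x.2, x.2⟩) ?_ ?_ ?_ ?_ ?_
        · rintro ⟨S, u⟩ h
          simp only [Finset.mem_sigma, Finset.mem_powersetCard, Finset.mem_sdiff] at h ⊢
          refine ⟨⟨Finset.insert_subset h.2.1 h.1.1, ?_⟩, Finset.mem_insert_self _ _⟩
          rw [Finset.card_insert_of_notMem h.2.2, h.1.2]
        · rintro ⟨T, u⟩ h
          simp only [Finset.mem_sigma, Finset.mem_powersetCard, Finset.mem_sdiff] at h ⊢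
          refine ⟨⟨(Finset.erase_subset _ _).trans h.1.1, ?_⟩, h.1.1 h.2,
            Finset.notMem_erase _ _⟩
          rw [Finset.card_erase_of_mem h.2, h.1.2, Nat.add_sub_cancel]
        · rintro ⟨S, u⟩ h
          simp only [Finset.mem_sigma, Finset.mem_powersetCard, Finset.mem_sdiff] at h
          simp [Finset.erase_insert h.2.2]
        · rintro ⟨T, u⟩ h
          simp only [Finset.mem_sigma, Finset.mem_powersetCard] at h
          simp [Finset.insert_erase h.2]
        · rintro ⟨S, u⟩ h
          rfl

/-- If the increments `D` sum to zero and, from index `k` on, are first nonnegative and then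
nonpositive, then a monotone function `φ` into `[0, 1]` can gain at most the negative mass
below `k`. -/
theorem sum_mul_le_of_crossing {m k : ℕ} {D N B φ : ℕ → ℝ} (hkm : k ≤ m)
    (hN : ∀ j ≤ m, 0 ≤ N j) (hφ : ∀ i j, i ≤ j → j ≤ m → φ i ≤ φ j)
    (h0 : ∀ j ≤ m, 0 ≤ φ j) (h1 : ∀ j ≤ m, φ j ≤ 1)
    (hsum : ∑ j ∈ Finset.range (m + 1), N j * D j = 0)
    (hB : ∀ j ≤ m, -D j ≤ B j) (hB0 : ∀ j ≤ m, 0 ≤ B j)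
    (hcross : ∀ j, k ≤ j → j < m → D j < 0 → D (j + 1) < 0) :
    ∑ j ∈ Finset.range (m + 1), N j * D j * φ j ≤ ∑ j ∈ Finset.range k, N j * B j := by
  obtain ⟨c, hc0, hc1, hcl, hcr⟩ : ∃ c : ℝ, 0 ≤ c ∧ c ≤ 1 ∧ (∀ j < k, φ j ≤ c) ∧
      ∀ j, k ≤ j → j ≤ m → D j * (φ j - c) ≤ 0 := by
    by_cases hneg : ∃ j, k ≤ j ∧ j ≤ m ∧ D j < 0
    · classical
      let j₁ := Nat.find hneg
      obtain ⟨h₁, h₂, h₃⟩ := Nat.find_spec hneg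
      have hall : ∀ i, j₁ + i ≤ m → D (j₁ + i) < 0 := by
        intro i
        induction i with
        | zero => intro _; exact h₃
        | succ i ih =>
          intro hi
          exact hcross (j₁ + i) (h₁.trans (Nat.le_add_right _ _)) (by omega) (ih (by omega))
      refine ⟨φ j₁, h0 _ h₂, h1 _ h₂, fun j hj => hφ _ _ (hj.le.trans h₁) h₂, ?_⟩
      intro j hj hjm
      by_cases hlt : j < j₁
      · have hD : 0 ≤ D j := by
          by_contra hcon
          exact Nat.find_min hneg hlt ⟨hj, hjm, not_le.1 hcon⟩
        exact mul_nonpos_of_nonneg_of_nonpos hD (sub_nonpos.2 (hφ _ _ hlt.le h₂))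
      · obtain ⟨i, rfl⟩ := Nat.exists_eq_add_of_le (not_lt.1 hlt)
        exact mul_nonpos_of_nonpos_of_nonneg (hall i hjm).le
          (sub_nonneg.2 (hφ _ _ (Nat.le_add_right _ _) hjm))
    · push Not at hneg
      refine ⟨1, zero_le_one, le_rfl, fun j hj => h1 j (hj.le.trans hkm), fun j hj hjm => ?_⟩
      exact mul_nonpos_of_nonneg_of_nonpos (hneg j hj hjm) (sub_nonpos.2 (h1 j hjm))
  have e1 : ∑ j ∈ Finset.range (m + 1), N j * D j * φ j =
      ∑ j ∈ Finset.range (m + 1), N j * (D j * (φ j - c)) := by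
    have : ∑ j ∈ Finset.range (m + 1), N j * (D j * (φ j - c)) =
        ∑ j ∈ Finset.range (m + 1), N j * D j * φ j -
          c * ∑ j ∈ Finset.range (m + 1), N j * D j := by
      rw [Finset.mul_sum, ← Finset.sum_sub_distrib]
      exact Finset.sum_congr rfl fun j _ => by ring
    rw [this, hsum]
    ring
  have e2 : Finset.range (m + 1) = Finset.range k ∪ Finset.Ico k (m + 1) := by
    ext j
    simp only [Finset.mem_union, Finset.mem_range, Finset.mem_Ico]
    omega
  have e3 : Disjoint (Finset.range k) (Finset.Ico k (m + 1)) := by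
    rw [Finset.disjoint_left]
    intro j h1 h2
    simp only [Finset.mem_range, Finset.mem_Ico] at h1 h2
    omega
  rw [e1, e2, Finset.sum_union e3]
  have e4 : ∑ j ∈ Finset.Ico k (m + 1), N j * (D j * (φ j - c)) ≤ 0 := by
    refine Finset.sum_nonpos fun j hj => ?_
    obtain ⟨hj1, hj2⟩ := Finset.mem_Ico.1 hj
    exact mul_nonpos_of_nonneg_of_nonpos (hN j (by omega)) (hcr j hj1 (by omega))
  have e5 : ∑ j ∈ Finset.range k, N j * (D j * (φ j - c)) ≤
      ∑ j ∈ Finset.range k, N j * B j := by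
    refine Finset.sum_le_sum fun j hj => ?_
    have hjk := Finset.mem_range.1 hj
    have hjm : j ≤ m := by omega
    refine mul_le_mul_of_nonneg_left ?_ (hN j hjm)
    have a1 := hcl j hjk
    have a2 := h0 j hjm
    have a3 := hB j hjm
    have a4 := hB0 j hjm
    nlinarith [mul_nonneg (sub_nonneg.2 a1) (by linarith : 0 ≤ B j + D j),
      mul_nonneg a4 (by linarith : 0 ≤ 1 - (c - φ j))]
  linarith

/-- Planting a uniform element of `W` into a random subset of `W` with density `p'` is dominated
by a random subset of density `p`, up to the probability that the latter has fewer than `k`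
elements, as soon as the size `k` is at least as likely (per set) on the planted side: the ratio
of the two size distributions is log-concave, so that it then crosses `1` only once above `k`. -/
theorem planting_core {W : Finset E} {p p' : ℝ} {k : ℕ} (hp' : 0 < p') (hpp : p' ≤ p)
    (hp : p < 1) (hk : 1 ≤ k) (hkm : k ≤ W.card)
    (hAB : p ^ k * (1 - p) ^ (W.card - k) ≤
      (k / W.card : ℝ) * (p' ^ (k - 1) * (1 - p') ^ (W.card - k)))
    {f : Finset E → ℝ} (hf : Monotone f) (hf0 : ∀ S, 0 ≤ f S) (hf1 : ∀ S, f S ≤ 1) :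
    (∑ u ∈ W, bernE W (fun _ => p') (fun S => f (insert u S))) / W.card ≤
      bernE W (fun _ => p) f +
        ∑ j ∈ Finset.range k, (W.card.choose j : ℝ) * (p ^ j * (1 - p) ^ (W.card - j)) := by
  set m := W.card with hm
  have hm0 : (0 : ℝ) < m := by
    have : 0 < m := by omega
    exact_mod_cast this
  have hp0 : 0 < p := hp'.trans_le hpp
  have hq : 0 < 1 - p := by linarith
  have hq' : 0 < 1 - p' := by linarith
  set A : ℕ → ℝ := fun j => (j / m : ℝ) * (p' ^ (j - 1) * (1 - p') ^ (m - j)) with hA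
  set B : ℕ → ℝ := fun j => p ^ j * (1 - p) ^ (m - j) with hB
  have hA0 : ∀ j, 0 ≤ A j := fun j => by positivity
  have hB0 : ∀ j, 0 ≤ B j := fun j => by positivity
  have diff : ∀ g : Finset E → ℝ,
      (∑ u ∈ W, bernE W (fun _ => p') (fun S => g (insert u S))) / m -
        bernE W (fun _ => p) g =
      ∑ j ∈ Finset.range (m + 1), (A j - B j) * ∑ S ∈ W.powersetCard j, g S := by
    intro g
    rw [sum_bernE_insert, bernE_const_prob, Finset.sum_div, ← Finset.sum_sub_distrib,
      Finset.sum_powerset]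
    refine Finset.sum_congr rfl fun j _ => ?_
    rw [Finset.mul_sum]
    refine Finset.sum_congr rfl fun S hS => ?_
    rw [(Finset.mem_powersetCard.1 hS).2]
    simp only [hA, hB]
    ring
  have hN : ∀ j ≤ m, (0 : ℝ) < m.choose j := fun j hj => by
    exact_mod_cast Nat.choose_pos hj
  set φ : ℕ → ℝ := fun j => (∑ S ∈ W.powersetCard j, f S) / m.choose j with hφ
  have hstep : ∀ j, j < m → φ j ≤ φ (j + 1) := by
    intro j hj
    have h1 := sum_powersetCard_mul_le (W := W) hf (j := j) hj
    have h2 : ((m.choose (j + 1) : ℝ)) * (j + 1) = m.choose j * (m - j) := by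
      have := Nat.choose_succ_right_eq m j
      rw [← Nat.cast_sub hj.le]
      exact_mod_cast this
    have h3 := hN j hj.le
    have h4 := hN (j + 1) hj
    have h5 : (0 : ℝ) < m - j := by
      have : (j : ℝ) < m := by exact_mod_cast hj
      linarith
    simp only [hφ]
    rw [div_le_div_iff₀ h3 h4]
    have h6 : (0 : ℝ) < j + 1 := by positivity
    have : (∑ S ∈ W.powersetCard j, f S) * (m.choose (j + 1) : ℝ) * (j + 1) ≤
        (∑ S ∈ W.powersetCard (j + 1), f S) * (m.choose j) * (j + 1) := by
      calc (∑ S ∈ W.powersetCard j, f S) * (m.choose (j + 1) : ℝ) * (j + 1)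
          = m.choose j * ((∑ S ∈ W.powersetCard j, f S) * (m - j)) := by
            rw [mul_assoc, h2]; ring
        _ ≤ m.choose j * ((∑ S ∈ W.powersetCard (j + 1), f S) * (j + 1)) :=
            mul_le_mul_of_nonneg_left h1 h3.le
        _ = _ := by ring
    exact le_of_mul_le_mul_right this h6
  have hmono : ∀ i j, i ≤ j → j ≤ m → φ i ≤ φ j := by
    intro i j hij
    induction j, hij using Nat.le_induction with
    | base => intro _; exact le_rfl
    | succ j hij ih => intro hj; exact (ih (by omega)).trans (hstep j (by omega))
  have hφ0 : ∀ j ≤ m, 0 ≤ φ j := fun j hj =>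
    div_nonneg (Finset.sum_nonneg fun S _ => hf0 S) (hN j hj).le
  have hφ1 : ∀ j ≤ m, φ j ≤ 1 := by
    intro j hj
    rw [div_le_one (hN j hj)]
    calc ∑ S ∈ W.powersetCard j, f S ≤ ∑ S ∈ W.powersetCard j, (1 : ℝ) :=
          Finset.sum_le_sum fun S _ => hf1 S
      _ = m.choose j := by simp [Finset.card_powersetCard, hm]
  have hsum : ∑ j ∈ Finset.range (m + 1), (m.choose j : ℝ) * (A j - B j) = 0 := by
    have h := diff fun _ => 1
    simp only [bernE_one, Finset.sum_const, Finset.card_powersetCard, nsmul_eq_mul, mul_one,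
      ← hm, div_self hm0.ne', sub_self] at h
    rw [h]
    exact Finset.sum_congr rfl fun j _ => mul_comm _ _
  have hA1 : ∀ j, 1 ≤ j → j < m →
      A (j + 1) * (j * (1 - p')) = A j * ((j + 1) * p') := by
    intro j hj hjm
    obtain ⟨i, rfl⟩ := Nat.exists_eq_add_of_le' hj
    obtain ⟨l, hl⟩ := Nat.exists_eq_add_of_lt hjm
    have e1 : m - (i + 1) = l + 1 := by omega
    have e2 : m - (i + 1 + 1) = l := by omega
    simp only [hA, e1, e2, Nat.add_sub_cancel]
    push_cast
    ring
  have hB1 : ∀ j, j < m → B (j + 1) * (1 - p) = B j * p := by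
    intro j hjm
    obtain ⟨l, hl⟩ := Nat.exists_eq_add_of_lt hjm
    have e1 : m - j = l + 1 := by omega
    have e2 : m - (j + 1) = l := by omega
    simp only [hB, e1, e2]
    ring
  have hcross : ∀ j, k ≤ j → j < m → A j - B j < 0 → A (j + 1) - B (j + 1) < 0 := by
    intro j hkj hjm hneg
    by_contra hcon
    have hj0 : (0 : ℝ) < j := by
      have : 0 < j := by omega
      exact_mod_cast this
    -- the growth factor of `A` exceeds that of `B` at `j`, hence at all earlier indices
    have hfac : p * (j * (1 - p')) ≤ (j + 1) * p' * (1 - p) := by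
      by_contra hlt
      push Not at hlt
      have a1 := hA1 j (by omega) hjm
      have a2 := hB1 j hjm
      have a3 : B (j + 1) ≤ A (j + 1) := by linarith
      have a4 : A j < B j := by linarith
      have hBj : 0 < B j := by positivity
      have : B (j + 1) * (1 - p) * (j * (1 - p')) ≤ A (j + 1) * (j * (1 - p')) * (1 - p) := by
        have := mul_le_mul_of_nonneg_right a3 (by positivity : 0 ≤ (1 - p) * (j * (1 - p')))
        linarith
      rw [a1, a2] at this
      have h5 : A j * ((j + 1) * p' * (1 - p)) ≤ B j * ((j + 1) * p' * (1 - p)) :=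
        mul_le_mul_of_nonneg_right a4.le (by positivity)
      have h6 : B j * ((j + 1) * p' * (1 - p)) < B j * (p * (j * (1 - p'))) :=
        mul_lt_mul_of_pos_left hlt hBj
      nlinarith
    have hle : ∀ i, k ≤ i → i ≤ j → B i ≤ A i := by
      intro i hki
      induction i, hki using Nat.le_induction with
      | base => intro _; exact hAB
      | succ i hki ih =>
        intro hij
        have ih' := ih (by omega)
        have hi0 : (0 : ℝ) < i := by
          have : 0 < i := by omega
          exact_mod_cast this
        have hij' : (i : ℝ) ≤ j := by
          have : i ≤ j := by omega
          exact_mod_cast this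
        have hfi : p * (i * (1 - p')) ≤ (i + 1) * p' * (1 - p) := by
          have hpq : p' * (1 - p) ≤ p * (1 - p') := by nlinarith
          nlinarith [mul_nonneg (sub_nonneg.2 hij') (sub_nonneg.2 hpq)]
        have a1 := hA1 i (by omega) (by omega)
        have a2 := hB1 i (by omega)
        have : B (i + 1) * ((1 - p) * (i * (1 - p'))) ≤
            A (i + 1) * ((1 - p) * (i * (1 - p'))) := by
          calc B (i + 1) * ((1 - p) * (i * (1 - p')))
              = B i * (p * (i * (1 - p'))) := by rw [← mul_assoc, a2]; ring
            _ ≤ A i * ((i + 1) * p' * (1 - p)) :=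
                mul_le_mul ih' hfi (by positivity) (hA0 i)
            _ = A (i + 1) * (i * (1 - p')) * (1 - p) := by rw [a1]; ring
            _ = _ := by ring
        exact le_of_mul_le_mul_right this (by positivity)
    have := hle j hkj le_rfl
    linarith
  have main := sum_mul_le_of_crossing (m := m) (k := k) (D := fun j => A j - B j)
    (N := fun j => (m.choose j : ℝ)) (B := B) (φ := φ) hkm (fun j hj => (hN j hj).le) hmono
    hφ0 hφ1 hsum (fun j _ => by have := hA0 j; linarith) (fun j _ => hB0 j) hcross
  have hd := diff f
  have heq : ∑ j ∈ Finset.range (m + 1), (A j - B j) * ∑ S ∈ W.powersetCard j, f S =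
      ∑ j ∈ Finset.range (m + 1), (m.choose j : ℝ) * (A j - B j) * φ j := by
    refine Finset.sum_congr rfl fun j hj => ?_
    have := hN j (by have := Finset.mem_range.1 hj; omega)
    simp only [hφ]
    field_simp
  rw [heq] at hd
  linarith

end Bern

/-! ### Intensities and planting -/

section Planting

variable {E : Type*} [DecidableEq E] [Fintype E]

/-- The expectation of `f S` when `S` is the set of elements hit by independent Poisson clocks:
`e` belongs to `S` with probability `1 - exp (-lam e)`. In this parametrization unions of
independent sets correspond to sums of the intensities `lam`. -/
noncomputable def bernL (lam : E → ℝ) (f : Finset E → ℝ) : ℝ :=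
  bernE Finset.univ (fun e => 1 - Real.exp (-lam e)) f

theorem bernL_mono {lam : E → ℝ} (h0 : ∀ e, 0 ≤ lam e) {f g : Finset E → ℝ}
    (hfg : ∀ S, f S ≤ g S) : bernL lam f ≤ bernL lam g :=
  bernE_mono (fun e _ => sub_nonneg.2 (Real.exp_le_one_iff.2 (neg_nonpos.2 (h0 e))))
    (fun e _ => by have := Real.exp_pos (-lam e); linarith) hfg

theorem bernL_const (lam : E → ℝ) (c : ℝ) : bernL lam (fun _ => c) = c := bernE_const _ _ _

theorem bernL_nonneg {lam : E → ℝ} (h0 : ∀ e, 0 ≤ lam e) {f : Finset E → ℝ}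
    (hf : ∀ S, 0 ≤ f S) : 0 ≤ bernL lam f := by
  have := bernL_mono (f := fun _ => 0) h0 hf
  rwa [bernL_const] at this

/-- Adding the intensity `q` on `W` means adding an independent uniform-density random subset
of `W`. -/
theorem bernL_add_indicator (lam : E → ℝ) (W : Finset E) (q : ℝ) (f : Finset E → ℝ) :
    bernL (fun e => lam e + if e ∈ W then q else 0) f =
      bernL lam (fun S => bernE W (fun _ => 1 - Real.exp (-q)) (fun S' => f (S ∪ S'))) := by
  have h1 : ∀ S : Finset E, bernE W (fun _ => 1 - Real.exp (-q)) (fun S' => f (S ∪ S')) =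
      bernE Finset.univ (fun e => if e ∈ W then 1 - Real.exp (-q) else 0)
        (fun S' => f (S ∪ S')) := by
    intro S
    rw [bernE_restrict (Finset.subset_univ W) (fun e _ he => if_neg he)]
    exact bernE_congr fun e he => (if_pos he).symm
  unfold bernL
  simp only [h1]
  rw [bernE_union]
  refine bernE_congr fun e _ => ?_
  split_ifs
  · rw [neg_add, Real.exp_add]; ring
  · simp

/-- The numerical condition under which a uniform element of an `m`-set with intensity `L / m`
per element can be planted at the price `C / m` per element and with error `err`. The natural
number `k` is a size below which the random subset falls with probability at most `err`. -/
def Plantable (L C err : ℝ) (m : ℕ) : Prop :=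
  0 < C ∧ C < L ∧ ∃ k : ℕ, 1 ≤ k ∧ k ≤ m ∧
    Real.exp (C * (k / (L - C) - 1 + k / m)) ≤ k / (L - C) ∧
    ∑ j ∈ Finset.range k, (m.choose j : ℝ) *
      ((1 - Real.exp (-(L / m))) ^ j * Real.exp (-(L / m)) ^ (m - j)) ≤ err

/-- Concavity of `x ↦ 1 - exp (-x)`. -/
theorem one_sub_exp_neg_div_le {x y : ℝ} (hx : 0 < x) (hxy : x ≤ y) :
    (1 - Real.exp (-y)) * x ≤ (1 - Real.exp (-x)) * y := by
  have ha : 0 ≤ 1 - x / y := by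
    rw [sub_nonneg, div_le_one (hx.trans_le hxy)]; exact hxy
  have hb : 0 ≤ x / y := div_nonneg hx.le (hx.trans_le hxy).le
  have h := convexOn_exp.2 (Set.mem_univ (0 : ℝ)) (Set.mem_univ (-y)) ha hb (by ring)
  have hy : 0 < y := hx.trans_le hxy
  have e1 : (1 - x / y) • (0 : ℝ) + (x / y) • (-y) = -x := by
    simp only [smul_eq_mul]; field_simp; ring
  rw [e1] at h
  simp only [smul_eq_mul, Real.exp_zero] at h
  have h2 := mul_le_mul_of_nonneg_right h hy.le
  have e2 : ((1 - x / y) * 1 + x / y * Real.exp (-y)) * y = y - x + x * Real.exp (-y) := by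
    field_simp
  rw [e2] at h2
  nlinarith

/-- **Planting.** Adding a uniformly random element of `W` costs an intensity `C / |W|` on the
elements of `W`. -/
theorem planting {W : Finset E} {L C err : ℝ} (hPl : Plantable L C err W.card)
    {lam : E → ℝ} (h0 : ∀ e, 0 ≤ lam e) (hlam : ∀ e ∈ W, L / W.card ≤ lam e)
    {f : Finset E → ℝ} (hf : Monotone f) (hf0 : ∀ S, 0 ≤ f S) (hf1 : ∀ S, f S ≤ 1) :
    (∑ u ∈ W, bernL (fun e => lam e - if e ∈ W then C / W.card else 0)
      (fun S => f (insert u S))) / W.card ≤ bernL lam f + err := by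
  obtain ⟨hC, hCL, k, hk1, hkm, hexp, herr⟩ := hPl
  set m := W.card with hm
  have hm0 : (0 : ℝ) < m := by
    have : 0 < m := by omega
    exact_mod_cast this
  have hk0 : (0 : ℝ) < k := by
    have : 0 < k := by omega
    exact_mod_cast this
  set q := L / m with hq
  set q' := (L - C) / m with hq'
  have hLC : 0 < L - C := by linarith
  have hq'0 : 0 < q' := div_pos hLC hm0
  have hqq : q' ≤ q := by
    rw [hq, hq']; gcongr; linarith
  -- the base intensity, left over after setting aside a uniform layer on `W`
  set rho : E → ℝ := fun e => lam e - if e ∈ W then q else 0 with hrho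
  have hrho0 : ∀ e, 0 ≤ rho e := by
    intro e
    simp only [hrho]
    split_ifs with he
    · exact sub_nonneg.2 (hlam e he)
    · simpa using h0 e
  have e1 : lam = fun e => rho e + if e ∈ W then q else 0 := by
    funext e; simp [hrho]
  have e2 : (fun e => lam e - if e ∈ W then C / m else 0) =
      fun e => rho e + if e ∈ W then q' else 0 := by
    funext e
    simp only [hrho]
    split_ifs
    · simp only [hq, hq']; ring
    · ring
  have hPP : 1 - Real.exp (-q') ≤ 1 - Real.exp (-q) := by
    have : Real.exp (-q) ≤ Real.exp (-q') := Real.exp_le_exp.2 (by linarith)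
    linarith
  have hP'0 : 0 < 1 - Real.exp (-q') := by
    have : Real.exp (-q') < 1 := Real.exp_lt_one_iff.2 (by linarith)
    linarith
  have hAB : (1 - Real.exp (-q)) ^ k * (1 - (1 - Real.exp (-q))) ^ (m - k) ≤
      (k / m : ℝ) * ((1 - Real.exp (-q')) ^ (k - 1) *
        (1 - (1 - Real.exp (-q'))) ^ (m - k)) := by
    set P := 1 - Real.exp (-q)
    set P' := 1 - Real.exp (-q') with hP'
    rw [sub_sub_cancel, sub_sub_cancel]
    have b1 : P * q' ≤ P' * q := one_sub_exp_neg_div_le hq'0 hqq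
    have b2 : P ≤ P' * (L / (L - C)) := by
      have : L / (L - C) = q / q' := by
        rw [hq, hq']; field_simp
      rw [this, ← mul_div_assoc, le_div_iff₀ hq'0]
      exact b1
    have b3 : L / (L - C) ≤ Real.exp (C / (L - C)) := by
      have := Real.add_one_le_exp (C / (L - C))
      have h : C / (L - C) + 1 = L / (L - C) := by field_simp; ring
      linarith
    have b4 : P' * m ≤ L - C := by
      have := Real.add_one_le_exp (-q')
      have h : P' ≤ q' := by rw [hP']; linarith
      calc P' * m ≤ q' * m := mul_le_mul_of_nonneg_right h hm0.le
        _ = L - C := by rw [hq']; field_simp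
    have b5 : P ≤ P' * Real.exp (C / (L - C)) :=
      b2.trans (mul_le_mul_of_nonneg_left b3 hP'0.le)
    have b6 : P ^ k ≤ P' ^ k * Real.exp (k * (C / (L - C))) := by
      rw [Real.exp_nat_mul, ← mul_pow]
      exact pow_le_pow_left₀ (hP'0.le.trans hPP) b5 k
    have b7 : Real.exp (-q) ^ (m - k) =
        Real.exp (-q') ^ (m - k) * Real.exp (-(C / m) * (m - k)) := by
      rw [← Real.exp_nat_mul, ← Real.exp_nat_mul, ← Real.exp_add, Nat.cast_sub hkm]
      congr 1
      rw [hq, hq']; ring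
    have b8 : P' * m * Real.exp (C * (k / (L - C) - 1 + k / m)) ≤ k := by
      calc P' * m * Real.exp (C * (k / (L - C) - 1 + k / m))
          ≤ (L - C) * (k / (L - C)) :=
            mul_le_mul b4 hexp (Real.exp_pos _).le hLC.le
        _ = k := by field_simp
    have b9 : P' ^ k = P' * P' ^ (k - 1) := by
      rw [← pow_succ', Nat.sub_add_cancel hk1]
    calc P ^ k * Real.exp (-q) ^ (m - k)
        ≤ (P' ^ k * Real.exp (k * (C / (L - C)))) *
          (Real.exp (-q') ^ (m - k) * Real.exp (-(C / m) * (m - k))) := by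
          rw [b7]
          exact mul_le_mul_of_nonneg_right b6 (by positivity)
      _ = (P' * m * (Real.exp (k * (C / (L - C))) * Real.exp (-(C / m) * (m - k)))) / m *
          (P' ^ (k - 1) * Real.exp (-q') ^ (m - k)) := by
          have hm1 : ∀ X : ℝ, P' * m * X / m = P' * X := fun X => by
            rw [mul_right_comm, mul_div_assoc, div_self hm0.ne', mul_one]
          rw [b9, hm1]; ring
      _ = (P' * m * Real.exp (C * (k / (L - C) - 1 + k / m))) / m *
          (P' ^ (k - 1) * Real.exp (-q') ^ (m - k)) := by
          have hCm : C / m * m = C := div_mul_cancel₀ _ hm0.ne'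
          rw [← Real.exp_add, show (k : ℝ) * (C / (L - C)) + -(C / m) * (m - k) =
            C * (k / (L - C) - 1 + k / m) by linear_combination -hCm]
      _ ≤ k / m * (P' ^ (k - 1) * Real.exp (-q') ^ (m - k)) :=
          mul_le_mul_of_nonneg_right (div_le_div_of_nonneg_right b8 hm0.le)
            (mul_nonneg (pow_nonneg hP'0.le _) (pow_nonneg (Real.exp_pos _).le _))
  have hcore : ∀ S : Finset E,
      (∑ u ∈ W, bernE W (fun _ => 1 - Real.exp (-q')) (fun S' => f (S ∪ insert u S'))) / m ≤
        bernE W (fun _ => 1 - Real.exp (-q)) (fun S' => f (S ∪ S')) + err := by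
    intro S
    have h := planting_core (W := W) hP'0 hPP (by have := Real.exp_pos (-q); linarith) hk1 hkm
      hAB (f := fun S' => f (S ∪ S'))
      (fun A B hAB => hf (Finset.union_subset_union_right hAB)) (fun _ => hf0 _) (fun _ => hf1 _)
    refine h.trans ?_
    simp only [sub_sub_cancel]
    linarith
  rw [e2]
  conv_rhs => rw [e1, bernL_add_indicator]
  simp only [bernL_add_indicator, ← Finset.union_insert]
  have e3 : (∑ u ∈ W, bernL rho fun S => bernE W (fun _ => 1 - Real.exp (-q')) fun S' =>
      f (S ∪ insert u S')) / m = bernL rho fun S =>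
      (∑ u ∈ W, bernE W (fun _ => 1 - Real.exp (-q')) fun S' => f (S ∪ insert u S')) / m := by
    simp only [div_eq_inv_mul]
    unfold bernL
    rw [bernE_const_mul, bernE_sum]
  rw [e3]
  refine (bernL_mono hrho0 hcore).trans ?_
  unfold bernL
  rw [bernE_add, bernE_const]

/-- Chernoff bound for the lower tail in `Plantable`. -/
theorem binomial_lower_tail_le {m k : ℕ} {L z : ℝ} (hm : 0 < m) (hL : 0 < L) (hz : 0 < z)
    (hz1 : z ≤ 1) (hkm : k ≤ m) :
    ∑ j ∈ Finset.range k, (m.choose j : ℝ) *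
      ((1 - Real.exp (-(L / m))) ^ j * Real.exp (-(L / m)) ^ (m - j)) ≤
    z⁻¹ ^ k * Real.exp (-((1 - z) * (L / (1 + L / m)))) := by
  have hm0 : (0 : ℝ) < m := by exact_mod_cast hm
  set P := 1 - Real.exp (-(L / m)) with hP
  have hE : Real.exp (-(L / m)) = 1 - P := by rw [hP]; ring
  have hq : 0 < L / m := by positivity
  have hP0 : 0 ≤ P := by
    have : Real.exp (-(L / m)) < 1 := Real.exp_lt_one_iff.2 (by linarith)
    linarith
  have hP1 : 0 ≤ 1 - P := by rw [← hE]; exact (Real.exp_pos _).le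
  have hPm : L / (1 + L / m) ≤ P * m := by
    have h1 := Real.add_one_le_exp (L / m)
    have h2 : Real.exp (-(L / m)) ≤ 1 / (1 + L / m) := by
      rw [Real.exp_neg, inv_eq_one_div]
      exact one_div_le_one_div_of_le (by positivity) (by linarith)
    have h3 : (L / m) / (1 + L / m) ≤ P := by
      have : (L / m) / (1 + L / m) = 1 - 1 / (1 + L / m) := by field_simp; ring
      rw [this]; linarith
    calc L / (1 + L / m) = (L / m) / (1 + L / m) * m := by field_simp
      _ ≤ P * m := mul_le_mul_of_nonneg_right h3 hm0.le
  rw [hE]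
  calc ∑ j ∈ Finset.range k, (m.choose j : ℝ) * (P ^ j * (1 - P) ^ (m - j))
      ≤ ∑ j ∈ Finset.range k, z⁻¹ ^ k * ((z * P) ^ j * (1 - P) ^ (m - j) * m.choose j) := by
        refine Finset.sum_le_sum fun j hj => ?_
        have hjk : j ≤ k := (Finset.mem_range.1 hj).le
        have h1 : 1 ≤ z⁻¹ ^ k * z ^ j := by
          obtain ⟨i, rfl⟩ := Nat.exists_eq_add_of_le hjk
          rw [pow_add, mul_right_comm, ← mul_pow, inv_mul_cancel₀ hz.ne', one_pow, one_mul]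
          exact one_le_pow₀ ((one_le_inv₀ hz).2 hz1)
        have h2 : 0 ≤ (m.choose j : ℝ) * (P ^ j * (1 - P) ^ (m - j)) := by positivity
        calc (m.choose j : ℝ) * (P ^ j * (1 - P) ^ (m - j))
            ≤ (z⁻¹ ^ k * z ^ j) * ((m.choose j : ℝ) * (P ^ j * (1 - P) ^ (m - j))) :=
              le_mul_of_one_le_left h2 h1
          _ = _ := by rw [mul_pow]; ring
    _ ≤ ∑ j ∈ Finset.range (m + 1),
          z⁻¹ ^ k * ((z * P) ^ j * (1 - P) ^ (m - j) * m.choose j) := by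
        refine Finset.sum_le_sum_of_subset_of_nonneg ?_ fun j _ _ => by positivity
        exact Finset.range_subset_range.2 (by omega)
    _ = z⁻¹ ^ k * (z * P + (1 - P)) ^ m := by
        rw [add_pow, Finset.mul_sum]
    _ ≤ z⁻¹ ^ k * Real.exp (-((1 - z) * P)) ^ m := by
        have h1 : 0 ≤ z * P + (1 - P) := by positivity
        have h2 : z * P + (1 - P) ≤ Real.exp (-((1 - z) * P)) := by
          have := Real.add_one_le_exp (-((1 - z) * P))
          linarith
        gcongr
    _ ≤ z⁻¹ ^ k * Real.exp (-((1 - z) * (L / (1 + L / m)))) := by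
        rw [← Real.exp_nat_mul]
        have h1 : (m : ℝ) * -((1 - z) * P) ≤ -((1 - z) * (L / (1 + L / m))) := by
          have := mul_le_mul_of_nonneg_left hPm (sub_nonneg.2 hz1)
          linarith
        gcongr

end Planting

/-! ### Iterated planting -/

section Iterate

variable {E : Type*} [DecidableEq E] [Fintype E]

/-- One planting step inside an experiment `Ω`. The planted set `P` and the intensities `lam`
become `P'` and `lam'`; the new element is uniform given all the rest because the bijections
`ρ c` of the sample space resample it. -/
theorem planting_step {Ω ι : Type*} [Fintype Ω] [Nonempty Ω] [Fintype ι] [Nonempty ι]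
    {L C err : ℝ} (hPl : Plantable L C err (Fintype.card ι)) (ρ : ι → Ω ≃ Ω)
    {P P' : Ω → Finset E} {lam lam' : Ω → E → ℝ} {edge : Ω → ι → E} {star : Ω → Finset E}
    (hinj : ∀ ω, Function.Injective (edge ω))
    (hstar : ∀ ω, star ω = Finset.univ.image (edge ω))
    (hP : ∀ ω c, P' (ρ c ω) = insert (edge ω c) (P ω))
    (hlam : ∀ ω c e, lam' (ρ c ω) e =
      lam ω e - if e ∈ star ω then C / Fintype.card ι else 0)
    (hlow : ∀ ω e, L / Fintype.card ι ≤ lam ω e)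
    {f : Finset E → ℝ} (hf : Monotone f) (hf0 : ∀ S, 0 ≤ f S) (hf1 : ∀ S, f S ≤ 1) :
    Finset.univ.expect (fun ω => bernL (lam' ω) (fun S => f (P' ω ∪ S))) ≤
      Finset.univ.expect (fun ω => bernL (lam ω) (fun S => f (P ω ∪ S))) + err := by
  classical
  have hcard : ∀ ω, (star ω).card = Fintype.card ι := fun ω => by
    rw [hstar, Finset.card_image_of_injective _ (hinj ω), Finset.card_univ]
  have hι : (0 : ℝ) < Fintype.card ι := by exact_mod_cast Fintype.card_pos
  have hL : 0 < L := hPl.1.trans hPl.2.1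
  have h1 : ∀ c, Finset.univ.expect (fun ω => bernL (lam' ω) (fun S => f (P' ω ∪ S))) =
      Finset.univ.expect (fun ω => bernL (lam' (ρ c ω)) (fun S => f (P' (ρ c ω) ∪ S))) :=
    fun c => (Fintype.expect_equiv (ρ c) _ _ fun ω => rfl).symm
  have h2 : Finset.univ.expect (fun ω => bernL (lam' ω) (fun S => f (P' ω ∪ S))) =
      Finset.univ.expect (fun ω => Finset.univ.expect fun c : ι =>
        bernL (lam' (ρ c ω)) (fun S => f (P' (ρ c ω) ∪ S))) := by
    rw [Finset.expect_comm]
    rw [← Finset.expect_const (Finset.univ_nonempty (α := ι))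
      (Finset.univ.expect (fun ω => bernL (lam' ω) (fun S => f (P' ω ∪ S))))]
    exact Finset.expect_congr rfl fun c _ => h1 c
  have h3 : ∀ ω, (Finset.univ.expect fun c : ι =>
      bernL (lam' (ρ c ω)) (fun S => f (P' (ρ c ω) ∪ S))) ≤
      bernL (lam ω) (fun S => f (P ω ∪ S)) + err := by
    intro ω
    have hpl := planting (W := star ω) (L := L) (C := C) (err := err) (by rw [hcard]; exact hPl)
      (lam := lam ω) (fun e => (div_pos hL hι).le.trans (hlow ω e))
      (fun e _ => by rw [hcard]; exact hlow ω e) (f := fun S => f (P ω ∪ S))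
      (fun A B hAB => hf (Finset.union_subset_union_right hAB)) (fun _ => hf0 _) (fun _ => hf1 _)
    refine le_trans (le_of_eq ?_) hpl
    rw [Fintype.expect_eq_sum_div_card, hcard]
    congr 1
    conv_rhs => rw [hstar]
    rw [Finset.sum_image fun a _ b _ h => hinj ω h]
    refine Finset.sum_congr rfl fun c _ => ?_
    congr 1
    · funext e; rw [hlam, hstar]
    · funext S
      rw [hP, Finset.insert_union, Finset.union_insert]
  rw [h2]
  calc _ ≤ Finset.univ.expect (fun ω => bernL (lam ω) (fun S => f (P ω ∪ S)) + err) :=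
        Finset.expect_le_expect fun ω _ => h3 ω
    _ = _ := by
        rw [Finset.expect_add_distrib, Finset.expect_const Finset.univ_nonempty]

/-- Iterating a planting experiment `d` times independently, as long as the total cost leaves
the intensity `low`. -/
theorem planting_rounds {Ω : Type*} [Fintype Ω] [Nonempty Ω] {P : Ω → Finset E}
    {cost : Ω → E → ℝ} {low err : ℝ} (hc0 : ∀ ω e, 0 ≤ cost ω e)
    (hc1 : ∀ ω e, cost ω e ≤ low) (herr : 0 ≤ err)
    (hround : ∀ (lam : E → ℝ), (∀ e, low ≤ lam e) → ∀ f : Finset E → ℝ, Monotone f →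
      (∀ S, 0 ≤ f S) → (∀ S, f S ≤ 1) →
      Finset.univ.expect (fun ω => bernL (fun e => lam e - cost ω e) (fun S => f (P ω ∪ S))) ≤
        bernL lam f + err)
    (d : ℕ) {lam : E → ℝ} (hlow : ∀ e, low ≤ lam e) {f : Finset E → ℝ} (hf : Monotone f)
    (hf0 : ∀ S, 0 ≤ f S) (hf1 : ∀ S, f S ≤ 1) :
    Finset.univ.expect (fun ω : Fin d → Ω =>
      open scoped Classical in
      if ∀ e, ∑ i, cost (ω i) e ≤ lam e - low then f (Finset.univ.biUnion fun i => P (ω i))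
      else 0) ≤ bernL lam f + d * err := by
  classical
  have hlow0 : ∀ e : E, 0 ≤ low := fun e =>
    (hc0 (Classical.arbitrary Ω) e).trans (hc1 _ e)
  induction d generalizing lam f with
  | zero =>
    simp only [Finset.univ_eq_empty, Finset.sum_empty, Finset.biUnion_empty]
    rw [Finset.expect_const Finset.univ_nonempty, if_pos fun e => sub_nonneg.2 (hlow e)]
    simp only [Nat.cast_zero, zero_mul, add_zero]
    calc f ∅ = bernL lam (fun _ => f ∅) := (bernL_const _ _).symm
      _ ≤ bernL lam f := bernL_mono (fun e => (hlow0 e).trans (hlow e)) fun S =>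
          hf (Finset.empty_subset S)
  | succ d ih =>
    have e1 : ∀ F : (Fin (d + 1) → Ω) → ℝ, Finset.univ.expect F =
        Finset.univ.expect (fun ω₀ : Ω => Finset.univ.expect fun ω : Fin d → Ω =>
          F (Fin.cons ω₀ ω)) := by
      intro F
      rw [← Finset.expect_product' (s := Finset.univ) (t := Finset.univ)
        (f := fun ω₀ (ω : Fin d → Ω) => F (Fin.cons ω₀ ω)), Finset.univ_product_univ]
      exact (Fintype.expect_equiv (Fin.consEquiv fun _ => Ω) _ _ fun _ => rfl).symm
    rw [e1]
    have h1 : ∀ ω₀ : Ω, (Finset.univ.expect fun ω : Fin d → Ω =>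
        if ∀ e, ∑ i, cost ((Fin.cons ω₀ ω : Fin (d + 1) → Ω) i) e ≤ lam e - low then
          f (Finset.univ.biUnion fun i => P ((Fin.cons ω₀ ω : Fin (d + 1) → Ω) i)) else 0) ≤
        bernL (fun e => lam e - cost ω₀ e) (fun S => f (P ω₀ ∪ S)) + d * err := by
      intro ω₀
      by_cases hok : ∀ e, low ≤ lam e - cost ω₀ e
      · refine le_trans (le_of_eq ?_) (ih (lam := fun e => lam e - cost ω₀ e) hok
          (f := fun S => f (P ω₀ ∪ S))
          (fun A B hAB => hf (Finset.union_subset_union_right hAB)) (fun _ => hf0 _)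
          (fun _ => hf1 _))
        refine Finset.expect_congr rfl fun ω _ => ?_
        have hb : (Finset.univ.biUnion fun i => P ((Fin.cons ω₀ ω : Fin (d + 1) → Ω) i)) =
            P ω₀ ∪ Finset.univ.biUnion fun i => P (ω i) := by
          ext e
          simp [Fin.exists_fin_succ]
        rw [hb]
        refine if_congr (forall_congr' fun e => ?_) rfl rfl
        rw [Fin.sum_univ_succ]
        simp only [Fin.cons_zero, Fin.cons_succ]
        constructor <;> intro h <;> linarith
      · have hz : ∀ ω : Fin d → Ω,
            ¬ ∀ e, ∑ i, cost ((Fin.cons ω₀ ω : Fin (d + 1) → Ω) i) e ≤ lam e - low := by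
          intro ω hall
          refine hok fun e => ?_
          have := hall e
          rw [Fin.sum_univ_succ] at this
          simp only [Fin.cons_zero, Fin.cons_succ] at this
          have h2 : 0 ≤ ∑ i, cost (ω i) e := Finset.sum_nonneg fun i _ => hc0 _ _
          linarith
        simp only [if_neg (hz _)]
        rw [Finset.expect_const Finset.univ_nonempty]
        have : 0 ≤ bernL (fun e => lam e - cost ω₀ e) (fun S => f (P ω₀ ∪ S)) :=
          bernL_nonneg (fun e => sub_nonneg.2 ((hc1 ω₀ e).trans (hlow e))) fun _ => hf0 _
        positivity
    calc _ ≤ Finset.univ.expect (fun ω₀ =>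
          bernL (fun e => lam e - cost ω₀ e) (fun S => f (P ω₀ ∪ S)) + d * err) :=
          Finset.expect_le_expect fun ω₀ _ => h1 ω₀
      _ ≤ bernL lam f + err + d * err := by
          rw [Finset.expect_add_distrib, Finset.expect_const Finset.univ_nonempty]
          linarith [hround lam hlow f hf hf0 hf1]
      _ = _ := by push_cast; ring

end Iterate

/-! ### One round: random pairs followed by random choices -/

section Round

/-- The vertex at position `a` of `Fin n`, for `a < n`. -/
def vpos (n : ℕ) [NeZero n] (a : ℕ) : Fin n := Fin.ofNat n a

theorem vpos_val {n : ℕ} [NeZero n] {a : ℕ} (h : a < n) : (vpos n a).val = a :=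
  Nat.mod_eq_of_lt h

/-- The pairs of positions `{0, 1}, {2, 3}, …`, the first `t` of them. -/
def pairsPat (n : ℕ) [NeZero n] (t : ℕ) : Finset (Sym2 (Fin n)) :=
  (Finset.range t).image fun s => s(vpos n (2 * s), vpos n (2 * s + 1))

/-- The possible values of the `s`-th pair once the vertices at positions up to `2 * s` are
known. -/
def pairStar (n : ℕ) [NeZero n] (s : ℕ) : Finset (Sym2 (Fin n)) :=
  Finset.univ.image fun b : {b : Fin n // 2 * s < b.val} => s(vpos n (2 * s), b.1)

/-- The intensity spent on a pair of positions by planting the first `t` pairs. -/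
noncomputable def pairCost (n : ℕ) [NeZero n] (C : ℝ) (t : ℕ) (e : Sym2 (Fin n)) : ℝ :=
  ∑ s ∈ Finset.range t,
    if e ∈ pairStar n s then C / Fintype.card {b : Fin n // 2 * s < b.val} else 0

/-- The choices made by the positions from `2 * T` on: the `j`-th choice of position `2 * T + i`
is position `2 * T + φ (i, j)`. Only the choices with index in `A` are listed. -/
def choicePat (n : ℕ) [NeZero n] (T : ℕ) {u k : ℕ} (A : Finset (Fin u × Fin k))
    (φ : Fin u × Fin k → Fin u) : Finset (Sym2 (Fin n)) :=
  A.image fun a => s(vpos n (2 * T + a.1), vpos n (2 * T + φ a))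

/-- The possible values of a choice of position `2 * T + i`. -/
def choiceStar (n : ℕ) [NeZero n] (T u : ℕ) (i : Fin u) : Finset (Sym2 (Fin n)) :=
  Finset.univ.image fun c : Fin u => s(vpos n (2 * T + i), vpos n (2 * T + c))

/-- The intensity spent on a pair of positions by planting the choices with index in `A`. -/
noncomputable def choiceCost (n : ℕ) [NeZero n] (C : ℝ) (T : ℕ) {u k : ℕ}
    (A : Finset (Fin u × Fin k)) (e : Sym2 (Fin n)) : ℝ :=
  ∑ a ∈ A, if e ∈ choiceStar n T u a.1 then C / u else 0

/-- The pattern planted in one round: `T` pairs, and `k` choices for each of the other `u`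
positions. -/
def plantPat (n : ℕ) [NeZero n] (T : ℕ) {u k : ℕ} (φ : Fin u × Fin k → Fin u) :
    Finset (Sym2 (Fin n)) :=
  pairsPat n T ∪ choicePat n T Finset.univ φ

/-- The intensity spent on a pair of positions in one round. -/
noncomputable def plantCost (n : ℕ) [NeZero n] (C : ℝ) (T u k : ℕ) (e : Sym2 (Fin n)) : ℝ :=
  pairCost n C T e + choiceCost n C T (Finset.univ : Finset (Fin u × Fin k)) e

variable {n : ℕ} [NeZero n]

theorem mem_pairStar_swap {s t : ℕ} (hst : s ≤ t) (ht : 2 * t + 1 < n)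
    (b : {b : Fin n // 2 * t < b.val}) (e : Sym2 (Fin n)) :
    Sym2.map (Equiv.swap (vpos n (2 * t + 1)) b.1) e ∈ pairStar n s ↔ e ∈ pairStar n s := by
  have key : ∀ e : Sym2 (Fin n), e ∈ pairStar n s →
      Sym2.map (Equiv.swap (vpos n (2 * t + 1)) b.1) e ∈ pairStar n s := by
    intro e he
    obtain ⟨c, -, rfl⟩ := Finset.mem_image.1 he
    have h1 : (vpos n (2 * t + 1)).val = 2 * t + 1 := vpos_val ht
    have h2 : (vpos n (2 * s)).val = 2 * s := vpos_val (by omega)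
    have h3 : Equiv.swap (vpos n (2 * t + 1)) b.1 (vpos n (2 * s)) = vpos n (2 * s) := by
      refine Equiv.swap_apply_of_ne_of_ne ?_ ?_
      · intro h; have := congrArg Fin.val h; omega
      · intro h; have := congrArg Fin.val h; have := b.2; omega
    have h4 : 2 * s < (Equiv.swap (vpos n (2 * t + 1)) b.1 c.1).val := by
      rw [Equiv.swap_apply_def]
      split_ifs
      · have := b.2; omega
      · omega
      · exact c.2
    refine Finset.mem_image.2 ⟨⟨_, h4⟩, Finset.mem_univ _, ?_⟩
    simp [h3]
  refine ⟨fun h => ?_, key e⟩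
  have := key _ h
  rwa [Sym2.map_map, ← Equiv.coe_trans, Equiv.swap_swap, Equiv.coe_refl, Sym2.map_id, id] at this

theorem mem_image_sym2_map {n : ℕ} (σ : Equiv.Perm (Fin n)) (A : Finset (Sym2 (Fin n)))
    (e : Sym2 (Fin n)) :
    e ∈ A.image (Sym2.map σ) ↔ Sym2.map σ.symm e ∈ A := by
  constructor
  · intro h
    obtain ⟨e', he', rfl⟩ := Finset.mem_image.1 h
    rwa [Sym2.map_map, Equiv.symm_comp_self, Sym2.map_id, id]
  · intro h
    refine Finset.mem_image.2 ⟨_, h, ?_⟩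
    rw [Sym2.map_map, Equiv.self_comp_symm, Sym2.map_id, id]

theorem card_gt_subtype {n s : ℕ} (hs : 2 * s < n) :
    Fintype.card {b : Fin n // 2 * s < b.val} = n - 1 - 2 * s := by
  have h : (Finset.univ.filter fun b : Fin n => 2 * s < b.val) = Finset.Ioi ⟨2 * s, hs⟩ := by
    ext b; simp [Fin.lt_def]
  rw [Fintype.card_subtype, h, Fin.card_Ioi]

/-- Planting the pair at positions `2 * t` and `2 * t + 1` of a uniformly random ordering of the
vertices: transpositions resample the second vertex of the pair. -/
theorem pairs_step {t : ℕ} (ht : 2 * t + 1 < n)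
    {L C err : ℝ} (hPl : Plantable L C err (n - 1 - 2 * t)) {lam : Sym2 (Fin n) → ℝ}
    (hlow : ∀ e e', L / (n - 1 - 2 * t : ℕ) ≤ lam e - pairCost n C t e')
    {f : Finset (Sym2 (Fin n)) → ℝ} (hf : Monotone f) (hf0 : ∀ S, 0 ≤ f S)
    (hf1 : ∀ S, f S ≤ 1) :
    Finset.univ.expect (fun σ : Equiv.Perm (Fin n) =>
      bernL (fun e => lam e - pairCost n C (t + 1) (Sym2.map σ.symm e))
        (fun S => f ((pairsPat n (t + 1)).image (Sym2.map σ) ∪ S))) ≤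
    Finset.univ.expect (fun σ : Equiv.Perm (Fin n) =>
      bernL (fun e => lam e - pairCost n C t (Sym2.map σ.symm e))
        (fun S => f ((pairsPat n t).image (Sym2.map σ) ∪ S))) + err := by
  have hcard : Fintype.card {b : Fin n // 2 * t < b.val} = n - 1 - 2 * t :=
    card_gt_subtype (by omega)
  have v1 : (vpos n (2 * t + 1)).val = 2 * t + 1 := vpos_val ht
  have : Nonempty {b : Fin n // 2 * t < b.val} := ⟨⟨vpos n (2 * t + 1), by omega⟩⟩
  have hfix : ∀ (b : {b : Fin n // 2 * t < b.val}) (a : ℕ), a ≤ 2 * t →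
      Equiv.swap (vpos n (2 * t + 1)) b.1 (vpos n a) = vpos n a := by
    intro b a ha
    have v2 : (vpos n a).val = a := vpos_val (by omega)
    refine Equiv.swap_apply_of_ne_of_ne ?_ ?_
    · intro h; have := congrArg Fin.val h; omega
    · intro h; have := congrArg Fin.val h; have := b.2; omega
  refine planting_step (L := L) (C := C) (ι := {b : Fin n // 2 * t < b.val})
    (by rw [hcard]; exact hPl)
    (fun b => Equiv.mulRight (Equiv.swap (vpos n (2 * t + 1)) b.1))
    (edge := fun σ b => s(σ (vpos n (2 * t)), σ b.1))
    (star := fun σ => (pairStar n t).image (Sym2.map σ)) ?_ ?_ ?_ ?_ ?_ hf hf0 hf1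
  · intro σ b c h
    exact Subtype.ext (σ.injective (Sym2.congr_right.1 h))
  · intro σ
    rw [pairStar, Finset.image_image]
    rfl
  · intro σ b
    have e1 : pairsPat n (t + 1) = insert s(vpos n (2 * t), vpos n (2 * t + 1)) (pairsPat n t) := by
      rw [pairsPat, Finset.range_add_one, Finset.image_insert]; rfl
    rw [e1, Finset.image_insert]
    congr 1
    · simp [hfix b _ le_rfl]
    · rw [pairsPat, Finset.image_image, Finset.image_image]
      refine Finset.image_congr fun s hs => ?_
      have hs' : s < t := by simpa using hs
      simp [hfix b (2 * s) (by omega), hfix b (2 * s + 1) (by omega)]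
  · intro σ b e
    have e1 : Sym2.map (Equiv.mulRight (Equiv.swap (vpos n (2 * t + 1)) b.1) σ).symm e =
        Sym2.map (Equiv.swap (vpos n (2 * t + 1)) b.1) (Sym2.map σ.symm e) := by
      rw [Sym2.map_map]
      congr 1
    have e2 : pairCost n C (t + 1)
          (Sym2.map (Equiv.mulRight (Equiv.swap (vpos n (2 * t + 1)) b.1) σ).symm e) =
        pairCost n C (t + 1) (Sym2.map σ.symm e) := by
      rw [e1]
      refine Finset.sum_congr rfl fun s hs => ?_
      have hs' : s ≤ t := by have := Finset.mem_range.1 hs; omega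
      simp only [mem_pairStar_swap hs' ht]
    rw [e2, pairCost, Finset.sum_range_succ]
    simp only [mem_image_sym2_map]
    rw [← pairCost]
    ring
  · intro σ e
    rw [hcard]
    exact hlow _ _

/-- Planting the first `t` pairs of a uniformly random ordering. -/
theorem pairs_round {T : ℕ} (hT : 2 * T < n) {L C err : ℝ}
    (hPl : ∀ t < T, Plantable L C err (n - 1 - 2 * t)) {lam : Sym2 (Fin n) → ℝ}
    (hlow : ∀ t < T, ∀ e e', L / (n - 1 - 2 * t : ℕ) ≤ lam e - pairCost n C t e')
    {f : Finset (Sym2 (Fin n)) → ℝ} (hf : Monotone f) (hf0 : ∀ S, 0 ≤ f S)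
    (hf1 : ∀ S, f S ≤ 1) :
    Finset.univ.expect (fun σ : Equiv.Perm (Fin n) =>
      bernL (fun e => lam e - pairCost n C T (Sym2.map σ.symm e))
        (fun S => f ((pairsPat n T).image (Sym2.map σ) ∪ S))) ≤ bernL lam f + T * err := by
  suffices h : ∀ t ≤ T, Finset.univ.expect (fun σ : Equiv.Perm (Fin n) =>
      bernL (fun e => lam e - pairCost n C t (Sym2.map σ.symm e))
        (fun S => f ((pairsPat n t).image (Sym2.map σ) ∪ S))) ≤ bernL lam f + t * err from
    h T le_rfl
  intro t
  induction t with
  | zero =>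
    intro _
    simp [pairCost, pairsPat]
  | succ t ih =>
    intro ht
    have h1 := pairs_step (t := t) (by omega) (hPl t (by omega)) (hlow t (by omega)) hf hf0 hf1
    have h2 := ih (by omega)
    push_cast
    linarith

/-- Planting independent uniform choices; translations modulo `u` resample a choice. -/
theorem choices_round {T u k : ℕ} [NeZero u] (hn : n = 2 * T + u) {L C err : ℝ}
    (hPl : Plantable L C err u) (σ : Equiv.Perm (Fin n)) {lam : Sym2 (Fin n) → ℝ}
    (hlow : ∀ (A : Finset (Fin u × Fin k)) e e', L / u ≤ lam e - choiceCost n C T A e')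
    {f : Finset (Sym2 (Fin n)) → ℝ} (hf : Monotone f) (hf0 : ∀ S, 0 ≤ f S)
    (hf1 : ∀ S, f S ≤ 1) :
    Finset.univ.expect (fun φ : Fin u × Fin k → Fin u =>
      bernL (fun e => lam e - choiceCost n C T (Finset.univ : Finset (Fin u × Fin k))
          (Sym2.map σ.symm e))
        (fun S => f ((choicePat n T Finset.univ φ).image (Sym2.map σ) ∪ S))) ≤
      bernL lam f + (u * k : ℕ) * err := by
  suffices h : ∀ A : Finset (Fin u × Fin k),
      Finset.univ.expect (fun φ : Fin u × Fin k → Fin u =>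
        bernL (fun e => lam e - choiceCost n C T A (Sym2.map σ.symm e))
          (fun S => f ((choicePat n T A φ).image (Sym2.map σ) ∪ S))) ≤
        bernL lam f + A.card * err by
    have := h Finset.univ
    rwa [Finset.card_univ, Fintype.card_prod, Fintype.card_fin, Fintype.card_fin] at this
  have hvinj : ∀ a b : Fin u, vpos n (2 * T + a) = vpos n (2 * T + b) → a = b := by
    intro a b h
    have h1 := congrArg Fin.val h
    rw [vpos_val (by omega), vpos_val (by omega)] at h1
    exact Fin.ext (by omega)
  intro A
  induction A using Finset.induction_on with
  | empty => simp [choiceCost, choicePat]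
  | insert a A ha ih =>
    rw [Finset.card_insert_of_notMem ha]
    push_cast
    have hstep := planting_step (L := L) (C := C) (err := err) (ι := Fin u)
      (Ω := Fin u × Fin k → Fin u)
      (by rw [Fintype.card_fin]; exact hPl) (fun c => Equiv.addRight (Pi.single a c))
      (P := fun φ => (choicePat n T A φ).image (Sym2.map σ))
      (P' := fun φ => (choicePat n T (insert a A) φ).image (Sym2.map σ))
      (lam := fun _ e => lam e - choiceCost n C T A (Sym2.map σ.symm e))
      (lam' := fun _ e => lam e - choiceCost n C T (insert a A) (Sym2.map σ.symm e))
      (edge := fun φ c => s(σ (vpos n (2 * T + a.1)), σ (vpos n (2 * T + (φ a + c : Fin u)))))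
      (star := fun _ => (choiceStar n T u a.1).image (Sym2.map σ))
      ?_ ?_ ?_ ?_ ?_ hf hf0 hf1
    · linarith
    · intro φ b c h
      exact add_left_cancel (hvinj _ _ (σ.injective (Sym2.congr_right.1 h)))
    · intro φ
      rw [choiceStar, Finset.image_image]
      ext e
      simp only [Finset.mem_image, Finset.mem_univ, true_and, Function.comp_apply, Sym2.map_mk]
      constructor
      · rintro ⟨c, rfl⟩
        exact ⟨c - φ a, by rw [add_sub_cancel]⟩
      · rintro ⟨c, rfl⟩
        exact ⟨φ a + c, rfl⟩
    · intro φ c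
      have e1 : choicePat n T (insert a A) (φ + Pi.single a c) =
          insert s(vpos n (2 * T + a.1), vpos n (2 * T + (φ a + c : Fin u)))
            (choicePat n T A φ) := by
        rw [choicePat, Finset.image_insert, Pi.add_apply, Pi.single_eq_same]
        congr 1
        refine Finset.image_congr fun b hb => ?_
        have hba : b ≠ a := fun h => ha (h ▸ hb)
        simp [Pi.single_eq_of_ne hba]
      simp only [Equiv.coe_addRight]
      rw [e1, Finset.image_insert]
      rfl
    · intro φ c e
      simp only [mem_image_sym2_map, Fintype.card_fin]
      rw [choiceCost, Finset.sum_insert ha, ← choiceCost]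
      ring
    · intro φ e
      rw [Fintype.card_fin]
      exact hlow _ _ _

theorem card_sym2_mem_le {n : ℕ} (e : Sym2 (Fin n)) {ι : Type*} (g : ι → Fin n) (A : Finset ι)
    (hg : Set.InjOn g A) : (A.filter fun i => g i ∈ e).card ≤ 2 := by
  classical
  have h1 : (A.filter fun i => g i ∈ e).card ≤ e.toFinset.card := by
    refine Finset.card_le_card_of_injOn g ?_ ?_
    · intro i hi
      have := (Finset.mem_filter.1 hi).2
      simpa using this
    · intro i hi j hj h
      exact hg (Finset.mem_filter.1 hi).1 (Finset.mem_filter.1 hj).1 h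
  refine h1.trans ?_
  induction e with
  | _ a b => rw [Sym2.toFinset_mk_eq]; exact Finset.card_le_two

theorem pairCost_nonneg {C : ℝ} (hC : 0 ≤ C) (t : ℕ) (e : Sym2 (Fin n)) :
    0 ≤ pairCost n C t e :=
  Finset.sum_nonneg fun s _ => by split_ifs <;> positivity

theorem choiceCost_nonneg {C : ℝ} (hC : 0 ≤ C) (T : ℕ) {u k : ℕ} (A : Finset (Fin u × Fin k))
    (e : Sym2 (Fin n)) : 0 ≤ choiceCost n C T A e :=
  Finset.sum_nonneg fun s _ => by split_ifs <;> positivity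

theorem pairCost_le {C : ℝ} (hC : 0 ≤ C) {T u : ℕ} (hn : n = 2 * T + u) (hu : 0 < u) {t : ℕ}
    (ht : t ≤ T) (e : Sym2 (Fin n)) : pairCost n C t e ≤ 2 * C / u := by
  have hu' : (0 : ℝ) < u := by exact_mod_cast hu
  calc pairCost n C t e
      ≤ ∑ s ∈ Finset.range t, if vpos n (2 * s) ∈ e then C / u else 0 := by
        refine Finset.sum_le_sum fun s hs => ?_
        have hs' := Finset.mem_range.1 hs
        by_cases he : e ∈ pairStar n s
        · have hmem : vpos n (2 * s) ∈ e := by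
            obtain ⟨b, -, rfl⟩ := Finset.mem_image.1 he
            simp
          rw [if_pos he, if_pos hmem, card_gt_subtype (by omega)]
          have : (u : ℝ) ≤ (n - 1 - 2 * s : ℕ) := by
            have : u ≤ n - 1 - 2 * s := by omega
            exact_mod_cast this
          gcongr
        · rw [if_neg he]
          split_ifs <;> positivity
    _ = ((Finset.range t).filter fun s => vpos n (2 * s) ∈ e).card * (C / u) := by
        rw [← Finset.sum_filter, Finset.sum_const, nsmul_eq_mul]
    _ ≤ 2 * (C / u) := by
        have h := card_sym2_mem_le e (fun s => vpos n (2 * s)) (Finset.range t) (by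
          intro a ha b hb h
          have ha' : a < t := by simpa using ha
          have hb' : b < t := by simpa using hb
          have h1 := congrArg Fin.val h
          simp only at h1
          rw [vpos_val (by omega), vpos_val (by omega)] at h1
          omega)
        have h' : (((Finset.range t).filter fun s => vpos n (2 * s) ∈ e).card : ℝ) ≤ 2 := by
          exact_mod_cast h
        gcongr
    _ = 2 * C / u := by ring

theorem choiceCost_le {C : ℝ} (hC : 0 ≤ C) {T u k : ℕ} (hn : n = 2 * T + u) (hu : 0 < u)
    (A : Finset (Fin u × Fin k)) (e : Sym2 (Fin n)) :
    choiceCost n C T A e ≤ 2 * k * C / u := by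
  have hu' : (0 : ℝ) < u := by exact_mod_cast hu
  calc choiceCost n C T A e
      ≤ choiceCost n C T (Finset.univ : Finset (Fin u × Fin k)) e :=
        Finset.sum_le_sum_of_subset_of_nonneg (Finset.subset_univ A) fun a _ _ => by
          split_ifs <;> positivity
    _ = ∑ i : Fin u, ∑ j : Fin k, if e ∈ choiceStar n T u i then C / u else 0 := by
        rw [choiceCost, Fintype.sum_prod_type]
    _ ≤ ∑ i : Fin u, if vpos n (2 * T + i) ∈ e then k * (C / u) else 0 := by
        refine Finset.sum_le_sum fun i _ => ?_
        rw [Finset.sum_const, Finset.card_univ, Fintype.card_fin, nsmul_eq_mul]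
        by_cases he : e ∈ choiceStar n T u i
        · have hmem : vpos n (2 * T + i) ∈ e := by
            obtain ⟨b, -, rfl⟩ := Finset.mem_image.1 he
            simp
          rw [if_pos he, if_pos hmem]
        · rw [if_neg he, mul_zero]
          split_ifs <;> positivity
    _ = (Finset.univ.filter fun i : Fin u => vpos n (2 * T + i) ∈ e).card * (k * (C / u)) := by
        rw [← Finset.sum_filter, Finset.sum_const, nsmul_eq_mul]
    _ ≤ 2 * (k * (C / u)) := by
        have h := card_sym2_mem_le e (fun i : Fin u => vpos n (2 * T + i)) Finset.univ (by
          intro a ha b hb h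
          have h1 := congrArg Fin.val h
          simp only at h1
          rw [vpos_val (by omega), vpos_val (by omega)] at h1
          exact Fin.ext (by omega))
        have h' : ((Finset.univ.filter fun i : Fin u => vpos n (2 * T + i) ∈ e).card : ℝ) ≤ 2 := by
          exact_mod_cast h
        gcongr
    _ = 2 * k * C / u := by ring

theorem plantCost_nonneg {C : ℝ} (hC : 0 ≤ C) (T u k : ℕ) (e : Sym2 (Fin n)) :
    0 ≤ plantCost n C T u k e :=
  add_nonneg (pairCost_nonneg hC _ _) (choiceCost_nonneg hC _ _ _)

theorem plantCost_le {C : ℝ} (hC : 0 ≤ C) {T u : ℕ} (k : ℕ) (hn : n = 2 * T + u) (hu : 0 < u)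
    (e : Sym2 (Fin n)) : plantCost n C T u k e ≤ 2 * (k + 1) * C / u := by
  have h1 := pairCost_le hC hn hu le_rfl e
  have h2 := choiceCost_le hC hn hu (Finset.univ : Finset (Fin u × Fin k)) e
  have h3 : 2 * (k + 1) * C / u = 2 * C / u + 2 * k * C / u := by ring
  rw [h3]
  exact add_le_add h1 h2

/-- One full round of planting: the pattern of pairs and choices, transported by a uniformly
random ordering of the vertices. -/
theorem plant_round {T u k : ℕ} (hn : n = 2 * T + u) (hu : 0 < u) {L C err : ℝ}
    (hPl : ∀ m, u ≤ m → m ≤ n → Plantable L C err m) (lam : Sym2 (Fin n) → ℝ)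
    (hlow : ∀ e, (2 * (k + 1) * C + L) / u ≤ lam e)
    (f : Finset (Sym2 (Fin n)) → ℝ) (hf : Monotone f) (hf0 : ∀ S, 0 ≤ f S)
    (hf1 : ∀ S, f S ≤ 1) :
    Finset.univ.expect (fun ω : Equiv.Perm (Fin n) × (Fin u × Fin k → Fin u) =>
      bernL (fun e => lam e - plantCost n C T u k (Sym2.map ω.1.symm e))
        (fun S => f ((plantPat n T ω.2).image (Sym2.map ω.1) ∪ S))) ≤
      bernL lam f + (T + u * k : ℕ) * err := by
  have : NeZero u := ⟨hu.ne'⟩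
  have hu' : (0 : ℝ) < u := by exact_mod_cast hu
  obtain ⟨hC, hCL, -⟩ := hPl u le_rfl (by omega)
  have hL : 0 < L := hC.trans hCL
  have hb : ∀ e, 2 * C / u + 2 * k * C / u + L / u ≤ lam e := fun e => by
    have h1 := hlow e
    have h2 : (2 * (k + 1) * C + L) / u = 2 * C / u + 2 * k * C / u + L / u := by ring
    linarith
  have hk0 : 0 ≤ 2 * k * C / u := by positivity
  rw [← Finset.univ_product_univ, Finset.expect_product]
  have h1 : ∀ σ : Equiv.Perm (Fin n),
      (Finset.univ.expect fun φ : Fin u × Fin k → Fin u =>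
        bernL (fun e => lam e - plantCost n C T u k (Sym2.map σ.symm e))
          (fun S => f ((plantPat n T φ).image (Sym2.map σ) ∪ S))) ≤
      bernL (fun e => lam e - pairCost n C T (Sym2.map σ.symm e))
        (fun S => f ((pairsPat n T).image (Sym2.map σ) ∪ S)) + (u * k : ℕ) * err := by
    intro σ
    refine le_trans (le_of_eq ?_) (choices_round (T := T) (u := u) (k := k) hn
      (hPl u le_rfl (by omega)) σ
      (lam := fun e => lam e - pairCost n C T (Sym2.map σ.symm e)) ?_
      (f := fun S => f ((pairsPat n T).image (Sym2.map σ) ∪ S))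
      (fun A B hAB => hf (Finset.union_subset_union_right hAB)) (fun _ => hf0 _)
      (fun _ => hf1 _))
    · refine Finset.expect_congr rfl fun φ _ => ?_
      congr 1
      · funext e; rw [plantCost]; ring
      · funext S; rw [plantPat, Finset.image_union, Finset.union_assoc]
    · intro A e e'
      have h2 := choiceCost_le hC.le hn hu A e'
      have h3 := pairCost_le hC.le hn hu le_rfl (Sym2.map σ.symm e)
      have h4 := hb e
      linarith
  calc _ ≤ Finset.univ.expect (fun σ : Equiv.Perm (Fin n) =>
        bernL (fun e => lam e - pairCost n C T (Sym2.map σ.symm e))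
        (fun S => f ((pairsPat n T).image (Sym2.map σ) ∪ S)) + (u * k : ℕ) * err) :=
        Finset.expect_le_expect fun σ _ => h1 σ
    _ ≤ bernL lam f + T * err + (u * k : ℕ) * err := by
        rw [Finset.expect_add_distrib, Finset.expect_const Finset.univ_nonempty]
        have := pairs_round (T := T) (by omega) (L := L) (C := C) (err := err)
          (fun t ht => hPl _ (by omega) (by omega)) (lam := lam) (fun t ht e e' => by
            have h3 := pairCost_le hC.le hn hu ht.le e'
            have h4 := hb e
            have h5 : L / (n - 1 - 2 * t : ℕ) ≤ L / u := by
              have : (u : ℝ) ≤ (n - 1 - 2 * t : ℕ) := by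
                have : u ≤ n - 1 - 2 * t := by omega
                exact_mod_cast this
              gcongr
            linarith) hf hf0 hf1
        linarith
    _ = _ := by push_cast; ring

end Round

/-! ### Perfect matchings in graphs of random choices -/

section Tutte

/-- Greedy grouping of weights below `N / 8`: some group has total weight between `N / 8` and
`N / 4`. -/
theorem exists_subset_sum_between {K : Type*} [DecidableEq K] (s : Finset K) (w : K → ℕ) (N : ℕ)
    (hw : ∀ c ∈ s, 8 * w c < N) (hs : N ≤ 8 * ∑ c ∈ s, w c) :
    ∃ A ⊆ s, N ≤ 8 * ∑ c ∈ A, w c ∧ (8 * ∑ c ∈ A, w c < 2 * N ∨ N = 0) := by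
  induction s using Finset.induction_on with
  | empty =>
    refine ⟨∅, le_rfl, hs, Or.inr ?_⟩
    simpa using hs
  | insert a s ha ih =>
    by_cases h : N ≤ 8 * ∑ c ∈ s, w c
    · obtain ⟨A, hA, h1, h2⟩ := ih (fun c hc => hw c (Finset.mem_insert_of_mem hc)) h
      exact ⟨A, hA.trans (Finset.subset_insert _ _), h1, h2⟩
    · refine ⟨insert a s, le_rfl, hs, Or.inl ?_⟩
      have := hw a (Finset.mem_insert_self _ _)
      rw [Finset.sum_insert ha]
      omega

/-- The components left by a Tutte violator of size `t` can be grouped so that the group, together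
with the violator, is neither too large nor much larger than the group. -/
theorem exists_component_group {K : Type*} [Fintype K] (w : K → ℕ) (t N : ℕ)
    (hw : ∀ c, 1 ≤ w c) (ht : t < Fintype.card K) (hN : ∑ c, w c + t = N) (heven : Even N)
    (hodd : t = 0 → ∃ c, Odd (w c)) :
    ∃ A : Finset K, 1 ≤ ∑ c ∈ A, w c ∧ 8 * (∑ c ∈ A, w c + t) ≤ 7 * N ∧
      t ≤ 4 * ∑ c ∈ A, w c := by
  classical
  have hcard : ∀ B : Finset K, B.card ≤ ∑ c ∈ B, w c := fun B => by
    rw [Finset.card_eq_sum_ones]; exact Finset.sum_le_sum fun c _ => hw c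
  have hKw := hcard Finset.univ
  rw [Finset.card_univ] at hKw
  -- discard a heavy component if there is one, and group the components greedily otherwise
  by_cases hbig : ∃ c, N ≤ 8 * w c
  · obtain ⟨c, hc⟩ := hbig
    have hsum := Finset.add_sum_erase Finset.univ w (Finset.mem_univ c)
    have hcd := hcard (Finset.univ.erase c)
    rw [Finset.card_erase_of_mem (Finset.mem_univ c), Finset.card_univ] at hcd
    refine ⟨Finset.univ.erase c, ?_, by omega, by omega⟩
    by_contra hlt
    have h0 : ∑ x ∈ Finset.univ.erase c, w x = 0 := by omega
    have ht0 : t = 0 := by omega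
    obtain ⟨c', hc'⟩ := hodd ht0
    have hcc : c' = c := by
      by_contra hne
      have h1 := Finset.single_le_sum (f := w) (fun _ _ => Nat.zero_le _)
        (Finset.mem_erase.2 ⟨hne, Finset.mem_univ c'⟩)
      have := hw c'
      omega
    rw [hcc] at hc'
    have : w c = N := by omega
    rw [this] at hc'
    exact (Nat.not_even_iff_odd.2 hc') heven
  · push Not at hbig
    obtain ⟨A, -, h1, h2⟩ := exists_subset_sum_between Finset.univ w N (fun c _ => hbig c)
      (by omega)
    exact ⟨A, by omega, by omega, by omega⟩

/-- A graph of even order without a perfect matching has a nonempty vertex set `X` whose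
neighbours lie in a set `Z ⊇ X` that is not much larger than `X` and does not cover almost
everything. -/
theorem exists_trapped_of_no_perfectMatching {V : Type*} [Fintype V] [DecidableEq V]
    (G : SimpleGraph V) (heven : Even (Fintype.card V))
    (hG : ∀ M : G.Subgraph, ¬ M.IsPerfectMatching) :
    ∃ Z X : Finset V, X ⊆ Z ∧ X.Nonempty ∧ 8 * Z.card ≤ 7 * Fintype.card V ∧
      Z.card ≤ 5 * X.card ∧ ∀ x ∈ X, ∀ y, G.Adj x y → y ∈ Z := by
  classical
  have hT := mt SimpleGraph.tutte.2 (by push Not; exact hG)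
  push Not at hT
  obtain ⟨T, hT⟩ := hT
  rw [SimpleGraph.IsTutteViolator] at hT
  set S := (⊤ : G.Subgraph).deleteVerts T with hS
  set H := S.coe with hH
  have hmem : ∀ v : V, v ∈ S.verts ↔ v ∉ T := by
    intro v; simp [hS]
  let K := H.ConnectedComponent
  let w : K → ℕ := fun c => (Finset.univ.filter fun v : S.verts => H.connectedComponentMk v = c).card
  have hwsupp : ∀ c : K, c.supp.ncard = w c := by
    intro c
    change c.supp.ncard =
      (Finset.univ.filter fun v : S.verts => H.connectedComponentMk v = c).card
    rw [← Set.ncard_coe_finset]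
    congr 1
    ext v
    simp [SimpleGraph.ConnectedComponent.mem_supp_iff]
  have hw : ∀ c : K, 1 ≤ w c := by
    intro c
    induction c using SimpleGraph.ConnectedComponent.ind with
    | _ v => exact Finset.card_pos.2 ⟨v, by simp⟩
  have hTcard : T.ncard = T.toFinset.card := Set.ncard_eq_toFinset_card' T
  have hTK : T.toFinset.card < Fintype.card K := by
    rw [← hTcard]
    refine hT.trans_le ?_
    rw [← Nat.card_eq_fintype_card]
    exact Set.ncard_le_card _
  have hsum : ∑ c, w c + T.toFinset.card = Fintype.card V := by
    have h1 : ∑ c, w c = Fintype.card S.verts := by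
      rw [← Finset.card_univ]
      exact (Finset.card_eq_sum_card_fiberwise (f := fun v : S.verts => H.connectedComponentMk v)
        (s := Finset.univ) (t := Finset.univ) fun _ _ => Finset.mem_coe.2 (Finset.mem_univ _)).symm
    have h2 : Fintype.card S.verts = (T.toFinsetᶜ).card := by
      rw [Fintype.card_subtype]
      congr 1
      ext v
      simp [hmem]
    rw [h1, h2, Finset.card_compl]
    have := Finset.card_le_univ T.toFinset
    omega
  obtain ⟨A, hA1, hA2, hA3⟩ := exists_component_group w T.toFinset.card (Fintype.card V) hw hTK
    hsum heven (by
      intro h0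
      have : 0 < H.oddComponents.ncard := by omega
      obtain ⟨c, hc⟩ := Set.nonempty_of_ncard_ne_zero this.ne'
      exact ⟨c, by rw [← hwsupp]; exact hc⟩)
  let X : Finset V := (Finset.univ.filter fun v : S.verts =>
    H.connectedComponentMk v ∈ A).map (Function.Embedding.subtype _)
  have hX : X.card = ∑ c ∈ A, w c := by
    rw [Finset.card_map]
    rw [Finset.card_eq_sum_card_fiberwise (f := fun v : S.verts => H.connectedComponentMk v)
        (t := A) fun v hv => by simpa using hv]
    refine Finset.sum_congr rfl fun c hc => ?_
    congr 1
    ext v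
    simp only [Finset.mem_filter, Finset.mem_univ, true_and]
    exact ⟨fun h => h.2, fun h => ⟨h ▸ hc, h⟩⟩
  have hdisj : Disjoint X T.toFinset := by
    rw [Finset.disjoint_left]
    intro v hv hvT
    obtain ⟨v', -, rfl⟩ := Finset.mem_map.1 hv
    exact (hmem _).1 v'.2 (Set.mem_toFinset.1 hvT)
  have hZ : (X ∪ T.toFinset).card = ∑ c ∈ A, w c + T.toFinset.card := by
    rw [Finset.card_union_of_disjoint hdisj, hX]
  refine ⟨X ∪ T.toFinset, X, Finset.subset_union_left, Finset.card_pos.1 (by omega), by omega,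
    by omega, ?_⟩
  intro x hx y hxy
  by_cases hy : y ∈ T
  · exact Finset.mem_union_right _ (Set.mem_toFinset.2 hy)
  · obtain ⟨x', hx', rfl⟩ := Finset.mem_map.1 hx
    refine Finset.mem_union_left _ (Finset.mem_map.2 ⟨⟨y, (hmem y).2 hy⟩, ?_, rfl⟩)
    have hadj : H.Adj x' ⟨y, (hmem y).2 hy⟩ := by
      have h1 := (hmem x').1 x'.2
      simp only [hH, hS, SimpleGraph.Subgraph.coe_adj, SimpleGraph.Subgraph.deleteVerts_adj]
      exact ⟨trivial, h1, trivial, hy, hxy⟩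
    have heq := SimpleGraph.ConnectedComponent.connectedComponentMk_eq_of_adj hadj
    simp only [Finset.mem_filter, Finset.mem_univ, true_and] at hx' ⊢
    rwa [← heq]

/-- The graph in which every vertex is joined to the vertices it has chosen. -/
def choiceGraph {u k : ℕ} (φ : Fin u × Fin k → Fin u) : SimpleGraph (Fin u) :=
  SimpleGraph.fromRel fun a b => ∃ j, φ (a, j) = b

theorem expect_indicator_piFinset {u k : ℕ} [NeZero u] (X Z : Finset (Fin u)) :
    (Finset.univ.expect fun φ : Fin u × Fin k → Fin u =>
      open scoped Classical in
      if ∀ x ∈ X, ∀ j, φ (x, j) ∈ Z then (1 : ℝ) else 0) = ((Z.card : ℝ) / u) ^ (k * X.card) := by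
  classical
  have hu : (u : ℝ) ≠ 0 := by exact_mod_cast NeZero.ne u
  rw [Fintype.expect_eq_sum_div_card, Finset.sum_boole]
  have h1 : (Finset.univ.filter fun φ : Fin u × Fin k → Fin u => ∀ x ∈ X, ∀ j, φ (x, j) ∈ Z) =
      Fintype.piFinset fun a : Fin u × Fin k => if a.1 ∈ X then Z else Finset.univ := by
    ext φ
    simp only [Finset.mem_filter, Finset.mem_univ, true_and, Fintype.mem_piFinset, Prod.forall]
    refine forall_congr' fun x => ?_
    by_cases hx : x ∈ X <;> simp [hx]
  rw [h1, Fintype.card_piFinset, Fintype.card_fun, Fintype.card_prod, Fintype.card_fin,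
    Fintype.card_fin]
  push_cast
  have h2 : ∏ a : Fin u × Fin k, ((if a.1 ∈ X then Z else Finset.univ).card : ℝ) =
      ∏ a : Fin u × Fin k, ((if a.1 ∈ X then (Z.card : ℝ) / u else 1) * u) := by
    refine Finset.prod_congr rfl fun a _ => ?_
    split_ifs
    · field_simp
    · simp
  rw [h2, Finset.prod_mul_distrib, Finset.prod_const, Finset.card_univ, Fintype.card_prod,
    Fintype.card_fin, Fintype.card_fin, mul_div_assoc, div_self (pow_ne_zero _ hu), mul_one]
  have h4 : ∏ a : Fin u × Fin k, (if a.1 ∈ X then (Z.card : ℝ) / u else 1) =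
      ∏ x : Fin u, ∏ _j : Fin k, (if x ∈ X then (Z.card : ℝ) / u else 1) :=
    Fintype.prod_prod_type _
  rw [h4]
  simp only [Finset.prod_const, Finset.card_univ, Fintype.card_fin]
  have h3 : ∀ x : Fin u, (if x ∈ X then (Z.card : ℝ) / u else 1) ^ k =
      if x ∈ X then ((Z.card : ℝ) / u) ^ k else 1 := by
    intro x; split_ifs <;> simp
  simp only [h3]
  rw [Finset.prod_ite, Finset.prod_const, Finset.prod_const_one, mul_one, ← pow_mul]
  congr 2
  simp

/-- One term of the union bound: there are `u.choose z` sets `Z` of size `z` and at most `2 ^ z`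
subsets `X` of each, whose at least `31 z` choices all have to fall into `Z`. -/
theorem trapped_term_le {u z : ℕ} (hz : 1 ≤ z) (hzu : 8 * z ≤ 7 * u) :
    (u.choose z : ℝ) * (2 ^ z * ((z : ℝ) / u) ^ (31 * z)) ≤ (7 / u) ^ 5 := by
  have hz0 : (0 : ℝ) < z := by exact_mod_cast hz
  have hu0 : (0 : ℝ) < u := by
    have : 0 < u := by omega
    exact_mod_cast this
  set r : ℝ := (z : ℝ) / u with hr
  have hr0 : 0 < r := div_pos hz0 hu0
  have hr1 : r ≤ 7 / 8 := by
    rw [hr, div_le_iff₀ hu0]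
    have : (8 * z : ℝ) ≤ 7 * u := by exact_mod_cast hzu
    linarith
  have hchoose : (u.choose z : ℝ) ≤ (Real.exp 1 / r) ^ z := by
    have h1 : (u.choose z : ℝ) ≤ (u : ℝ) ^ z / z.factorial := Nat.choose_le_pow_div z u
    have h2 : (z : ℝ) ^ z / z.factorial ≤ Real.exp z := Real.pow_div_factorial_le_exp _ hz0.le z
    have hf : (0 : ℝ) < z.factorial := by exact_mod_cast z.factorial_pos
    calc (u.choose z : ℝ) ≤ (u : ℝ) ^ z / z.factorial := h1
      _ = ((z : ℝ) ^ z / z.factorial) * (1 / r) ^ z := by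
          rw [hr, one_div_div, div_pow]; field_simp
      _ ≤ Real.exp z * (1 / r) ^ z := by gcongr
      _ = (Real.exp 1 / r) ^ z := by
          rw [← Real.exp_one_pow, ← mul_pow, mul_one_div]
  have hsmall : 2 * Real.exp 1 * r ^ 25 ≤ 1 := by
    have h1 := Real.exp_one_lt_d9
    have h2 : r ^ 25 ≤ (7 / 8 : ℝ) ^ 25 := by gcongr
    calc 2 * Real.exp 1 * r ^ 25 ≤ 2 * 2.7182818286 * (7 / 8 : ℝ) ^ 25 := by gcongr
      _ ≤ 1 := by norm_num
  have hrz : r ^ z ≤ 7 / u := by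
    obtain ⟨y, rfl⟩ := Nat.exists_eq_add_of_le' hz
    have h1 : r ^ y ≤ (7 / 8) ^ y := by gcongr
    have h2 : ((7 : ℝ) / 8) ^ y * (y + 1) ≤ 7 := by
      have hb : 1 + (y : ℝ) * (1 / 7) ≤ (1 + 1 / 7) ^ y :=
        one_add_mul_le_pow (by norm_num) y
      have h3 : ((7 : ℝ) / 8) ^ y * (1 + 1 / 7) ^ y = 1 := by
        rw [← mul_pow]; norm_num
      have h4 : (y : ℝ) + 1 ≤ 7 * (1 + 1 / 7) ^ y := by linarith
      calc ((7 : ℝ) / 8) ^ y * (y + 1) ≤ (7 / 8) ^ y * (7 * (1 + 1 / 7) ^ y) := by gcongr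
        _ = 7 * (((7 : ℝ) / 8) ^ y * (1 + 1 / 7) ^ y) := by ring
        _ = 7 := by rw [h3, mul_one]
    calc r ^ (y + 1) = r ^ y * r := pow_succ _ _
      _ ≤ (7 / 8) ^ y * r := by gcongr
      _ = ((7 : ℝ) / 8) ^ y * (y + 1) / u := by rw [hr]; push_cast; ring
      _ ≤ 7 / u := by gcongr
  calc (u.choose z : ℝ) * (2 ^ z * r ^ (31 * z))
      ≤ (Real.exp 1 / r) ^ z * (2 ^ z * r ^ (31 * z)) := by gcongr
    _ = (2 * Real.exp 1 * r ^ 25) ^ z * (r ^ z) ^ 5 := by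
        rw [div_pow, mul_pow, mul_pow, ← pow_mul, ← pow_mul]
        have : r ^ (31 * z) = r ^ z * r ^ (25 * z) * r ^ (z * 5) := by
          rw [← pow_add, ← pow_add]; congr 1; ring
        rw [this]
        field_simp
    _ ≤ 1 * (7 / u) ^ 5 := by
        have h1 : (2 * Real.exp 1 * r ^ 25) ^ z ≤ 1 := pow_le_one₀ (by positivity) hsmall
        have h2 : (r ^ z) ^ 5 ≤ (7 / u) ^ 5 := by gcongr
        exact mul_le_mul h1 h2 (by positivity) zero_le_one
    _ = (7 / u) ^ 5 := one_mul _

open scoped Classical in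
/-- Graphs of `155` random choices per vertex have a perfect matching with high probability. -/
theorem expect_no_perfectMatching_le {u : ℕ} [NeZero u] (heven : Even u) :
    (Finset.univ.expect fun φ : Fin u × Fin 155 → Fin u =>
      if ∀ M : (choiceGraph φ).Subgraph, ¬ M.IsPerfectMatching then (1 : ℝ) else 0) ≤
      7 ^ 5 / (u : ℝ) ^ 4 := by
  have hu0 : (0 : ℝ) < u := by exact_mod_cast Nat.pos_of_ne_zero (NeZero.ne u)
  -- the pairs `(Z, X)` of the union bound
  let I : Finset (Finset (Fin u) × Finset (Fin u)) := Finset.univ.filter fun p =>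
    p.2 ⊆ p.1 ∧ p.2.Nonempty ∧ 8 * p.1.card ≤ 7 * u ∧ p.1.card ≤ 5 * p.2.card
  have h1 : ∀ φ : Fin u × Fin 155 → Fin u,
      (if ∀ M : (choiceGraph φ).Subgraph, ¬ M.IsPerfectMatching then (1 : ℝ) else 0) ≤
      ∑ p ∈ I, if ∀ x ∈ p.2, ∀ j, φ (x, j) ∈ p.1 then (1 : ℝ) else 0 := by
    intro φ
    split_ifs with h
    · obtain ⟨Z, X, hXZ, hX, h8, h5, hadj⟩ := exists_trapped_of_no_perfectMatching (choiceGraph φ)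
        (by simpa using heven) h
      rw [Fintype.card_fin] at h8
      have hmem : (Z, X) ∈ I := Finset.mem_filter.2 ⟨Finset.mem_univ _, hXZ, hX, h8, h5⟩
      refine le_trans ?_ (Finset.single_le_sum (fun p _ => ?_) hmem)
      · rw [if_pos]
        intro x hx j
        by_cases hxx : x = φ (x, j)
        · rw [← hxx]; exact hXZ hx
        · exact hadj x hx _ ((SimpleGraph.fromRel_adj _ _ _).2 ⟨hxx, Or.inl ⟨j, rfl⟩⟩)
      · split_ifs <;> norm_num
    · exact Finset.sum_nonneg fun p _ => by split_ifs <;> norm_num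
  have h2 : ∀ p ∈ I, ((p.1.card : ℝ) / u) ^ (155 * p.2.card) ≤
      ((p.1.card : ℝ) / u) ^ (31 * p.1.card) := by
    intro p hp
    obtain ⟨-, -, -, -, h5⟩ := Finset.mem_filter.1 hp
    refine pow_le_pow_of_le_one (by positivity) ?_ (by omega)
    rw [div_le_one hu0]
    have := Finset.card_le_univ p.1
    rw [Fintype.card_fin] at this
    exact_mod_cast this
  calc _ ≤ Finset.univ.expect (fun φ : Fin u × Fin 155 → Fin u =>
        ∑ p ∈ I, if ∀ x ∈ p.2, ∀ j, φ (x, j) ∈ p.1 then (1 : ℝ) else 0) :=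
        Finset.expect_le_expect fun φ _ => h1 φ
    _ = ∑ p ∈ I, ((p.1.card : ℝ) / u) ^ (155 * p.2.card) := by
        rw [Finset.expect_sum_comm]
        exact Finset.sum_congr rfl fun p _ => expect_indicator_piFinset p.2 p.1
    _ ≤ ∑ p ∈ I, ((p.1.card : ℝ) / u) ^ (31 * p.1.card) := Finset.sum_le_sum h2
    _ ≤ ∑ p ∈ Finset.univ.filter fun p : Finset (Fin u) × Finset (Fin u) =>
          (1 ≤ p.1.card ∧ 8 * p.1.card ≤ 7 * u) ∧ p.2 ⊆ p.1,
          ((p.1.card : ℝ) / u) ^ (31 * p.1.card) := by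
        refine Finset.sum_le_sum_of_subset_of_nonneg ?_ fun _ _ _ => by positivity
        intro p hp
        obtain ⟨-, h1, h2, h3, h4⟩ := Finset.mem_filter.1 hp
        have h5 := h2.card_pos
        have h6 := Finset.card_le_card h1
        exact Finset.mem_filter.2 ⟨Finset.mem_univ _, ⟨by omega, h3⟩, h1⟩
    _ = ∑ Z ∈ Finset.univ.filter fun Z : Finset (Fin u) => 1 ≤ Z.card ∧ 8 * Z.card ≤ 7 * u,
          2 ^ Z.card * ((Z.card : ℝ) / u) ^ (31 * Z.card) := by
        rw [Finset.sum_finset_product _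
          (Finset.univ.filter fun Z : Finset (Fin u) => 1 ≤ Z.card ∧ 8 * Z.card ≤ 7 * u)
          (fun Z => Z.powerset) fun p => by simp]
        refine Finset.sum_congr rfl fun Z _ => ?_
        simp only [Finset.sum_const, Finset.card_powerset, nsmul_eq_mul]
        push_cast
        rfl
    _ = ∑ z ∈ (Finset.range (u + 1)).filter fun z => 1 ≤ z ∧ 8 * z ≤ 7 * u,
          (u.choose z : ℝ) * (2 ^ z * ((z : ℝ) / u) ^ (31 * z)) := by
        rw [Finset.sum_filter, Finset.sum_filter, ← Finset.powerset_univ,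
          Finset.sum_powerset_apply_card
          (fun z => if 1 ≤ z ∧ 8 * z ≤ 7 * u then 2 ^ z * ((z : ℝ) / u) ^ (31 * z) else 0),
          Finset.card_univ, Fintype.card_fin]
        refine Finset.sum_congr rfl fun z _ => ?_
        rw [nsmul_eq_mul]
        split_ifs <;> simp
    _ ≤ ∑ z ∈ (Finset.range (u + 1)).filter fun z => 1 ≤ z ∧ 8 * z ≤ 7 * u, (7 / (u : ℝ)) ^ 5 := by
        refine Finset.sum_le_sum fun z hz => ?_
        obtain ⟨-, h1, h2⟩ := Finset.mem_filter.1 hz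
        exact trapped_term_le h1 h2
    _ ≤ u * (7 / (u : ℝ)) ^ 5 := by
        rw [Finset.sum_const, nsmul_eq_mul]
        have : ((Finset.range (u + 1)).filter fun z => 1 ≤ z ∧ 8 * z ≤ 7 * u).card ≤ u := by
          have hsub : ((Finset.range (u + 1)).filter fun z => 1 ≤ z ∧ 8 * z ≤ 7 * u) ⊆
              Finset.Icc 1 u := by
            intro z hz
            simp only [Finset.mem_filter, Finset.mem_range, Finset.mem_Icc] at hz ⊢
            omega
          simpa using Finset.card_le_card hsub
        have h' : ((((Finset.range (u + 1)).filter fun z => 1 ≤ z ∧ 8 * z ≤ 7 * u).card : ℕ) : ℝ)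
            ≤ u := by exact_mod_cast this
        gcongr
    _ = 7 ^ 5 / (u : ℝ) ^ 4 := by
        field_simp

end Tutte

/-! ### Uniform perfect matchings -/

section Symmetry

theorem mem_perfectMatchings {n : ℕ} {M : SimpleGraph (Fin n)} :
    M ∈ perfectMatchings n ↔ ∀ v, ∃! w, M.Adj v w := by
  rw [perfectMatchings, Set.mem_ofPred_eq, SimpleGraph.Subgraph.isPerfectMatching_iff]
  simp

/-- The involution exchanging the two ends of every edge of a perfect matching. -/
theorem exists_mate {n : ℕ} {M : SimpleGraph (Fin n)} (hM : M ∈ perfectMatchings n) :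
    ∃ m : Equiv.Perm (Fin n), (∀ x y, M.Adj x y ↔ m x = y) ∧ m ^ 2 = 1 ∧ ∀ x, m x ≠ x := by
  have h := mem_perfectMatchings.1 hM
  choose m hm hm' using h
  have hadj : ∀ x y, M.Adj x y ↔ m x = y := fun x y =>
    ⟨fun hxy => (hm' x y hxy).symm, fun hxy => hxy ▸ hm x⟩
  have hinv : Function.Involutive m := fun x => (hadj _ _).1 (hm x).symm
  refine ⟨hinv.toPerm, hadj, ?_, fun x hx => (hm x).ne hx.symm⟩
  ext x
  simp [pow_two, hinv x]

/-- The symmetric group acts transitively on perfect matchings. -/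
theorem exists_perm_comap_eq {n : ℕ} {M M' : SimpleGraph (Fin n)} (hM : M ∈ perfectMatchings n)
    (hM' : M' ∈ perfectMatchings n) : ∃ τ : Equiv.Perm (Fin n), M' = M.comap τ := by
  obtain ⟨m, hm, hm2, hmx⟩ := exists_mate hM
  obtain ⟨m', hm', hm2', hmx'⟩ := exists_mate hM'
  have htype : ∀ f : Equiv.Perm (Fin n), f ^ 2 = 1 → (∀ x, f x ≠ x) →
      f.cycleType = Multiset.replicate (n / 2) 2 := by
    intro f hf hfx
    have h1 := Equiv.Perm.cycleType_of_pow_prime_eq_one (p := 2) hf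
    have h2 := f.sum_cycleType
    have h3 : f.support = Finset.univ := by ext x; simp [hfx x]
    rw [h3, Finset.card_univ, Fintype.card_fin, h1, Multiset.sum_replicate, smul_eq_mul] at h2
    rw [h1]
    congr 1
    omega
  have hconj : IsConj m' m := Equiv.Perm.isConj_iff_cycleType_eq.2
    ((htype m' hm2' hmx').trans (htype m hm2 hmx).symm)
  obtain ⟨τ, hτ⟩ := isConj_iff.1 hconj
  refine ⟨τ, ?_⟩
  ext x y
  rw [SimpleGraph.comap_adj, hm', hm, ← hτ]
  simp

theorem comap_mem_perfectMatchings {n : ℕ} {M : SimpleGraph (Fin n)}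
    (hM : M ∈ perfectMatchings n) (τ : Equiv.Perm (Fin n)) :
    M.comap τ ∈ perfectMatchings n := by
  rw [mem_perfectMatchings] at hM ⊢
  intro v
  obtain ⟨w, hw, hw'⟩ := hM (τ v)
  refine ⟨τ.symm w, by simpa using hw, fun y hy => ?_⟩
  rw [Equiv.eq_symm_apply]
  exact hw' _ hy

/-- Relabelling a fixed perfect matching by a uniform permutation produces a uniform perfect
matching. -/
theorem expect_comap_eq {n : ℕ} [Fintype (perfectMatchings n)] {M₀ : SimpleGraph (Fin n)}
    (hM₀ : M₀ ∈ perfectMatchings n) (h : SimpleGraph (Fin n) → ℝ) :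
    Finset.univ.expect (fun σ : Equiv.Perm (Fin n) => h (M₀.comap σ.symm)) =
      Finset.univ.expect (fun M : perfectMatchings n => h M.1) := by
  have : Nonempty (perfectMatchings n) := ⟨⟨M₀, hM₀⟩⟩
  let act : Equiv.Perm (Fin n) → perfectMatchings n ≃ perfectMatchings n := fun σ =>
    { toFun := fun M => ⟨M.1.comap σ.symm, comap_mem_perfectMatchings M.2 _⟩
      invFun := fun M => ⟨M.1.comap σ, comap_mem_perfectMatchings M.2 _⟩
      left_inv := fun M => Subtype.ext (by ext x y; simp)
      right_inv := fun M => Subtype.ext (by ext x y; simp) }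
  have h1 : ∀ σ : Equiv.Perm (Fin n), Finset.univ.expect (fun M : perfectMatchings n => h M.1) =
      Finset.univ.expect (fun M : perfectMatchings n => h (M.1.comap σ.symm)) := fun σ =>
    (Fintype.expect_equiv (act σ) _ _ fun M => rfl).symm
  have h2 : ∀ M : perfectMatchings n,
      Finset.univ.expect (fun σ : Equiv.Perm (Fin n) => h (M.1.comap σ.symm)) =
      Finset.univ.expect (fun σ : Equiv.Perm (Fin n) => h (M₀.comap σ.symm)) := by
    intro M
    obtain ⟨τ, hτ⟩ := exists_perm_comap_eq hM₀ M.2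
    refine Fintype.expect_equiv (Equiv.mulRight τ⁻¹) _ _ fun σ => ?_
    congr 1
    rw [hτ]
    ext x y
    simp [Equiv.Perm.mul_def, Equiv.Perm.inv_def]
  calc Finset.univ.expect (fun σ : Equiv.Perm (Fin n) => h (M₀.comap σ.symm))
      = Finset.univ.expect (fun M : perfectMatchings n =>
          Finset.univ.expect (fun σ : Equiv.Perm (Fin n) => h (M.1.comap σ.symm))) := by
        rw [Finset.expect_congr rfl fun M _ => h2 M, Finset.expect_const Finset.univ_nonempty]
    _ = Finset.univ.expect (fun σ : Equiv.Perm (Fin n) =>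
          Finset.univ.expect (fun M : perfectMatchings n => h (M.1.comap σ.symm))) :=
        Finset.expect_comm _ _ _
    _ = _ := by
        rw [← Finset.expect_congr rfl fun σ _ => h1 σ, Finset.expect_const Finset.univ_nonempty]

/-- A perfect matching of the graph of choices completes the planted pairs to a perfect matching
of all positions. -/
theorem exists_perfectMatching_le_plantPat {n T u k : ℕ} [NeZero n] (hn : n = 2 * T + u)
    (φ : Fin u × Fin k → Fin u) {N : (choiceGraph φ).Subgraph} (hN : N.IsPerfectMatching) :
    ∃ M ∈ perfectMatchings n, ∀ x y, M.Adj x y → s(x, y) ∈ plantPat n T φ := by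
  have hN' := SimpleGraph.Subgraph.isPerfectMatching_iff.1 hN
  choose m hm hm' using hN'
  have hmm : ∀ i, m (m i) = i := fun i => (hm' _ _ (hm i).symm).symm
  have hadjN : ∀ i, (choiceGraph φ).Adj i (m i) := fun i => (hm i).adj_sub
  -- the partner of a position
  let mate : Fin n → Fin n := fun v =>
    if h : v.val < 2 * T then
      if v.val % 2 = 0 then vpos n (v.val + 1) else vpos n (v.val - 1)
    else vpos n (2 * T + m ⟨v.val - 2 * T, by omega⟩)
  have hval : ∀ v : Fin n, (mate v).val =
      if h : v.val < 2 * T then if v.val % 2 = 0 then v.val + 1 else v.val - 1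
      else 2 * T + m ⟨v.val - 2 * T, by omega⟩ := by
    intro v
    simp only [mate]
    split_ifs
    · exact vpos_val (by omega)
    · exact vpos_val (by omega)
    · exact vpos_val (by omega)
  have hinv : ∀ v, mate (mate v) = v := by
    intro v
    apply Fin.ext
    rw [hval]
    by_cases h : v.val < 2 * T
    · have h1 := hval v
      rw [dif_pos h] at h1
      by_cases h2 : v.val % 2 = 0
      · rw [if_pos h2] at h1
        rw [dif_pos (by omega), if_neg (by omega)]
        omega
      · rw [if_neg h2] at h1
        rw [dif_pos (by omega), if_pos (by omega)]
        omega
    · have h1 := hval v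
      rw [dif_neg h] at h1
      rw [dif_neg (by omega)]
      have h2 : (⟨(mate v).val - 2 * T, by omega⟩ : Fin u) = m ⟨v.val - 2 * T, by omega⟩ :=
        Fin.ext (by simp only; omega)
      rw [h2, hmm]
      simp only
      omega
  have hne : ∀ v, mate v ≠ v := by
    intro v hv
    have h1 := hval v
    rw [hv] at h1
    split_ifs at h1 with h h2
    · omega
    · omega
    · have h3 := (hadjN ⟨v.val - 2 * T, by omega⟩).ne
      apply h3
      apply Fin.ext
      simp only
      omega
  let M : SimpleGraph (Fin n) :=
    { Adj := fun x y => mate x = y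
      symm := ⟨fun x y h => by rw [← h, hinv]⟩
      loopless := ⟨fun x h => hne x h⟩ }
  refine ⟨M, mem_perfectMatchings.2 fun v => ⟨mate v, rfl, fun y hy => (show mate v = y from hy).symm⟩, ?_⟩
  intro x y hxy
  have hxy' : mate x = y := hxy
  subst hxy'
  rw [plantPat, Finset.mem_union]
  have h1 := hval x
  by_cases h : x.val < 2 * T
  · left
    rw [dif_pos h] at h1
    refine Finset.mem_image.2 ⟨x.val / 2, Finset.mem_range.2 (by omega), ?_⟩
    by_cases h2 : x.val % 2 = 0
    · rw [if_pos h2] at h1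
      have e1 : vpos n (2 * (x.val / 2)) = x := Fin.ext (by rw [vpos_val (by omega)]; omega)
      have e2 : vpos n (2 * (x.val / 2) + 1) = mate x :=
        Fin.ext (by rw [vpos_val (by omega)]; omega)
      rw [e1, e2]
    · rw [if_neg h2] at h1
      have e1 : vpos n (2 * (x.val / 2)) = mate x := Fin.ext (by rw [vpos_val (by omega)]; omega)
      have e2 : vpos n (2 * (x.val / 2) + 1) = x :=
        Fin.ext (by rw [vpos_val (by omega)]; omega)
      rw [e1, e2, Sym2.eq_swap]
  · right
    rw [dif_neg h] at h1
    set i : Fin u := ⟨x.val - 2 * T, by omega⟩ with hi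
    have hiv : i.val = x.val - 2 * T := rfl
    have e1 : vpos n (2 * T + i) = x := Fin.ext (by rw [vpos_val (by omega)]; omega)
    have e2 : vpos n (2 * T + m i) = mate x := Fin.ext (by rw [vpos_val (by omega)]; omega)
    obtain ⟨-, hj⟩ := (SimpleGraph.fromRel_adj _ _ _).1 (hadjN i)
    rcases hj with ⟨j, hj⟩ | ⟨j, hj⟩
    · exact Finset.mem_image.2 ⟨(i, j), Finset.mem_univ _, by rw [hj, e1, e2]⟩
    · refine Finset.mem_image.2 ⟨(m i, j), Finset.mem_univ _, ?_⟩
      rw [hj, e1, e2, Sym2.eq_swap]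

/-- A uniform perfect matching is dominated by the planted pattern of one round. -/
theorem expect_perfectMatching_le {n T u : ℕ} [NeZero n] [Fintype (perfectMatchings n)]
    (hn : n = 2 * T + u) (hu : 0 < u) (heven : Even n) {h : SimpleGraph (Fin n) → ℝ}
    (hmono : Monotone h) (h0 : ∀ G, 0 ≤ h G) (h1 : ∀ G, h G ≤ 1) :
    Finset.univ.expect (fun M : perfectMatchings n => h M.1) ≤
      Finset.univ.expect (fun ω : Equiv.Perm (Fin n) × (Fin u × Fin 155 → Fin u) =>
        h (SimpleGraph.fromEdgeSet ((plantPat n T ω.2).image (Sym2.map ω.1)))) +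
      7 ^ 5 / (u : ℝ) ^ 4 := by
  classical
  have : NeZero u := ⟨hu.ne'⟩
  have hue : Even u := by
    rw [hn] at heven
    exact (Nat.even_add.1 heven).1 (even_two_mul T)
  set m := Finset.univ.expect (fun M : perfectMatchings n => h M.1) with hm
  have hm1 : m ≤ 1 := by
    rw [hm]
    by_cases hne : Nonempty (perfectMatchings n)
    · exact Finset.expect_le Finset.univ_nonempty fun M _ => h1 _
    · rw [not_nonempty_iff] at hne
      simp
  rw [← Finset.univ_product_univ, Finset.expect_product, Finset.expect_comm]
  have hφ : ∀ φ : Fin u × Fin 155 → Fin u, m ≤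
      Finset.univ.expect (fun σ : Equiv.Perm (Fin n) =>
        h (SimpleGraph.fromEdgeSet ((plantPat n T φ).image (Sym2.map σ)))) +
      if ∀ M : (choiceGraph φ).Subgraph, ¬ M.IsPerfectMatching then (1 : ℝ) else 0 := by
    intro φ
    split_ifs with hno
    · have : 0 ≤ Finset.univ.expect (fun σ : Equiv.Perm (Fin n) =>
          h (SimpleGraph.fromEdgeSet ((plantPat n T φ).image (Sym2.map σ)))) :=
        Finset.expect_nonneg fun σ _ => h0 _
      linarith
    · push Not at hno
      obtain ⟨N, hN⟩ := hno
      obtain ⟨M₀, hM₀, hle⟩ := exists_perfectMatching_le_plantPat hn φ hN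
      rw [add_zero, hm, ← expect_comap_eq hM₀]
      refine Finset.expect_le_expect fun σ _ => hmono ?_
      intro x y hxy
      rw [SimpleGraph.comap_adj] at hxy
      rw [SimpleGraph.fromEdgeSet_adj]
      refine ⟨?_, fun hne => hxy.ne (by rw [hne])⟩
      rw [Finset.mem_coe, mem_image_sym2_map]
      exact hle _ _ hxy
  calc m = Finset.univ.expect (fun _ : Fin u × Fin 155 → Fin u => m) :=
        (Finset.expect_const Finset.univ_nonempty _).symm
    _ ≤ _ := Finset.expect_le_expect fun φ _ => hφ φ
    _ ≤ _ := by
        rw [Finset.expect_add_distrib]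
        have := expect_no_perfectMatching_le hue
        linarith

theorem expect_iSup_succ {Γ Ω : Type*} [CompleteLattice Γ] [Fintype Ω] (G : Ω → Γ) (d : ℕ)
    (h : Γ → ℝ) :
    Finset.univ.expect (fun ω : Fin (d + 1) → Ω => h (⨆ i, G (ω i))) =
      Finset.univ.expect (fun ω₀ : Ω => Finset.univ.expect fun ω : Fin d → Ω =>
        h (G ω₀ ⊔ ⨆ i, G (ω i))) := by
  rw [← Finset.expect_product' (s := Finset.univ) (t := Finset.univ)
    (f := fun ω₀ (ω : Fin d → Ω) => h (G ω₀ ⊔ ⨆ i, G (ω i))), Finset.univ_product_univ]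
  refine (Fintype.expect_equiv (Fin.consEquiv fun _ => Ω) _ _ fun ω => ?_).symm
  congr 1
  refine le_antisymm (sup_le ?_ (iSup_le fun i => ?_)) (iSup_le fun i => ?_)
  · exact le_iSup (fun i => G ((Fin.consEquiv fun _ => Ω) ω i)) 0
  · exact le_iSup (fun i => G ((Fin.consEquiv fun _ => Ω) ω i)) i.succ
  · refine Fin.cases ?_ (fun i => ?_) i
    · exact le_sup_left
    · exact (le_iSup (fun i => G (ω.2 i)) i).trans le_sup_right

/-- Domination of independent experiments, one coordinate at a time. -/
theorem expect_iSup_le {Γ Ω₁ Ω₂ : Type*} [CompleteLattice Γ] [Fintype Ω₁] [Fintype Ω₂]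
    [Nonempty Ω₁] [Nonempty Ω₂] (G₁ : Ω₁ → Γ) (G₂ : Ω₂ → Γ) {δ : ℝ}
    (hdom : ∀ h : Γ → ℝ, Monotone h → (∀ G, 0 ≤ h G) → (∀ G, h G ≤ 1) →
      Finset.univ.expect (fun ω => h (G₁ ω)) ≤ Finset.univ.expect (fun ω => h (G₂ ω)) + δ)
    (d : ℕ) {h : Γ → ℝ} (hmono : Monotone h) (h0 : ∀ G, 0 ≤ h G) (h1 : ∀ G, h G ≤ 1) :
    Finset.univ.expect (fun ω : Fin d → Ω₁ => h (⨆ i, G₁ (ω i))) ≤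
      Finset.univ.expect (fun ω : Fin d → Ω₂ => h (⨆ i, G₂ (ω i))) + d * δ := by
  induction d generalizing h with
  | zero =>
    simp only [iSup_of_empty]
    rw [Finset.expect_const Finset.univ_nonempty, Finset.expect_const Finset.univ_nonempty]
    simp
  | succ d ih =>
    rw [expect_iSup_succ, expect_iSup_succ]
    have hsup : ∀ X : Γ, Monotone fun G => h (X ⊔ G) := fun X A B hAB =>
      hmono (sup_le_sup_left hAB X)
    have hsup' : ∀ X : Γ, Monotone fun G => h (G ⊔ X) := fun X A B hAB =>
      hmono (sup_le_sup_right hAB X)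
    calc _ ≤ Finset.univ.expect (fun ω₀ : Ω₁ => (Finset.univ.expect fun ω : Fin d → Ω₂ =>
          h (G₁ ω₀ ⊔ ⨆ i, G₂ (ω i))) + d * δ) :=
          Finset.expect_le_expect fun ω₀ _ => ih (hsup _) (fun _ => h0 _) fun _ => h1 _
      _ = Finset.univ.expect (fun ω : Fin d → Ω₂ => Finset.univ.expect fun ω₀ : Ω₁ =>
          h (G₁ ω₀ ⊔ ⨆ i, G₂ (ω i))) + d * δ := by
          rw [Finset.expect_add_distrib, Finset.expect_const Finset.univ_nonempty,
            Finset.expect_comm]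
      _ ≤ Finset.univ.expect (fun ω : Fin d → Ω₂ => (Finset.univ.expect fun ω₀ : Ω₂ =>
          h (G₂ ω₀ ⊔ ⨆ i, G₂ (ω i))) + δ) + d * δ := by
          gcongr
          exact hdom _ (hsup' _) (fun _ => h0 _) fun _ => h1 _
      _ = _ := by
          rw [Finset.expect_add_distrib, Finset.expect_const Finset.univ_nonempty,
            Finset.expect_comm]
          push_cast
          ring

theorem fromEdgeSet_mono' {V : Type*} : Monotone fun S : Finset (Sym2 V) =>
    SimpleGraph.fromEdgeSet (S : Set (Sym2 V)) := fun _ _ h =>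
  SimpleGraph.fromEdgeSet_mono (Finset.coe_subset.2 h)

open scoped Classical in
/-- Independent uniform perfect matchings are dominated by the random graph with intensities
`lam`, up to the errors of planting and of matching and the probability that planting costs
more than `lam` affords. -/
theorem expect_matchings_le {n T u : ℕ} [NeZero n] [Nonempty (perfectMatchings n)]
    (hn : n = 2 * T + u) (hu : 0 < u) (heven : Even n) {L C err : ℝ} (herr : 0 ≤ err)
    (hPl : ∀ m, u ≤ m → m ≤ n → Plantable L C err m) (d : ℕ) {lam : Sym2 (Fin n) → ℝ}
    (hlow : ∀ e, (312 * C + L) / u ≤ lam e) {h : SimpleGraph (Fin n) → ℝ}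
    (hmono : Monotone h) (h0 : ∀ G, 0 ≤ h G) (h1 : ∀ G, h G ≤ 1) :
    Finset.univ.expect (fun M : Fin d → perfectMatchings n => h (⨆ i, (M i).1)) ≤
      bernL lam (fun S => h (SimpleGraph.fromEdgeSet S)) +
      d * ((T + u * 155 : ℕ) * err + 7 ^ 5 / (u : ℝ) ^ 4) +
      Finset.univ.expect (fun ω : Fin d → Equiv.Perm (Fin n) × (Fin u × Fin 155 → Fin u) =>
        if ∀ e, ∑ i, plantCost n C T u 155 (Sym2.map (ω i).1.symm e) ≤
          lam e - (312 * C + L) / u then (0 : ℝ) else 1) := by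
  have hu' : (0 : ℝ) < u := by exact_mod_cast hu
  have : NeZero u := ⟨hu.ne'⟩
  obtain ⟨hC, hCL, -⟩ := hPl u le_rfl (by omega)
  have hL : 0 < L := hC.trans hCL
  have s1 := expect_iSup_le (fun M : perfectMatchings n => M.1)
    (fun ω : Equiv.Perm (Fin n) × (Fin u × Fin 155 → Fin u) =>
      SimpleGraph.fromEdgeSet (((plantPat n T ω.2).image (Sym2.map ω.1) : Finset _) : Set _))
    (fun h hm h0 h1 => expect_perfectMatching_le hn hu heven hm h0 h1) d hmono h0 h1
  have s2 := planting_rounds (P := fun ω : Equiv.Perm (Fin n) × (Fin u × Fin 155 → Fin u) =>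
      (plantPat n T ω.2).image (Sym2.map ω.1))
    (cost := fun ω e => plantCost n C T u 155 (Sym2.map ω.1.symm e))
    (low := (312 * C + L) / u) (err := (T + u * 155 : ℕ) * err)
    (fun ω e => plantCost_nonneg hC.le _ _ _ _)
    (fun ω e => by
      refine (plantCost_le hC.le 155 hn hu _).trans ?_
      gcongr
      push_cast
      linarith) (by positivity)
    (fun lam hlam f hf hf0 hf1 => plant_round hn hu hPl lam (fun e => by
      refine le_trans (le_of_eq ?_) (hlam e)
      push_cast
      ring) f hf hf0 hf1)
    d hlow (f := fun S => h (SimpleGraph.fromEdgeSet S)) (hmono.comp fromEdgeSet_mono')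
    (fun _ => h0 _) (fun _ => h1 _)
  have s3 : ∀ ω : Fin d → Equiv.Perm (Fin n) × (Fin u × Fin 155 → Fin u),
      h (⨆ i, SimpleGraph.fromEdgeSet
        (((plantPat n T (ω i).2).image (Sym2.map (ω i).1) : Finset _) : Set _)) ≤
      (if ∀ e, ∑ i, plantCost n C T u 155 (Sym2.map (ω i).1.symm e) ≤
          lam e - (312 * C + L) / u then
        h (SimpleGraph.fromEdgeSet ((Finset.univ.biUnion fun i =>
          (plantPat n T (ω i).2).image (Sym2.map (ω i).1) : Finset _) : Set _)) else 0) +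
      if ∀ e, ∑ i, plantCost n C T u 155 (Sym2.map (ω i).1.symm e) ≤
          lam e - (312 * C + L) / u then (0 : ℝ) else 1 := by
    intro ω
    split_ifs
    · rw [add_zero]
      refine hmono (iSup_le fun i => fromEdgeSet_mono' ?_)
      exact Finset.subset_biUnion_of_mem
        (fun i => (plantPat n T (ω i).2).image (Sym2.map (ω i).1)) (Finset.mem_univ i)
    · rw [zero_add]; exact h1 _
  have s4 := Finset.expect_le_expect (s := Finset.univ) fun ω _ => s3 ω
  rw [Finset.expect_add_distrib] at s4
  rw [mul_add]
  linarith

end Symmetry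

/-! ### The cost of a pair over many rounds -/

section Cost

theorem exists_perm_map_eq {n : ℕ} {e e' : Sym2 (Fin n)} (he : ¬ e.IsDiag) (he' : ¬ e'.IsDiag) :
    ∃ τ : Equiv.Perm (Fin n), Sym2.map τ e = e' := by
  induction e with
  | _ a b =>
  induction e' with
  | _ c d =>
  rw [Sym2.mk_isDiag_iff] at he he'
  -- first move `a` to `c`, then the image of `b` to `d`
  refine ⟨Equiv.swap (Equiv.swap a c b) d * Equiv.swap a c, ?_⟩
  have h1 : Equiv.swap a c b ≠ c := by
    intro h
    have : Equiv.swap a c b = Equiv.swap a c a := by rw [h, Equiv.swap_apply_left]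
    exact he ((Equiv.swap a c).injective this).symm
  rw [Sym2.map_mk, Equiv.Perm.mul_apply, Equiv.Perm.mul_apply, Equiv.swap_apply_left,
    Equiv.swap_apply_left, Equiv.swap_apply_of_ne_of_ne h1.symm he']

/-- Each of the `T + u * k` planted elements costs `C` in total. -/
theorem sum_plantCost {n T u k : ℕ} [NeZero n] (hn : n = 2 * T + u) (hu : 0 < u) (C : ℝ) :
    ∑ e, plantCost n C T u k e = C * (T + u * k) := by
  have hu' : (u : ℝ) ≠ 0 := by exact_mod_cast hu.ne'
  have hpair : ∑ e, pairCost n C T e = C * T := by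
    unfold pairCost
    rw [Finset.sum_comm]
    have : ∀ s ∈ Finset.range T, ∑ e, (if e ∈ pairStar n s then
        C / Fintype.card {b : Fin n // 2 * s < b.val} else 0) = C := by
      intro s hs
      have hs' := Finset.mem_range.1 hs
      rw [← Finset.sum_filter, Finset.filter_mem_eq_inter, Finset.univ_inter, Finset.sum_const,
        pairStar, Finset.card_image_of_injective, Finset.card_univ, nsmul_eq_mul]
      · have hpos : (Fintype.card {b : Fin n // 2 * s < b.val} : ℝ) ≠ 0 := by
          rw [card_gt_subtype (by omega)]
          have : n - 1 - 2 * s ≠ 0 := by omega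
          exact_mod_cast this
        field_simp
      · intro b c h
        exact Subtype.ext (Sym2.congr_right.1 h)
    rw [Finset.sum_congr rfl this, Finset.sum_const, Finset.card_range, nsmul_eq_mul, mul_comm]
  have hchoice : ∑ e, choiceCost n C T (Finset.univ : Finset (Fin u × Fin k)) e =
      C * (u * k) := by
    unfold choiceCost
    rw [Finset.sum_comm]
    have : ∀ a ∈ (Finset.univ : Finset (Fin u × Fin k)),
        ∑ e, (if e ∈ choiceStar n T u a.1 then C / u else 0) = C := by
      intro a _
      rw [← Finset.sum_filter, Finset.filter_mem_eq_inter, Finset.univ_inter, Finset.sum_const,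
        choiceStar, Finset.card_image_of_injective, Finset.card_univ, nsmul_eq_mul,
        Fintype.card_fin]
      · field_simp
      · intro b c h
        have h1 := congrArg Fin.val (Sym2.congr_right.1 h)
        rw [vpos_val (by omega), vpos_val (by omega)] at h1
        exact Fin.ext (by omega)
    rw [Finset.sum_congr rfl this, Finset.sum_const, Finset.card_univ, Fintype.card_prod,
      Fintype.card_fin, Fintype.card_fin, nsmul_eq_mul]
    push_cast
    ring
  unfold plantCost
  rw [Finset.sum_add_distrib, hpair, hchoice]
  ring

/-- By symmetry, all pairs of vertices have the same expected cost. -/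
theorem expect_plantCost_le {n T u k : ℕ} [NeZero n] (hn : n = 2 * T + u) (hu : 0 < u) {C : ℝ}
    (hC : 0 ≤ C) {e : Sym2 (Fin n)} (he : ¬ e.IsDiag) :
    Finset.univ.expect (fun σ : Equiv.Perm (Fin n) =>
      plantCost n C T u k (Sym2.map σ.symm e)) * n.choose 2 ≤ C * (T + u * k) := by
  classical
  set m := Finset.univ.expect (fun σ : Equiv.Perm (Fin n) =>
      plantCost n C T u k (Sym2.map σ.symm e)) with hm
  have h1 : ∀ e' ∈ Finset.univ.filter (fun e' : Sym2 (Fin n) => ¬ e'.IsDiag),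
      Finset.univ.expect (fun σ : Equiv.Perm (Fin n) =>
        plantCost n C T u k (Sym2.map σ.symm e')) = m := by
    intro e' he'
    obtain ⟨τ, hτ⟩ := exists_perm_map_eq (Finset.mem_filter.1 he').2 he
    refine Fintype.expect_equiv (Equiv.mulLeft τ) _ _ fun σ => ?_
    congr 1
    rw [← hτ, Sym2.map_map]
    congr 1
    funext x
    change σ.symm x = σ.symm (τ.symm (τ x))
    rw [Equiv.symm_apply_apply]
  have hcard : (Finset.univ.filter fun e' : Sym2 (Fin n) => ¬ e'.IsDiag).card = n.choose 2 := by
    have := Sym2.card_subtype_not_diag (α := Fin n)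
    rwa [Fintype.card_subtype, Fintype.card_fin] at this
  calc m * n.choose 2
      = ∑ e' ∈ Finset.univ.filter (fun e' : Sym2 (Fin n) => ¬ e'.IsDiag),
          Finset.univ.expect (fun σ : Equiv.Perm (Fin n) =>
            plantCost n C T u k (Sym2.map σ.symm e')) := by
        rw [Finset.sum_congr rfl h1, Finset.sum_const, hcard, nsmul_eq_mul, mul_comm]
    _ ≤ ∑ e', Finset.univ.expect (fun σ : Equiv.Perm (Fin n) =>
            plantCost n C T u k (Sym2.map σ.symm e')) :=
        Finset.sum_le_sum_of_subset_of_nonneg (Finset.filter_subset _ _) fun e' _ _ =>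
          Finset.expect_nonneg fun σ _ => plantCost_nonneg hC _ _ _ _
    _ = Finset.univ.expect (fun σ : Equiv.Perm (Fin n) =>
          ∑ e', plantCost n C T u k (Sym2.map σ.symm e')) :=
        (Finset.expect_sum_comm _ _ _).symm
    _ = Finset.univ.expect (fun _ : Equiv.Perm (Fin n) => C * (T + u * k)) := by
        refine Finset.expect_congr rfl fun σ _ => ?_
        rw [← sum_plantCost hn hu (k := k) C]
        exact (Finite.injective_iff_bijective.1 (Sym2.map.injective σ.symm.injective)).sum_comp
          fun e' => plantCost n C T u k e'
    _ = C * (T + u * k) := Finset.expect_const Finset.univ_nonempty _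

theorem exp_le_one_add_of_le_one {x : ℝ} (h0 : 0 ≤ x) (h1 : x ≤ 1) :
    Real.exp x ≤ 1 + 7 / 4 * x := by
  have h := convexOn_exp.2 (Set.mem_univ (0 : ℝ)) (Set.mem_univ (1 : ℝ)) (sub_nonneg.2 h1) h0
    (by ring)
  simp only [smul_eq_mul, Real.exp_zero, mul_zero, mul_one, zero_add] at h
  have := Real.exp_one_lt_d9
  nlinarith

theorem expect_prod_pi {Ω : Type*} [Fintype Ω] (d : ℕ) (F : Ω → ℝ) :
    Finset.univ.expect (fun ω : Fin d → Ω => ∏ i, F (ω i)) = (Finset.univ.expect F) ^ d := by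
  rw [Fintype.expect_eq_sum_div_card, Fintype.expect_eq_sum_div_card, div_pow, Fintype.card_fun,
    Fintype.card_fin]
  push_cast
  congr 1
  rw [← Fin.prod_const, Finset.prod_univ_sum, Fintype.piFinset_univ]

open scoped Classical in
/-- **Chernoff bound.** Over `d` rounds the total cost of every pair is at most `s`, except with
small probability. -/
theorem expect_cost_exceeds_le {n T u k : ℕ} [NeZero n] (hn : n = 2 * T + u) (hu : 0 < u) {C : ℝ}
    (hC : 0 < C) (d : ℕ) {s : ℝ} {cap : Sym2 (Fin n) → ℝ} (hcap : ∀ e, ¬ e.IsDiag → s ≤ cap e)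
    (hdiag : ∀ e, e.IsDiag → d * (2 * (k + 1) * C / u) ≤ cap e) {μ : ℝ}
    (hμ : C * (T + u * k) ≤ μ * n.choose 2) (hn2 : 2 ≤ n) :
    Finset.univ.expect (fun ω : Fin d → Equiv.Perm (Fin n) × (Fin u × Fin k → Fin u) =>
        if ∀ e, ∑ i, plantCost n C T u k (Sym2.map (ω i).1.symm e) ≤ cap e
        then (0 : ℝ) else 1) ≤
      n ^ 2 * Real.exp ((7 / 4 * (d * μ) - s) / (2 * (k + 1) * C / u)) := by
  have : NeZero u := ⟨hu.ne'⟩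
  have hu' : (0 : ℝ) < u := by exact_mod_cast hu
  set b : ℝ := 2 * (k + 1) * C / u with hb
  have hb0 : 0 < b := by positivity
  have hcost : ∀ e, plantCost n C T u k e ≤ b := plantCost_le hC.le k hn hu
  have hch : (0 : ℝ) < n.choose 2 := by exact_mod_cast Nat.choose_pos hn2
  let Ω := Equiv.Perm (Fin n) × (Fin u × Fin k → Fin u)
  let D : Finset (Sym2 (Fin n)) := Finset.univ.filter fun e => ¬ e.IsDiag
  have h1 : ∀ ω : Fin d → Ω,
      (if ∀ e, ∑ i, plantCost n C T u k (Sym2.map (ω i).1.symm e) ≤ cap e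
        then (0 : ℝ) else 1) ≤
      ∑ e ∈ D, Real.exp (-s / b) *
        ∏ i, Real.exp (plantCost n C T u k (Sym2.map (ω i).1.symm e) / b) := by
    intro ω
    split_ifs with hall
    · exact Finset.sum_nonneg fun e _ => by positivity
    · push Not at hall
      obtain ⟨e, he⟩ := hall
      have hnd : ¬ e.IsDiag := by
        intro hd
        have h2 := hdiag e hd
        have h3 : ∑ i, plantCost n C T u k (Sym2.map (ω i).1.symm e) ≤ ∑ _i : Fin d, b :=
          Finset.sum_le_sum fun i _ => hcost _
        rw [Finset.sum_const, Finset.card_univ, Fintype.card_fin, nsmul_eq_mul] at h3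
        linarith
      have hmem : e ∈ D := Finset.mem_filter.2 ⟨Finset.mem_univ _, hnd⟩
      refine le_trans ?_ (Finset.single_le_sum (fun e _ => by positivity) hmem)
      rw [← Real.exp_sum, ← Real.exp_add, ← Finset.sum_div, ← add_div, Real.one_le_exp_iff]
      have := hcap e hnd
      exact div_nonneg (by linarith) hb0.le
  have h2 : ∀ e ∈ D, Finset.univ.expect (fun ω : Fin d → Ω => Real.exp (-s / b) *
        ∏ i, Real.exp (plantCost n C T u k (Sym2.map (ω i).1.symm e) / b)) ≤
      Real.exp ((7 / 4 * (d * μ) - s) / b) := by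
    intro e he
    have hnd := (Finset.mem_filter.1 he).2
    rw [← Finset.mul_expect, expect_prod_pi d fun ω : Ω =>
      Real.exp (plantCost n C T u k (Sym2.map ω.1.symm e) / b)]
    have h3 : Finset.univ.expect (fun ω : Ω =>
        Real.exp (plantCost n C T u k (Sym2.map ω.1.symm e) / b)) ≤
        Real.exp (7 / 4 * (μ / b)) := by
      calc Finset.univ.expect (fun ω : Ω =>
          Real.exp (plantCost n C T u k (Sym2.map ω.1.symm e) / b))
          = Finset.univ.expect (fun σ : Equiv.Perm (Fin n) =>
              Real.exp (plantCost n C T u k (Sym2.map σ.symm e) / b)) := by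
            rw [← Finset.univ_product_univ, Finset.expect_product]
            refine Finset.expect_congr rfl fun σ _ => ?_
            exact Finset.expect_const (Finset.univ_nonempty (α := Fin u × Fin k → Fin u))
              (Real.exp (plantCost n C T u k (Sym2.map σ.symm e) / b))
        _ ≤ Finset.univ.expect (fun σ : Equiv.Perm (Fin n) =>
              1 + 7 / 4 / b * plantCost n C T u k (Sym2.map σ.symm e)) := by
            refine Finset.expect_le_expect fun σ _ => ?_
            refine (exp_le_one_add_of_le_one (div_nonneg (plantCost_nonneg hC.le _ _ _ _) hb0.le)
              ((div_le_one hb0).2 (hcost _))).trans (le_of_eq ?_)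
            ring
        _ ≤ 1 + 7 / 4 / b * μ := by
            rw [Finset.expect_add_distrib, Finset.expect_const Finset.univ_nonempty,
              ← Finset.mul_expect]
            have := expect_plantCost_le (k := k) hn hu hC.le hnd
            have h4 := le_of_mul_le_mul_right (this.trans hμ) hch
            gcongr
        _ = 7 / 4 * (μ / b) + 1 := by ring
        _ ≤ Real.exp (7 / 4 * (μ / b)) := Real.add_one_le_exp _
    have h5 : 0 ≤ Finset.univ.expect (fun ω : Ω =>
        Real.exp (plantCost n C T u k (Sym2.map ω.1.symm e) / b)) :=
      Finset.expect_nonneg fun _ _ => by positivity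
    calc _ ≤ Real.exp (-s / b) * Real.exp (7 / 4 * (μ / b)) ^ d := by gcongr
      _ = Real.exp ((7 / 4 * (d * μ) - s) / b) := by
          rw [← Real.exp_nat_mul, ← Real.exp_add]
          congr 1
          ring
  calc _ ≤ Finset.univ.expect (fun ω : Fin d → Ω => ∑ e ∈ D, Real.exp (-s / b) *
        ∏ i, Real.exp (plantCost n C T u k (Sym2.map (ω i).1.symm e) / b)) :=
        Finset.expect_le_expect fun ω _ => h1 ω
    _ = ∑ e ∈ D, Finset.univ.expect (fun ω : Fin d → Ω => Real.exp (-s / b) *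
        ∏ i, Real.exp (plantCost n C T u k (Sym2.map (ω i).1.symm e) / b)) :=
        Finset.expect_sum_comm _ _ _
    _ ≤ ∑ e ∈ D, Real.exp ((7 / 4 * (d * μ) - s) / b) := Finset.sum_le_sum h2
    _ ≤ n ^ 2 * Real.exp ((7 / 4 * (d * μ) - s) / b) := by
        rw [Finset.sum_const, nsmul_eq_mul]
        have hD : D.card ≤ n ^ 2 := by
          have h6 : D.card = n.choose 2 := by
            have := Sym2.card_subtype_not_diag (α := Fin n)
            rwa [Fintype.card_subtype, Fintype.card_fin] at this
          rw [h6]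
          exact Nat.choose_le_pow n 2
        have : (D.card : ℝ) ≤ (n : ℝ) ^ 2 := by exact_mod_cast hD
        gcongr

end Cost

/-! ### Strassen's theorem on a finite order -/

section Strassen

/-- Coordinates of a linear functional on a product of two function spaces and a line. -/
theorem map_prod_eq_sum {Γ : Type*} [Fintype Γ] [DecidableEq Γ]
    (F : (Γ → ℝ) × (Γ → ℝ) × ℝ →ₗ[ℝ] ℝ) (a b : Γ → ℝ) (s : ℝ) :
    F (a, b, s) = ∑ x, a x * F (Pi.single x 1, 0, 0) + ∑ y, b y * F (0, Pi.single y 1, 0) +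
      s * F (0, 0, 1) := by
  have h1 := LinearMap.pi_apply_eq_sum_univ (F ∘ₗ LinearMap.inl ℝ (Γ → ℝ) ((Γ → ℝ) × ℝ)) a
  have h2 := LinearMap.pi_apply_eq_sum_univ
    (F ∘ₗ LinearMap.inr ℝ (Γ → ℝ) ((Γ → ℝ) × ℝ) ∘ₗ LinearMap.inl ℝ (Γ → ℝ) ℝ) b
  have h3 : F (0, 0, s) = s * F (0, 0, 1) := by
    rw [← smul_eq_mul, ← map_smul]; simp
  have e : (a, b, s) = ((a, 0, 0) : (Γ → ℝ) × (Γ → ℝ) × ℝ) + (0, b, 0) + (0, 0, s) := by simp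
  have hs : ∀ x : Γ, (fun j => if x = j then (1 : ℝ) else 0) = Pi.single x 1 := by
    intro x; ext j; simp [Pi.single_apply, eq_comm]
  simp only [LinearMap.comp_apply, LinearMap.inl_apply, LinearMap.inr_apply, smul_eq_mul,
    hs] at h1 h2
  rw [e, map_add, map_add, h3]
  congr 2

/-- **Strassen's theorem** for two probability vectors on a finite partial order, with an
error `e`. -/
theorem exists_coupling_of_expect_le {Γ : Type*} [Fintype Γ] [PartialOrder Γ]
    [DecidableLE Γ] {μ ν : Γ → ℝ} (hμ : μ ∈ stdSimplex ℝ Γ) (hν : ν ∈ stdSimplex ℝ Γ) {e : ℝ}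
    (h : ∀ f : Γ → ℝ, Monotone f → (∀ x, 0 ≤ f x) → (∀ x, f x ≤ 1) →
      ∑ x, μ x * f x ≤ ∑ x, ν x * f x + e) :
    ∃ π : Γ × Γ → ℝ, (∀ q, 0 ≤ π q) ∧ (∀ x, ∑ y, π (x, y) = μ x) ∧
      (∀ y, ∑ x, π (x, y) = ν y) ∧ ∑ q, π q * (if q.1 ≤ q.2 then 0 else 1) ≤ e := by
  classical
  let c : Γ × Γ → ℝ := fun q => if q.1 ≤ q.2 then 0 else 1
  -- marginals and defect of a joint distribution
  let Φ : (Γ × Γ → ℝ) →ₗ[ℝ] (Γ → ℝ) × (Γ → ℝ) × ℝ :=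
    { toFun := fun π => (fun x => ∑ y, π (x, y), fun y => ∑ x, π (x, y), ∑ q, π q * c q)
      map_add' := fun π π' => by
        ext <;> simp [Finset.sum_add_distrib, add_mul]
      map_smul' := fun a π => by
        ext <;> simp [Finset.mul_sum, mul_assoc] }
  by_contra hcon
  have hdisj : Disjoint (Φ '' stdSimplex ℝ (Γ × Γ))
      (({μ} : Set (Γ → ℝ)) ×ˢ ({ν} : Set (Γ → ℝ)) ×ˢ Set.Iic e) := by
    rw [Set.disjoint_left]
    rintro _ ⟨π, hπ, rfl⟩ ⟨h1, h2, h3⟩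
    exact hcon ⟨π, hπ.1, fun x => congrFun h1 x, fun y => congrFun h2 y, h3⟩
  obtain ⟨F, r, v, hF1, hrv, hF2⟩ := geometric_hahn_banach_compact_closed
    ((convex_stdSimplex ℝ (Γ × Γ)).linear_image Φ)
    ((isCompact_stdSimplex ℝ (Γ × Γ)).image Φ.continuous_of_finiteDimensional)
    ((convex_singleton μ).prod ((convex_singleton ν).prod (convex_Iic e)))
    (isClosed_singleton.prod (isClosed_singleton.prod isClosed_Iic)) hdisj
  set α : Γ → ℝ := fun x => F (Pi.single x 1, 0, 0) with hα
  set β : Γ → ℝ := fun y => F (0, Pi.single y 1, 0) with hβ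
  set γ : ℝ := F (0, 0, 1) with hγ
  have hFeq : ∀ a b s, F (a, b, s) = ∑ x, a x * α x + ∑ y, b y * β y + s * γ :=
    fun a b s => map_prod_eq_sum (F : (Γ → ℝ) × (Γ → ℝ) × ℝ →ₗ[ℝ] ℝ) a b s
  have hpt : ∀ x y, α x + β y + c (x, y) * γ < r := by
    intro x y
    have h1 := hF1 _ ⟨_, single_mem_stdSimplex ℝ (x, y), rfl⟩
    have h2 : Φ (Pi.single (x, y) 1) = (Pi.single x 1, Pi.single y 1, c (x, y)) := by
      refine Prod.ext ?_ (Prod.ext ?_ ?_)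
      · funext x'
        by_cases hx : x' = x
        · subst hx
          simpa [Φ, Pi.single_apply] using Finset.card_eq_one.2 ⟨y, by ext; simp⟩
        · simp [Φ, Pi.single_apply, hx]
      · funext y'
        by_cases hy : y' = y
        · subst hy
          simpa [Φ, Pi.single_apply] using Finset.card_eq_one.2 ⟨x, by ext; simp⟩
        · simp [Φ, Pi.single_apply, hy]
      · simp [Φ, Pi.single_apply]
    rw [h2, hFeq] at h1
    simpa [Pi.single_apply] using h1
  have hsep : ∀ s ≤ e, v < ∑ x, μ x * α x + ∑ y, ν y * β y + s * γ := by
    intro s hs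
    rw [← hFeq]
    exact hF2 _ ⟨rfl, rfl, hs⟩
  have hγ0 : γ ≤ 0 := by
    by_contra hpos
    push Not at hpos
    set X := ∑ x, μ x * α x + ∑ y, ν y * β y with hX
    have h1 := hsep e le_rfl
    have h2 := hsep (e - (X + e * γ - v) / γ) (by
      have : 0 ≤ (X + e * γ - v) / γ := div_nonneg (by linarith) hpos.le
      linarith)
    rw [sub_mul, div_mul_cancel₀ _ hpos.ne'] at h2
    linarith
  have hne : Nonempty Γ := by
    by_contra hemp
    rw [not_nonempty_iff] at hemp
    have := hμ.2
    simp at this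
  set M : ℝ := Finset.univ.sup' Finset.univ_nonempty α with hM
  have hαM : ∀ x, α x ≤ M := fun x => Finset.le_sup' α (Finset.mem_univ x)
  obtain ⟨x₀, -, hx₀⟩ := Finset.exists_mem_eq_sup' Finset.univ_nonempty α
  have hlow : ∀ z : Γ, (Finset.univ.filter fun x => x ≤ z).Nonempty := fun z =>
    ⟨z, by simp⟩
  -- the least monotone function above `α`, truncated to an interval of length `-γ`
  set H : Γ → ℝ := fun z => max ((Finset.univ.filter fun x => x ≤ z).sup' (hlow z) α) (M + γ)
    with hH
  have hmono : Monotone H := by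
    intro z z' hz
    refine max_le_max ?_ le_rfl
    refine Finset.sup'_mono α (fun x hx => ?_) (hlow z)
    simp only [Finset.mem_filter, Finset.mem_univ, true_and] at hx ⊢
    exact hx.trans hz
  have hαH : ∀ x, α x ≤ H x := fun x =>
    (Finset.le_sup' α (by simp : x ∈ Finset.univ.filter fun x' => x' ≤ x)).trans (le_max_left _ _)
  have hHβ : ∀ y, H y ≤ r - β y := by
    intro y
    refine max_le (Finset.sup'_le _ _ fun x hx => ?_) ?_
    · have hxy : x ≤ y := by simpa using hx
      have := hpt x y
      simp only [c, hxy, if_true, zero_mul] at this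
      linarith
    · have h1 := hpt x₀ y
      have h2 : c (x₀, y) ≤ 1 := by simp only [c]; split_ifs <;> norm_num
      have h3 : γ ≤ c (x₀, y) * γ := by nlinarith
      rw [hM, hx₀]
      linarith
  have hHlo : ∀ z, M + γ ≤ H z := fun z => le_max_right _ _
  have hHhi : ∀ z, H z ≤ M := fun z =>
    max_le (Finset.sup'_le _ _ fun x _ => hαM x) (by linarith)
  have i1 : ∑ x, μ x * α x ≤ ∑ x, μ x * H x :=
    Finset.sum_le_sum fun x _ => mul_le_mul_of_nonneg_left (hαH x) (hμ.1 x)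
  have i2 : ∑ y, ν y * H y ≤ r - ∑ y, ν y * β y := by
    calc ∑ y, ν y * H y ≤ ∑ y, ν y * (r - β y) :=
          Finset.sum_le_sum fun y _ => mul_le_mul_of_nonneg_left (hHβ y) (hν.1 y)
      _ = r - ∑ y, ν y * β y := by
          simp only [mul_sub, Finset.sum_sub_distrib]
          rw [← Finset.sum_mul, hν.2, one_mul]
  have i3 : ∑ x, μ x * H x ≤ ∑ x, ν x * H x - γ * e := by
    rcases hγ0.lt_or_eq with hlt | h0
    · have h1 := h (fun z => (H z - (M + γ)) / -γ)
        (fun z z' hz => div_le_div_of_nonneg_right (by linarith [hmono hz]) (by linarith))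
        (fun z => div_nonneg (by linarith [hHlo z]) (by linarith))
        (fun z => by
          rw [div_le_one (by linarith)]
          linarith [hHhi z])
      have h2 : ∀ w : Γ → ℝ, ∑ x, w x = 1 →
          ∑ x, w x * ((H x - (M + γ)) / -γ) = (∑ x, w x * H x - (M + γ)) / -γ := by
        intro w hw
        have h3 : ∑ x, w x * (H x - (M + γ)) = ∑ x, w x * H x - (M + γ) := by
          simp only [mul_sub, Finset.sum_sub_distrib]
          rw [← Finset.sum_mul, hw, one_mul]
        rw [← h3, Finset.sum_div]
        exact Finset.sum_congr rfl fun x _ => by ring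
      rw [h2 μ hμ.2, h2 ν hν.2] at h1
      have hg : 0 < -γ := by linarith
      rw [← sub_le_iff_le_add', ← sub_div, div_le_iff₀ hg] at h1
      linarith
    · have hc : ∀ z, H z = M := fun z => le_antisymm (hHhi z) (by linarith [hHlo z])
      simp only [hc, h0, zero_mul, sub_zero]
      rw [← Finset.sum_mul, ← Finset.sum_mul, hμ.2, hν.2]
  have i4 := hsep e le_rfl
  linarith

end Strassen

/-! ### Couplings of random graphs -/

section Coupling

instance {n : ℕ} : MeasurableSingletonClass (SimpleGraph (Fin n)) where
  measurableSet_singleton G := by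
    have h : ({G} : Set (SimpleGraph (Fin n))) = SimpleGraph.edgeSet ⁻¹' {G.edgeSet} := by
      ext G'
      simp
    rw [h]
    exact SimpleGraph.measurable_edgeSet (measurableSet_singleton _)

/-- Elements that do not influence `f` may be discarded. -/
theorem bernE_of_insensitive {E : Type*} [DecidableEq E] {W s : Finset E} (hW : W ⊆ s)
    (w : E → ℝ) {f : Finset E → ℝ} (h : ∀ a ∈ s, a ∉ W → ∀ S, f (insert a S) = f S) :
    bernE s w f = bernE W w f := by
  induction s using Finset.induction_on generalizing W f with
  | empty => rw [Finset.subset_empty.1 hW]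
  | insert a s ha ih =>
    have hs : W.erase a ⊆ s := fun x hx =>
      (Finset.mem_insert.1 (hW (Finset.mem_of_mem_erase hx))).resolve_left
        (Finset.ne_of_mem_erase hx)
    have h' : ∀ b ∈ s, b ∉ W.erase a → ∀ S, f (insert b S) = f S := fun b hb hbW S =>
      h b (Finset.mem_insert_of_mem hb)
        (fun hbW' => hbW (Finset.mem_erase.2 ⟨fun hba => ha (hba ▸ hb), hbW'⟩)) S
    have h'' : ∀ b ∈ s, b ∉ W.erase a → ∀ S, f (insert a (insert b S)) = f (insert a S) :=
      fun b hb hbW S => by rw [Finset.insert_comm, h' b hb hbW]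
    rw [bernE_insert ha, ih hs h', ih (f := fun S => f (insert a S)) hs h'']
    by_cases haW : a ∈ W
    · conv_rhs => rw [← Finset.insert_erase haW]
      rw [bernE_insert (Finset.notMem_erase a W)]
    · have h1 : (fun S => f (insert a S)) = f :=
        funext fun S => h a (Finset.mem_insert_self _ _) haW S
      rw [h1, Finset.erase_eq_of_notMem haW]
      ring

open scoped Classical in
theorem sum_matchingUnion_mul {n d : ℕ} [Nonempty (perfectMatchings n)]
    (h : SimpleGraph (Fin n) → ℝ) :
    ∑ G, (matchingUnion n d).real {G} * h G =
      Finset.univ.expect (fun M : Fin d → perfectMatchings n => h (⨆ i, (M i).1)) := by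
  have : IsProbabilityMeasure (uniformOn (perfectMatchings n)) :=
    isProbabilityMeasure_uniformOn (Set.toFinite _) (Set.nonempty_coe_sort.1 inferInstance)
  have hint : ∑ G, (matchingUnion n d).real {G} * h G = ∫ G, h G ∂(matchingUnion n d) := by
    have : IsProbabilityMeasure (matchingUnion n d) :=
      Measure.isProbabilityMeasure_map (measurable_of_finite _).aemeasurable
    rw [integral_fintype (Integrable.of_finite)]
    simp
  rw [hint, matchingUnion, integral_map (measurable_of_finite _).aemeasurable
    (measurable_of_finite _).aestronglyMeasurable, ← uniformOn_pi,
    integral_fintype (Integrable.of_finite), Finset.expect_eq_sum_div_card]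
  set s : Finset (Fin d → SimpleGraph (Fin n)) :=
    Fintype.piFinset fun _ => (perfectMatchings n).toFinset with hs
  have hset : (Set.univ.pi fun _ : Fin d => perfectMatchings n) = (s : Set _) := by
    ext M
    simp [hs]
  have hcard : s.card = (Finset.univ : Finset (Fin d → perfectMatchings n)).card := by
    simp [hs]
  have hreal : ∀ M : Fin d → SimpleGraph (Fin n),
      (uniformOn (Set.univ.pi fun _ : Fin d => perfectMatchings n)).real {M} =
        if M ∈ s then 1 / (s.card : ℝ) else 0 := by
    intro M
    rw [hset, measureReal_def, ← Finset.coe_singleton, uniformOn_apply_finset]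
    split_ifs with hM
    · rw [Finset.inter_singleton_of_mem hM]
      simp
    · rw [Finset.inter_singleton_of_notMem hM]
      simp
  simp only [hreal, smul_eq_mul, ite_mul, zero_mul]
  rw [← Finset.sum_filter, Finset.filter_univ_mem, ← Finset.mul_sum, ← hcard, one_div,
    div_eq_inv_mul]
  congr 1
  symm
  refine Finset.sum_bij (fun M _ i => (M i).1) (fun M _ => ?_) (fun M _ M' _ hMM => ?_)
    (fun M hM => ?_) fun M _ => rfl
  · simp [hs]
  · funext i
    exact Subtype.ext (congrFun hMM i)
  · simp only [hs, Fintype.mem_piFinset, Set.mem_toFinset] at hM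
    exact ⟨fun i => ⟨M i, hM i⟩, Finset.mem_univ _, rfl⟩

open scoped Classical in
theorem sum_binomialRandom_mul {n : ℕ} (p : unitInterval) (h : SimpleGraph (Fin n) → ℝ) :
    ∑ G, (SimpleGraph.binomialRandom (Fin n) p).real {G} * h G =
      bernE (Finset.univ.filter fun e : Sym2 (Fin n) => ¬ e.IsDiag) (fun _ => (p : ℝ))
        (fun S => h (SimpleGraph.fromEdgeSet S)) := by
  have hcard : (Finset.univ.filter fun e : Sym2 (Fin n) => ¬ e.IsDiag).card = n.choose 2 := by
    rw [← Fintype.card_subtype, Sym2.card_subtype_not_diag, Fintype.card_fin]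
  rw [bernE_const_prob, hcard]
  refine Finset.sum_bij (fun G _ => G.edgeFinset) (fun G _ => ?_) (fun G _ G' _ hGG => ?_)
    (fun S hS => ?_) fun G _ => ?_
  · rw [Finset.mem_powerset]
    intro e he
    simpa using G.not_isDiag_of_mem_edgeFinset he
  · exact SimpleGraph.edgeFinset_inj.1 hGG
  · refine ⟨SimpleGraph.fromEdgeSet S, Finset.mem_univ _, ?_⟩
    ext e
    have hdiag : e ∈ S → ¬ e.IsDiag := fun he =>
      (Finset.mem_filter.1 (Finset.mem_powerset.1 hS he)).2
    simpa [SimpleGraph.mem_edgeFinset, SimpleGraph.edgeSet_fromEdgeSet] using hdiag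
  · rw [measureReal_def, SimpleGraph.binomialRandom_singleton]
    have e1 : G.edgeSet.ncard = G.edgeFinset.card := by
      rw [← SimpleGraph.coe_edgeFinset, Set.ncard_coe_finset]
    rw [e1, Nat.card_eq_fintype_card, Fintype.card_fin]
    simp

instance isProbabilityMeasure_matchingUnion {n d : ℕ} [Nonempty (perfectMatchings n)] :
    IsProbabilityMeasure (matchingUnion n d) := by
  have : IsProbabilityMeasure (uniformOn (perfectMatchings n)) :=
    isProbabilityMeasure_uniformOn (Set.toFinite _) (Set.nonempty_coe_sort.1 inferInstance)
  exact Measure.isProbabilityMeasure_map (measurable_of_finite _).aemeasurable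

/-- The probability vector of a law on a finite type. -/
theorem real_singleton_mem_stdSimplex {Γ : Type*} [Fintype Γ] [MeasurableSpace Γ]
    [MeasurableSingletonClass Γ] (μ : Measure Γ) [IsProbabilityMeasure μ] :
    (fun x => μ.real {x}) ∈ stdSimplex ℝ Γ :=
  ⟨fun _ => measureReal_nonneg, by
    rw [sum_measureReal_singleton, Finset.coe_univ, probReal_univ]⟩

/-- Strassen's theorem for probability measures on a finite partial order. -/
theorem exists_measure_coupling {Γ : Type*} [Fintype Γ] [PartialOrder Γ] [MeasurableSpace Γ]
    [MeasurableSingletonClass Γ] {μ ν : Measure Γ} [IsProbabilityMeasure μ]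
    [IsProbabilityMeasure ν] {e : ℝ}
    (h : ∀ f : Γ → ℝ, Monotone f → (∀ x, 0 ≤ f x) → (∀ x, f x ≤ 1) →
      ∑ x, μ.real {x} * f x ≤ ∑ x, ν.real {x} * f x + e) :
    ∃ π : Measure (Γ × Γ), π.fst = μ ∧ π.snd = ν ∧
      1 - ENNReal.ofReal e ≤ π {q | q.1 ≤ q.2} ∧ IsProbabilityMeasure π := by
  classical
  obtain ⟨w, hw0, hw1, hw2, hwe⟩ := exists_coupling_of_expect_le
    (real_singleton_mem_stdSimplex μ) (real_singleton_mem_stdSimplex ν) h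
  set π : Measure (Γ × Γ) := ∑ q, ENNReal.ofReal (w q) • Measure.dirac q with hπ
  have happ : ∀ S : Set (Γ × Γ), π S = ENNReal.ofReal (∑ q, if q ∈ S then w q else 0) := by
    intro S
    rw [hπ, Measure.finsetSum_apply, ENNReal.ofReal_sum_of_nonneg]
    · refine Finset.sum_congr rfl fun q _ => ?_
      by_cases hq : q ∈ S <;> simp [hq]
    · intro q _
      split_ifs
      exacts [hw0 q, le_rfl]
  have hfst : π.fst = μ := by
    refine Measure.ext_of_singleton fun x => ?_
    rw [Measure.fst_apply (measurableSet_singleton x), happ, Fintype.sum_prod_type,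
      Finset.sum_eq_single x (fun b _ hb => by simp [hb]) (by simp)]
    simp [hw1]
  have hsnd : π.snd = ν := by
    refine Measure.ext_of_singleton fun y => ?_
    rw [Measure.snd_apply (measurableSet_singleton y), happ, Fintype.sum_prod_type_right,
      Finset.sum_eq_single y (fun b _ hb => by simp [hb]) (by simp)]
    simp [hw2]
  have hprob : IsProbabilityMeasure π := by
    constructor
    rw [← Measure.fst_univ, hfst, measure_univ]
  refine ⟨π, hfst, hsnd, ?_, hprob⟩
  have hcompl : π {q | q.1 ≤ q.2}ᶜ ≤ ENNReal.ofReal e := by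
    rw [happ]
    refine ENNReal.ofReal_le_ofReal (le_trans (le_of_eq ?_) hwe)
    refine Finset.sum_congr rfl fun q _ => ?_
    by_cases hq : q.1 ≤ q.2 <;> simp [hq]
  rw [prob_compl_eq_one_sub (Set.toFinite _).measurableSet] at hcompl
  exact tsub_le_iff_tsub_le.1 hcompl

open scoped Classical in
/-- A random graph with intensities at most `p` off the diagonal is dominated by `G(n, p)`. -/
theorem bernL_fromEdgeSet_le {n : ℕ} {p : ℝ} (hp : p ≤ 1) {lam : Sym2 (Fin n) → ℝ}
    (h0 : ∀ e, 0 ≤ lam e) (hlam : ∀ e, ¬ e.IsDiag → lam e ≤ p)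
    {h : SimpleGraph (Fin n) → ℝ} (hmono : Monotone h) :
    bernL lam (fun S => h (SimpleGraph.fromEdgeSet S)) ≤
      bernE (Finset.univ.filter fun e : Sym2 (Fin n) => ¬ e.IsDiag) (fun _ => p)
        (fun S => h (SimpleGraph.fromEdgeSet S)) := by
  rw [bernL, bernE_of_insensitive (Finset.subset_univ
    (Finset.univ.filter fun e : Sym2 (Fin n) => ¬ e.IsDiag))]
  · refine bernE_le_of_le (fun e _ => ?_) (fun e he => ?_) (fun _ _ => hp)
      fun S S' hS => hmono (fromEdgeSet_mono' (by exact_mod_cast hS))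
    · have := Real.exp_le_one_iff.2 (neg_nonpos.2 (h0 e))
      linarith
    · have h1 := Real.add_one_le_exp (-lam e)
      have h2 := hlam e (Finset.mem_filter.1 he).2
      linarith
  · intro e _ he S
    have hdiag : e.IsDiag := by simpa using he
    congr 1
    ext a b
    simp only [SimpleGraph.fromEdgeSet_adj, Finset.coe_insert, Set.mem_insert_iff]
    constructor
    · rintro ⟨h1 | h1, h2⟩
      · exact absurd (Sym2.mk_isDiag_iff.1 (h1 ▸ hdiag)) h2
      · exact ⟨h1, h2⟩
    · exact fun h1 => ⟨Or.inr h1.1, h1.2⟩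

open scoped Classical in
theorem bernE_fromEdgeSet_mono {n : ℕ} {p p' : ℝ} (h0 : 0 ≤ p) (hp : p ≤ p') (h1 : p' ≤ 1)
    {h : SimpleGraph (Fin n) → ℝ} (hmono : Monotone h) (W : Finset (Sym2 (Fin n))) :
    bernE W (fun _ => p) (fun S => h (SimpleGraph.fromEdgeSet S)) ≤
      bernE W (fun _ => p') (fun S => h (SimpleGraph.fromEdgeSet S)) :=
  bernE_le_of_le (fun _ _ => h0) (fun _ _ => hp) (fun _ _ => h1)
    fun S S' hS => hmono (fromEdgeSet_mono' (by exact_mod_cast hS))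

open scoped Classical in
/-- More matchings make a larger union. -/
theorem expect_iSup_mono {n d d' : ℕ} [Nonempty (perfectMatchings n)] (hd : d ≤ d')
    {h : SimpleGraph (Fin n) → ℝ} (hmono : Monotone h) :
    Finset.univ.expect (fun M : Fin d → perfectMatchings n => h (⨆ i, (M i).1)) ≤
      Finset.univ.expect (fun M : Fin d' → perfectMatchings n => h (⨆ i, (M i).1)) := by
  induction d', hd using Nat.le_induction with
  | base => exact le_rfl
  | succ d' _ ih =>
    refine ih.trans ?_
    rw [expect_iSup_succ (fun M : perfectMatchings n => M.1) d' h]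
    exact Finset.le_expect Finset.univ_nonempty fun M₀ _ =>
      Finset.expect_le_expect fun M _ => hmono le_sup_right

theorem nonempty_perfectMatchings {n : ℕ} (hn : Even n) : Nonempty (perfectMatchings n) := by
  have hn2 := Nat.even_iff.1 hn
  refine ⟨⟨⟨fun x y => x ≠ y ∧ x.val / 2 = y.val / 2, ⟨fun x y h => ⟨h.1.symm, h.2.symm⟩⟩,
    ⟨fun x h => h.1 rfl⟩⟩, mem_perfectMatchings.2 fun v => ?_⟩⟩
  have hv := v.2
  refine ⟨⟨if v.val % 2 = 0 then v.val + 1 else v.val - 1, by split_ifs <;> omega⟩, ?_, ?_⟩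
  · constructor
    · intro h
      have := congrArg Fin.val h
      simp only at this
      split_ifs at this <;> omega
    · simp only
      split_ifs <;> omega
  · rintro w ⟨h1, h2⟩
    have h3 : v.val ≠ w.val := fun h => h1 (Fin.ext h)
    refine Fin.ext ?_
    simp only
    split_ifs <;> omega

end Coupling

/-! ### Domination for a fixed number of vertices -/

section Domination

open scoped Classical in
/-- The union of `d` independent uniform perfect matchings on `Fin n` is stochastically dominated
by `G(n, p)` up to an error `e`: the expectations of every monotone `[0, 1]`-valued graph
parameter are compared. -/
def MatchingsDominated (n d : ℕ) (p e : ℝ) : Prop :=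
  ∀ h : SimpleGraph (Fin n) → ℝ, Monotone h → (∀ G, 0 ≤ h G) → (∀ G, h G ≤ 1) →
    Finset.univ.expect (fun M : Fin d → perfectMatchings n => h (⨆ i, (M i).1)) ≤
      bernE (Finset.univ.filter fun e : Sym2 (Fin n) => ¬ e.IsDiag) (fun _ => p)
        (fun S => h (SimpleGraph.fromEdgeSet S)) + e

theorem MatchingsDominated.mono {n d d' : ℕ} {p p' e e' : ℝ} (h : MatchingsDominated n d p e)
    (hn : Even n) (hd : d' ≤ d) (hp0 : 0 ≤ p) (hp : p ≤ p') (hp1 : p' ≤ 1) (he : e ≤ e') :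
    MatchingsDominated n d' p' e' := fun f hf h0 h1 => by
  have := nonempty_perfectMatchings hn
  have := expect_iSup_mono hd hf
  have := bernE_fromEdgeSet_mono hp0 hp hp1 hf
    (Finset.univ.filter fun e : Sym2 (Fin n) => ¬ e.IsDiag)
  have := h f hf h0 h1
  linarith

/-- Every even `n` has a coupling of the two random graphs, which is good as soon as domination
holds. -/
theorem exists_coupling_of_matchingsDominated {n : ℕ} (hn : Even n) (d : ℕ) (p : unitInterval)
    (e : ℝ) :
    ∃ π : Measure (SimpleGraph (Fin n) × SimpleGraph (Fin n)), IsProbabilityMeasure π ∧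
      π.fst = matchingUnion n d ∧ π.snd = SimpleGraph.binomialRandom (Fin n) p ∧
      (MatchingsDominated n d p e → 1 - ENNReal.ofReal e ≤ π {HG | HG.1 ≤ HG.2}) := by
  classical
  have := nonempty_perfectMatchings hn
  by_cases h : MatchingsDominated n d p e
  · obtain ⟨π, h1, h2, h3, h4⟩ := exists_measure_coupling (μ := matchingUnion n d)
      (ν := SimpleGraph.binomialRandom (Fin n) p) (e := e) fun f hf h0 h1 => by
        rw [sum_matchingUnion_mul, sum_binomialRandom_mul]
        exact h f hf h0 h1
    exact ⟨π, h4, h1, h2, fun _ => h3⟩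
  · exact ⟨(matchingUnion n d).prod (SimpleGraph.binomialRandom (Fin n) p), inferInstance,
      Measure.fst_prod, Measure.snd_prod, fun h' => absurd h' h⟩

/-- Planting without ordered pairs: the intensity spent is bounded deterministically. -/
theorem matchingsDominated_of_choices {n : ℕ} (hn : Even n) (hn0 : 0 < n) {L C err : ℝ}
    (herr : 0 ≤ err) (hPl : Plantable L C err n) {d : ℕ} {p : ℝ} (hp : p ≤ 1)
    (hle : (312 * C + L) / n + d * (312 * C / n) ≤ p) :
    MatchingsDominated n d p (d * (n * 155 * err + 7 ^ 5 / (n : ℝ) ^ 4)) := by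
  intro h hmono h0 h1
  have : NeZero n := ⟨hn0.ne'⟩
  have := nonempty_perfectMatchings hn
  have hPl' := hPl
  obtain ⟨hC, hCL, -⟩ := hPl'
  have hn' : (0 : ℝ) < n := by exact_mod_cast hn0
  have hlow : (312 * C + L) / n ≤ p := by
    have : 0 ≤ d * (312 * C / n) := by positivity
    linarith
  have hp0 : 0 ≤ p := le_trans (div_nonneg (by linarith) hn'.le) hlow
  have s1 := expect_matchings_le (T := 0) (u := n) (by omega) hn0 hn herr
    (fun m hm hm' => (le_antisymm hm' hm) ▸ hPl) d (lam := fun _ => p) (fun _ => hlow) hmono h0 h1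
  have s2 := bernL_fromEdgeSet_le hp (lam := fun _ : Sym2 (Fin n) => p) (fun _ => hp0)
    (fun _ _ => le_rfl) hmono
  have s3 : Finset.univ.expect
      (fun ω : Fin d → Equiv.Perm (Fin n) × (Fin n × Fin 155 → Fin n) =>
        if ∀ e, ∑ i, plantCost n C 0 n 155 (Sym2.map (ω i).1.symm e) ≤
          p - (312 * C + L) / n then (0 : ℝ) else 1) = 0 := by
    refine Finset.expect_eq_zero fun ω _ => if_pos fun e => ?_
    have h2 : ∑ i, plantCost n C 0 n 155 (Sym2.map (ω i).1.symm e) ≤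
        ∑ _i : Fin d, 312 * C / n := Finset.sum_le_sum fun i _ => by
      refine (plantCost_le hC.le 155 (by omega) hn0 _).trans (le_of_eq ?_)
      push_cast
      ring
    rw [Finset.sum_const, Finset.card_univ, Fintype.card_fin, nsmul_eq_mul] at h2
    linarith
  rw [s3] at s1
  push_cast at s1
  rw [zero_add] at s1
  linarith

/-- Planting with `T` ordered pairs and `u` choosing vertices: the intensity spent on a pair of
vertices concentrates around its mean. -/
theorem matchingsDominated_of_pairs {n T u : ℕ} (hn : n = 2 * T + u) (hu : 0 < u)
    (heven : Even n) (hn2 : 2 ≤ n) {L C err : ℝ} (herr : 0 ≤ err)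
    (hPl : ∀ m, u ≤ m → m ≤ n → Plantable L C err m) {d : ℕ} {p s μ : ℝ} (hp : p ≤ 1)
    (hs : 0 ≤ s) (hμ : C * (T + u * 155) ≤ μ * n.choose 2)
    (hle : (312 * C + L) / u + s ≤ p) :
    MatchingsDominated n d p (d * ((T + u * 155 : ℕ) * err + 7 ^ 5 / (u : ℝ) ^ 4) +
      n ^ 2 * Real.exp ((7 / 4 * (d * μ) - s) / (312 * C / u))) := by
  intro h hmono h0 h1
  have : NeZero n := ⟨by omega⟩
  have := nonempty_perfectMatchings heven
  obtain ⟨hC, hCL, -⟩ := hPl u le_rfl (by omega)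
  have hu' : (0 : ℝ) < u := by exact_mod_cast hu
  have hp0 : 0 ≤ p := le_trans (add_nonneg (div_nonneg (by linarith) hu'.le) hs) hle
  -- on the diagonal the intensity is irrelevant and chosen so large that it is never exhausted
  set D : ℝ := (312 * C + L) / u + d * (2 * ((155 : ℕ) + 1) * C / u) with hD
  have hD0 : (312 * C + L) / u ≤ D := le_add_of_nonneg_right (by positivity)
  have hD1 : 0 ≤ D := le_trans (div_nonneg (by linarith) hu'.le) hD0
  set lam : Sym2 (Fin n) → ℝ := fun e => if e.IsDiag then D else p with hlam
  have s1 := expect_matchings_le hn hu heven herr hPl d (lam := lam)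
    (fun e => by
      simp only [hlam]
      split_ifs
      · exact hD0
      · linarith) hmono h0 h1
  have s2 := bernL_fromEdgeSet_le hp (lam := lam)
    (fun e => by
      simp only [hlam]
      split_ifs
      exacts [hD1, hp0])
    (fun e he => by simp [hlam, he]) hmono
  have s3 := expect_cost_exceeds_le (k := 155) hn hu hC d (s := s)
    (cap := fun e => lam e - (312 * C + L) / u)
    (fun e he => by simp only [hlam, he, if_false]; linarith)
    (fun e he => by simp only [hlam, he, if_true]; linarith) (μ := μ)
    (by push_cast; exact hμ) hn2
  have e1 : (2 * (((155 : ℕ) : ℝ) + 1) * C / u) = 312 * C / u := by push_cast; ring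
  rw [e1] at s3
  linarith

end Domination

/-! ### Choice of parameters -/

section Parameters

/-- A criterion for plantability uniform in the size `m ≥ u` of the planting set: `a` is the
fraction of `L` at which the binomial count is cut off, `a'` bounds the two terms in the exponent
of `Plantable` that become small compared with the `-1`, and `z` is the parameter of the Chernoff
bound. -/
theorem plantable_of {L C a a' z err u : ℝ} {m : ℕ} (hC : 0 < C) (hCL : C < L) (ha : 0 < a)
    (hz : 0 < z) (hz1 : z ≤ 1) (hexp : Real.exp (C * (a' - 1)) ≤ a) (hu : 0 < u) (hum : u ≤ m)
    (ha' : (a * L + 1) / (L - C) + (a * L + 1) / u ≤ a') (hau : a * L + 1 ≤ u)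
    (herr : z⁻¹ * Real.exp (a * L * Real.log z⁻¹ - (1 - z) * (L / (1 + L / u))) ≤ err) :
    Plantable L C err m := by
  have hL : 0 < L := hC.trans hCL
  have hm : (0 : ℝ) < m := hu.trans_le hum
  have haL : 0 < a * L := by positivity
  have hkle : (⌈a * L⌉₊ : ℝ) ≤ a * L + 1 := (Nat.ceil_lt_add_one haL.le).le
  have hkge : a * L ≤ ⌈a * L⌉₊ := Nat.le_ceil _
  have hkm : ⌈a * L⌉₊ ≤ m := by
    have : (⌈a * L⌉₊ : ℝ) ≤ m := by linarith
    exact_mod_cast this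
  have hLC : 0 < L - C := by linarith
  refine ⟨hC, hCL, ⌈a * L⌉₊, Nat.ceil_pos.2 haL, hkm, ?_, ?_⟩
  · have h1 : (⌈a * L⌉₊ : ℝ) / (L - C) ≤ (a * L + 1) / (L - C) := by gcongr
    have h2 : (⌈a * L⌉₊ : ℝ) / m ≤ (a * L + 1) / u := by gcongr
    have h3 : a ≤ (⌈a * L⌉₊ : ℝ) / (L - C) := by
      rw [le_div_iff₀ hLC]
      nlinarith
    refine le_trans (Real.exp_le_exp.2 ?_) (hexp.trans h3)
    refine mul_le_mul_of_nonneg_left ?_ hC.le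
    linarith
  · refine (binomial_lower_tail_le (by exact_mod_cast hm) hL hz hz1 hkm).trans
      (le_trans ?_ herr)
    have hz' : 1 ≤ z⁻¹ := (one_le_inv₀ hz).2 hz1
    have h1 : z⁻¹ ^ ⌈a * L⌉₊ ≤ z⁻¹ * Real.exp (a * L * Real.log z⁻¹) := by
      calc z⁻¹ ^ ⌈a * L⌉₊ = z⁻¹ ^ (⌈a * L⌉₊ : ℝ) := (Real.rpow_natCast _ _).symm
        _ ≤ z⁻¹ ^ (1 + a * L) := Real.rpow_le_rpow_of_exponent_le hz' (by linarith)
        _ = z⁻¹ * Real.exp (a * L * Real.log z⁻¹) := by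
          rw [Real.rpow_add (by positivity), Real.rpow_one, Real.rpow_def_of_pos (by positivity),
            mul_comm (Real.log _)]
    have h2 : Real.exp (-((1 - z) * (L / (1 + L / m)))) ≤
        Real.exp (-((1 - z) * (L / (1 + L / u)))) := by
      refine Real.exp_le_exp.2 (neg_le_neg (mul_le_mul_of_nonneg_left ?_ (by linarith)))
      gcongr
    calc _ ≤ (z⁻¹ * Real.exp (a * L * Real.log z⁻¹)) *
          Real.exp (-((1 - z) * (L / (1 + L / u)))) := by gcongr
      _ = _ := by rw [mul_assoc, ← Real.exp_add, ← sub_eq_add_neg]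

theorem tendsto_log_natCast : Tendsto (fun n : ℕ => Real.log n) atTop atTop :=
  Real.tendsto_log_atTop.comp tendsto_natCast_atTop_atTop

theorem tendsto_log_div_natCast : Tendsto (fun n : ℕ => Real.log n / n) atTop (𝓝 0) := by
  have := (Real.isLittleO_log_id_atTop.tendsto_div_nhds_zero).comp tendsto_natCast_atTop_atTop
  exact this

theorem tendsto_mul_exp_neg_mul {b : ℝ} (hb : 0 < b) :
    Tendsto (fun y : ℝ => y * Real.exp (-(b * y))) atTop (𝓝 0) := by
  have h1 := (Real.tendsto_pow_mul_exp_neg_atTop_nhds_zero 1).comp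
    (tendsto_id.const_mul_atTop hb)
  have h2 := h1.const_mul b⁻¹
  rw [mul_zero] at h2
  refine h2.congr fun y => ?_
  simp only [Function.comp_apply, id, pow_one]
  field_simp

theorem exp_neg_nat_mul_log {n : ℕ} (hn : 0 < n) (k : ℕ) :
    Real.exp (-(k * Real.log n)) = 1 / (n : ℝ) ^ k := by
  have : (0 : ℝ) < n := by exact_mod_cast hn
  rw [Real.exp_neg, Real.exp_nat_mul, Real.exp_log this, one_div]

/-- Near the connectivity threshold, at `p = (1 + ε) log n / n`, a number of matchings of order
`ε ^ 2 log n` may be planted. The parameters are `C = 64 / ε` and `L = (1 + ε / 2) log n`, and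
counts below the fraction `(ε / 16) ^ 2` of the mean are discarded. The intensity
`(ε / 2) log n / n` in excess of `L / n` pays for the planting. -/
theorem exists_matchingsDominated_near {ε : ℝ} (hε : 0 < ε) (hε1 : ε ≤ 1) :
    ∃ e : ℕ → ℝ, Tendsto e atTop (𝓝 0) ∧ ∀ᶠ n : ℕ in atTop, Even n →
      MatchingsDominated n ⌊ε ^ 2 / 80000 * Real.log n⌋₊ ((1 + ε) * (Real.log n / n)) (e n) ∧
        0 ≤ (1 + ε) * (Real.log n / n) := by
  -- in terms of `z = ε / 16`, `C = 4 / z` and the cutoff fraction is `z ^ 2`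
  obtain ⟨z, hz, hz1, rfl⟩ : ∃ z : ℝ, 0 < z ∧ z ≤ 1 / 16 ∧ ε = 16 * z :=
    ⟨ε / 16, by linarith, by linarith, by ring⟩
  refine ⟨fun n => 155 / z * (Real.log n * Real.exp (-(3 * z * Real.log n))) +
    7 ^ 5 * (Real.log n * Real.exp (-(4 * Real.log n))), ?_, ?_⟩
  · have h1 := ((tendsto_mul_exp_neg_mul (b := 3 * z) (by positivity)).comp
      tendsto_log_natCast).const_mul (155 / z)
    have h2 := ((tendsto_mul_exp_neg_mul (b := 4) (by norm_num)).comp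
      tendsto_log_natCast).const_mul (7 ^ 5)
    simpa using h1.add h2
  filter_upwards [tendsto_log_natCast.eventually_ge_atTop (10 + 8 / z + 312 / z ^ 2),
    tendsto_log_div_natCast.eventually_le_const (show 0 < z / 2 by positivity),
    eventually_gt_atTop 0] with n hl hln hn0 heven
  set l := Real.log n with hldef
  have hn : (0 : ℝ) < n := by exact_mod_cast hn0
  have hz2 : 0 < 312 / z ^ 2 := by positivity
  have hz3 : 0 < 8 / z := by positivity
  have hl10 : 10 ≤ l := by linarith
  set L := (1 + 8 * z) * l with hL
  have hLl : l ≤ L := by rw [hL]; nlinarith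
  have hLn : L / n ≤ z := by
    rw [hL, mul_div_assoc]
    have : 0 ≤ l / n := by positivity
    nlinarith
  have hL0 : 0 < L := by linarith
  have hC : 4 / z ≤ L / 2 := by
    have : 4 / z * 2 = 8 / z := by ring
    linarith
  have hL8 : z ^ 2 * L + 1 ≤ L / 8 := by
    have : z ^ 2 ≤ 1 / 256 := by nlinarith
    nlinarith
  have hPl : Plantable L (4 / z) (z⁻¹ * Real.exp (-((1 + 3 * z) * l))) n := by
    refine plantable_of (a := z ^ 2) (a' := 1 / 2) (z := z) (u := n) (by positivity)
      (by linarith) (by positivity) hz (by linarith) ?_ hn le_rfl ?_ ?_ ?_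
    · have h1 := Real.add_one_le_exp z⁻¹
      have h2 : z⁻¹ ≤ Real.exp z⁻¹ := by linarith
      have h3 : 4 / z * (1 / 2 - 1) = -(z⁻¹ + z⁻¹) := by rw [div_eq_mul_inv]; ring
      rw [h3, Real.exp_neg, Real.exp_add]
      have h4 : (z ^ 2)⁻¹ ≤ Real.exp z⁻¹ * Real.exp z⁻¹ := by
        rw [sq, mul_inv]
        gcongr
      exact inv_le_of_inv_le₀ (by positivity) h4
    · have h1 : (z ^ 2 * L + 1) / (L - 4 / z) ≤ 1 / 4 := by
        rw [div_le_iff₀ (by linarith)]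
        linarith
      have h2 : (z ^ 2 * L + 1) / n ≤ 1 / 4 := by
        calc (z ^ 2 * L + 1) / n ≤ (L / 8) / n := by gcongr
          _ = (L / n) / 8 := by ring
          _ ≤ 1 / 4 := by linarith
      linarith
    · have : L ≤ z * n := by rwa [div_le_iff₀ hn] at hLn
      nlinarith
    · gcongr
      have h1 : Real.log z⁻¹ ≤ z⁻¹ := (Real.log_le_sub_one_of_pos (by positivity)).trans
        (by linarith)
      have h2 : z ^ 2 * L * Real.log z⁻¹ ≤ z * L := by
        calc z ^ 2 * L * Real.log z⁻¹ ≤ z ^ 2 * L * z⁻¹ := by gcongr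
          _ = z * L := by field_simp
      have h3 : L * (1 - z) ≤ L / (1 + L / n) := by
        rw [le_div_iff₀ (by positivity), mul_assoc]
        have : (1 - z) * (1 + L / n) ≤ 1 := by
          have : 0 < L / n := by positivity
          nlinarith
        nlinarith
      have h4 : (1 - z) * (L * (1 - z)) ≤ (1 - z) * (L / (1 + L / n)) :=
        mul_le_mul_of_nonneg_left h3 (by linarith)
      have h5 : (1 + 3 * z) * l ≤ L * ((1 - z) * (1 - z) - z) := by
        have h6 : (1 + 3 * z) ≤ (1 + 8 * z) * ((1 - z) * (1 - z) - z) := by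
          nlinarith [mul_pos hz hz, mul_nonneg hz.le (sub_nonneg.2 hz1),
            mul_nonneg (mul_pos hz hz).le hz.le]
        have h7 := mul_le_mul_of_nonneg_right h6 (by linarith : 0 ≤ l)
        rw [hL]
        linarith
      linarith
  set d := ⌊(16 * z) ^ 2 / 80000 * l⌋₊ with hd
  have hdle : (d : ℝ) ≤ (16 * z) ^ 2 / 80000 * l := Nat.floor_le (by positivity)
  have hdl : (d : ℝ) ≤ l := hdle.trans (by nlinarith)
  have hp0 : 0 ≤ (1 + 16 * z) * (l / n) := by positivity
  have hp1 : (1 + 16 * z) * (l / n) ≤ 1 := by nlinarith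
  refine ⟨?_, hp0⟩
  refine (matchingsDominated_of_choices heven hn0 (by positivity) hPl (d := d) hp1 ?_).mono
    heven le_rfl hp0 le_rfl hp1 ?_
  · have h1 : d * (312 * (4 / z)) ≤ (16 * z) ^ 2 / 80000 * l * (312 * (4 / z)) := by gcongr
    have h2 : (16 * z) ^ 2 / 80000 * l * (312 * (4 / z)) ≤ 4 * z * l := by
      have : (16 * z) ^ 2 / 80000 * l * (312 * (4 / z)) = 319488 / 80000 * (z * l) := by
        field_simp
        ring
      rw [this]
      nlinarith [mul_pos hz (by linarith : 0 < l)]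
    have h3 : 312 * (4 / z) ≤ 4 * z * l := by
      have : 312 * (4 / z) = 4 * z * (312 / z ^ 2) := by field_simp
      rw [this]
      gcongr
      linarith
    calc (312 * (4 / z) + L) / n + d * (312 * (4 / z) / n) =
          (312 * (4 / z) + L + d * (312 * (4 / z))) / n := by ring
      _ ≤ ((1 + 16 * z) * l) / n := by
          gcongr
          rw [hL]
          linarith
      _ = (1 + 16 * z) * (l / n) := mul_div_assoc _ _ _
  · have e1 : Real.exp (-(4 * l)) = 1 / (n : ℝ) ^ 4 := by
      simpa using exp_neg_nat_mul_log hn0 4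
    have e2 : Real.exp (-((1 + 3 * z) * l)) = Real.exp (-(3 * z * l)) / n := by
      rw [show -((1 + 3 * z) * l) = -(3 * z * l) + -l by ring, Real.exp_add, Real.exp_neg l,
        Real.exp_log hn, div_eq_mul_inv]
    rw [e1, e2]
    calc d * (n * 155 * (z⁻¹ * (Real.exp (-(3 * z * l)) / n)) + 7 ^ 5 / (n : ℝ) ^ 4)
        ≤ l * (n * 155 * (z⁻¹ * (Real.exp (-(3 * z * l)) / n)) + 7 ^ 5 / (n : ℝ) ^ 4) := by
          gcongr
      _ = _ := by
          field_simp

/-- Far above the connectivity threshold `0.26 p n` matchings may be planted. With `C = 3 / 2` the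
mean cost of a pair per round is at most `1.54 / n`, since only about `n / 20000` of the vertices
make choices; twice the mean over `0.26 p n` rounds is `0.81 p`, below the intensity `p`. -/
theorem exists_matchingsDominated_far :
    ∃ e : ℕ → ℝ, Tendsto e atTop (𝓝 0) ∧ ∀ᶠ n : ℕ in atTop, Even n → ∀ p : ℝ,
      10 ^ 9 * (Real.log n / n) ≤ p → p ≤ 1 →
        MatchingsDominated n ⌊26 / 100 * (p * n)⌋₊ p (e n) := by
  refine ⟨fun n => (3 + 7 ^ 5 * 40000 ^ 4) / n, tendsto_const_div_atTop_nhds_zero_nat _, ?_⟩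
  filter_upwards [tendsto_log_natCast.eventually_ge_atTop 1000,
    tendsto_log_div_natCast.eventually_le_const (show (0 : ℝ) < 1 / 10 ^ 8 by norm_num),
    eventually_ge_atTop 80000] with n hl hln hn0 heven p hp hp1
  set l := Real.log n with hldef
  have hn : (80000 : ℝ) ≤ n := by exact_mod_cast hn0
  have hn' : (0 : ℝ) < n := by linarith
  obtain ⟨u, hu⟩ : ∃ u, u = 2 * (n / 40000) := ⟨_, rfl⟩
  obtain ⟨T, hT⟩ : ∃ T, n = 2 * T + u := by
    obtain ⟨r, hr⟩ := heven
    exact ⟨r - n / 40000, by omega⟩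
  have hu0 : 0 < u := by omega
  have hu1 : (n : ℝ) / 40000 ≤ u := by
    rw [div_le_iff₀ (by norm_num)]
    exact_mod_cast (by omega : n ≤ u * 40000)
  have hu2 : (u : ℝ) ≤ n / 20000 := by
    rw [le_div_iff₀ (by norm_num)]
    exact_mod_cast (by omega : u * 20000 ≤ n)
  have hu' : (0 : ℝ) < u := by exact_mod_cast hu0
  have hTn : (n : ℝ) = 2 * T + u := by exact_mod_cast hT
  have hln0 : 0 ≤ l / n := by positivity
  have hlu : l / u ≤ 40000 * (l / n) := by
    calc l / u ≤ l / (n / 40000) := by gcongr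
      _ = 40000 * (l / n) := by field_simp
  have hPl : ∀ m, u ≤ m → m ≤ n →
      Plantable (30 * l) (3 / 2) (2 * Real.exp (-(4 * l))) m := by
    intro m hm _
    have h15 : (1 / 2 * (30 * l) + 1) / u ≤ 1 / 100 := by
      calc (1 / 2 * (30 * l) + 1) / u ≤ (16 * l) / u := by gcongr; linarith
        _ = 16 * (l / u) := by ring
        _ ≤ 1 / 100 := by linarith
    -- `3 / 2 * (1 - 0.53) > log 2`, so that `exp (C (a' - 1)) ≤ a = 1 / 2`
    refine plantable_of (a := 1 / 2) (a' := 53 / 100) (z := 1 / 2) (u := u) (by norm_num)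
      (by linarith) (by norm_num) (by norm_num) (by norm_num) ?_ hu' (by exact_mod_cast hm)
      ?_ ?_ ?_
    · have h1 : (3 / 2 * (53 / 100 - 1) : ℝ) ≤ -Real.log 2 := by
        have := Real.log_two_lt_d9
        linarith
      calc Real.exp (3 / 2 * (53 / 100 - 1)) ≤ Real.exp (-Real.log 2) := Real.exp_le_exp.2 h1
        _ = 1 / 2 := by rw [Real.exp_neg, Real.exp_log (by norm_num), one_div]
    · have h1 : (1 / 2 * (30 * l) + 1) / (30 * l - 3 / 2) ≤ 52 / 100 := by
        rw [div_le_iff₀ (by linarith)]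
        linarith
      linarith
    · rw [div_le_iff₀ hu'] at h15
      linarith
    · rw [one_div, inv_inv]
      gcongr
      have h1 : 30 * l / u ≤ 2 / 100 := by
        rw [mul_div_assoc]
        linarith
      have h2 : 30 * l * (98 / 100) ≤ 30 * l / (1 + 30 * l / u) := by
        rw [le_div_iff₀ (by positivity), mul_assoc]
        have h3 : 98 / 100 * (1 + 30 * l / u) ≤ 1 := by linarith
        nlinarith
      have h4 := Real.log_two_lt_d9
      have h5 : l * Real.log 2 ≤ l * 0.7 := by gcongr; linarith
      linarith
  have hch : ((n.choose 2 : ℕ) : ℝ) = n * (n - 1) / 2 := Nat.cast_choose_two ℝ n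
  have hch0 : 0 < (n : ℝ) * (n - 1) / 2 := by
    have : (0 : ℝ) < n - 1 := by linarith
    positivity
  set d := ⌊26 / 100 * (p * n)⌋₊ with hd
  have hpn : 10 ^ 9 * l ≤ p * n := by
    have := mul_le_mul_of_nonneg_right hp hn'.le
    rwa [mul_assoc, div_mul_cancel₀ _ hn'.ne'] at this
  have hdle : (d : ℝ) ≤ 26 / 100 * (p * n) := Nat.floor_le (by linarith)
  have hdge : 25 / 100 * 10 ^ 9 * l ≤ d := by
    have := (Nat.lt_floor_add_one (26 / 100 * (p * n))).le
    rw [← hd] at this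
    linarith
  have hp0 : 0 < p := lt_of_lt_of_le (by positivity) hp
  have hdn : (d : ℝ) ≤ n := by nlinarith
  -- mean intensity per pair and round
  obtain ⟨μ, hμ⟩ : ∃ μ : ℝ, μ * (n * (n - 1) / 2) = 3 / 2 * (T + u * 155) :=
    ⟨3 / 2 * (T + u * 155) / (n * (n - 1) / 2), div_mul_cancel₀ _ hch0.ne'⟩
  have hμ0 : 0 ≤ μ := by
    by_contra hneg
    push Not at hneg
    have h1 := mul_neg_of_neg_of_pos hneg hch0
    have h2 : (0 : ℝ) ≤ 3 / 2 * (T + u * 155) := by positivity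
    linarith
  have hμlow : 3 / 2 ≤ μ * n := by
    by_contra hlt
    push Not at hlt
    have h1 : μ * n * (n - 1) / 2 ≤ 3 / 2 * (n - 1) / 2 := by
      have : (0 : ℝ) < n - 1 := by linarith
      gcongr
    have h2 : μ * n * (n - 1) / 2 = μ * (n * (n - 1) / 2) := by ring
    rw [h2, hμ] at h1
    linarith
  have hμup : μ * n ≤ 154 / 100 := by
    by_contra hlt
    push Not at hlt
    have h1 : 154 / 100 * (n - 1) / 2 ≤ μ * n * (n - 1) / 2 := by
      have : (0 : ℝ) < n - 1 := by linarith
      gcongr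
    have h2 : μ * n * (n - 1) / 2 = μ * (n * (n - 1) / 2) := by ring
    rw [h2, hμ] at h1
    linarith
  have hsμ : 2 * (d * μ) ≤ 81 / 100 * p := by
    have h1 : d * μ ≤ 26 / 100 * (p * n) * μ := by gcongr
    have h2 : 26 / 100 * (p * n) * μ = 26 / 100 * p * (μ * n) := by ring
    have h3 : 26 / 100 * p * (μ * n) ≤ 26 / 100 * p * (154 / 100) := by gcongr
    linarith
  refine (matchingsDominated_of_pairs hT hu0 heven (by omega) (by positivity) hPl (d := d)
    (s := 2 * (d * μ)) (μ := μ) hp1 (by positivity) (by rw [hch, hμ]) ?_).mono heven le_rfl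
    hp0.le le_rfl hp1 ?_
  · have h1 : (312 * (3 / 2) + 30 * l) / u ≤ 31 * (l / u) := by
      calc (312 * (3 / 2) + 30 * l) / u ≤ (31 * l) / u := by gcongr; linarith
        _ = 31 * (l / u) := mul_div_assoc _ _ _
    linarith
  · have e1 : Real.exp (-(4 * l)) = 1 / (n : ℝ) ^ 4 := by
      simpa using exp_neg_nat_mul_log (by omega : 0 < n) 4
    have e2 : Real.exp (-(3 * l)) = 1 / (n : ℝ) ^ 3 := by
      simpa using exp_neg_nat_mul_log (by omega : 0 < n) 3
    have h1 : (7 / 4 * (d * μ) - 2 * (d * μ)) / (312 * (3 / 2) / u) ≤ -(3 * l) := by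
      have h2 : (7 / 4 * (d * μ) - 2 * (d * μ)) / (312 * (3 / 2) / u) =
          -(d * (μ * u) / 1872) := by
        field_simp
        ring
      have h3 : 3 / 2 / 40000 ≤ μ * u := by
        calc 3 / 2 / 40000 ≤ μ * n / 40000 := by gcongr
          _ = μ * (n / 40000) := by ring
          _ ≤ μ * u := by gcongr
      have h4 : 25 / 100 * 10 ^ 9 * l * (3 / 2 / 40000) ≤ d * (μ * u) := by gcongr
      rw [h2]
      linarith
    have h2 : (n : ℝ) ^ 2 * Real.exp ((7 / 4 * (d * μ) - 2 * (d * μ)) / (312 * (3 / 2) / u)) ≤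
        1 / n := by
      calc _ ≤ (n : ℝ) ^ 2 * (1 / (n : ℝ) ^ 3) := by
            rw [← e2]
            gcongr
        _ = 1 / n := by field_simp
    have h3 : (7 : ℝ) ^ 5 / (u : ℝ) ^ 4 ≤ 7 ^ 5 * 40000 ^ 4 / (n : ℝ) ^ 4 := by
      calc (7 : ℝ) ^ 5 / (u : ℝ) ^ 4 ≤ 7 ^ 5 / (n / 40000 : ℝ) ^ 4 := by gcongr
        _ = 7 ^ 5 * 40000 ^ 4 / (n : ℝ) ^ 4 := by rw [div_pow]; field_simp
    have h4 : ((T + u * 155 : ℕ) : ℝ) ≤ n := by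
      push_cast
      linarith
    have h5 : (d : ℝ) * ((T + u * 155 : ℕ) * (2 * Real.exp (-(4 * l))) + 7 ^ 5 / (u : ℝ) ^ 4) ≤
        n * (n * (2 * (1 / (n : ℝ) ^ 4)) + 7 ^ 5 * 40000 ^ 4 / (n : ℝ) ^ 4) := by
      rw [e1]
      gcongr
    have h6 : n * (n * (2 * (1 / (n : ℝ) ^ 4)) + 7 ^ 5 * 40000 ^ 4 / (n : ℝ) ^ 4) =
        2 / (n : ℝ) ^ 2 + 7 ^ 5 * 40000 ^ 4 / (n : ℝ) ^ 3 := by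
      field_simp
    have hn1 : (1 : ℝ) ≤ n := by linarith
    have h7 : 2 / (n : ℝ) ^ 2 ≤ 2 / n :=
      div_le_div_of_nonneg_left (by norm_num) hn' (le_self_pow₀ hn1 (by norm_num))
    have h8 : (7 ^ 5 * 40000 ^ 4 : ℝ) / (n : ℝ) ^ 3 ≤ 7 ^ 5 * 40000 ^ 4 / n :=
      div_le_div_of_nonneg_left (by norm_num) hn' (le_self_pow₀ hn1 (by norm_num))
    have h9 : (3 + 7 ^ 5 * 40000 ^ 4 : ℝ) / n = 2 / n + 7 ^ 5 * 40000 ^ 4 / n + 1 / n := by ring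
    linarith

end Parameters

/-! ### The planted proportion as a function of the density -/

section Threshold

/-- The proportion of the mean degree `p n` that may be planted as matchings when
`p = x log n / n`: quadratic in `x - 1` near the threshold, and tending to `1 / 4`. The constant
`10 ^ 16` makes it so small for `x ≤ 10 ^ 9` that the near regime covers all these densities. -/
noncomputable def plantRatio (x : ℝ) : ℝ := 1 / 4 * ((x - 1) / (x - 1 + 10 ^ 16)) ^ 2

theorem plantRatio_base_nonneg {x : ℝ} (hx : 1 ≤ x) : 0 ≤ (x - 1) / (x - 1 + 10 ^ 16) :=
  div_nonneg (by linarith) (by linarith)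

theorem plantRatio_nonneg (x : ℝ) : 0 ≤ plantRatio x := by unfold plantRatio; positivity

theorem plantRatio_one : plantRatio 1 = 0 := by simp [plantRatio]

theorem continuousOn_plantRatio : ContinuousOn plantRatio (Set.Ici 1) := by
  unfold plantRatio
  refine continuousOn_const.mul (ContinuousOn.pow (ContinuousOn.div (by fun_prop) (by fun_prop)
    fun x hx => ?_) 2)
  have : (1 : ℝ) ≤ x := hx
  linarith

theorem strictMonoOn_plantRatio : StrictMonoOn plantRatio (Set.Ici 1) := by
  intro x hx y hy hxy
  have hx : (1 : ℝ) ≤ x := hx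
  unfold plantRatio
  have h0 := plantRatio_base_nonneg hx
  have h1 : (x - 1) / (x - 1 + 10 ^ 16) < (y - 1) / (y - 1 + 10 ^ 16) := by
    rw [div_lt_div_iff₀ (by linarith) (by linarith)]
    nlinarith
  gcongr

theorem plantRatio_le {x : ℝ} (hx : 1 ≤ x) : plantRatio x ≤ 1 / 4 := by
  have h0 := plantRatio_base_nonneg hx
  have h1 : (x - 1) / (x - 1 + 10 ^ 16) ≤ 1 := by
    rw [div_le_one (by linarith)]
    linarith
  have := pow_le_one₀ h0 h1 (n := 2)
  unfold plantRatio
  linarith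

theorem plantRatio_le_sq {x : ℝ} (hx : 1 ≤ x) : plantRatio x ≤ (x - 1) ^ 2 / (4 * 10 ^ 32) := by
  have h0 := plantRatio_base_nonneg hx
  have h1 : (x - 1) / (x - 1 + 10 ^ 16) ≤ (x - 1) / 10 ^ 16 := by
    have : 0 ≤ x - 1 := by linarith
    gcongr
    linarith
  calc plantRatio x ≤ 1 / 4 * ((x - 1) / 10 ^ 16) ^ 2 := by unfold plantRatio; gcongr
    _ = (x - 1) ^ 2 / (4 * 10 ^ 32) := by ring

theorem tendsto_plantRatio : Tendsto plantRatio atTop (𝓝 (1 / 4)) := by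
  have h1 : Tendsto (fun x : ℝ => 1 / 4 * (1 - 10 ^ 16 / (x - 1 + 10 ^ 16)) ^ 2) atTop
      (𝓝 (1 / 4 * (1 - 0) ^ 2)) := by
    refine Tendsto.const_mul _ (Tendsto.pow (Tendsto.const_sub _ ?_) 2)
    refine Tendsto.const_div_atTop ?_ _
    exact tendsto_atTop_add_const_right _ _
      (tendsto_atTop_add_const_right _ (-1 : ℝ) tendsto_id)
  have h2 : (1 / 4 * (1 - 0) ^ 2 : ℝ) = 1 / 4 := by norm_num
  rw [h2] at h1
  refine h1.congr' ?_
  filter_upwards [eventually_ge_atTop 1] with x hx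
  unfold plantRatio
  have : x - 1 + 10 ^ 16 ≠ 0 := (by linarith : 0 < x - 1 + 10 ^ 16).ne'
  congr 2
  field_simp
  ring

/-- Finitely many dyadic levels serve all excesses `t` above a fixed one. -/
theorem exists_dyadic_level {ε : ℝ} (hε : 0 < ε) :
    ∃ J : ℕ, ∀ t, ε ≤ t → ∃ j ≤ J, (1 / 2 : ℝ) ^ j ≤ t ∧ (t ≤ 2 * (1 / 2) ^ j ∨ j = 0) := by
  obtain ⟨J, hJ⟩ := exists_pow_lt_of_lt_one hε (by norm_num : (1 / 2 : ℝ) < 1)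
  refine ⟨J, fun t ht => ?_⟩
  rcases le_or_gt 1 t with h1 | h1
  · exact ⟨0, Nat.zero_le _, by simpa using h1, Or.inr rfl⟩
  · obtain ⟨j, hj1, hj2⟩ := exists_nat_pow_near_of_lt_one (hε.trans_le ht) h1.le
      (by norm_num : (0 : ℝ) < 1 / 2) (by norm_num)
    refine ⟨j + 1, ?_, hj1.le, Or.inl ?_⟩
    · by_contra hlt
      have h2 : (1 / 2 : ℝ) ^ j ≤ (1 / 2) ^ J :=
        pow_le_pow_of_le_one (by norm_num) (by norm_num) (by omega)
      linarith
    · rw [pow_succ]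
      linarith

/-- Asymptotic domination along even `n`, for all densities above the threshold. -/
theorem exists_matchingsDominated_of_plantRatio {ε : ℝ} (hε : 0 < ε) {x : ℕ → ℝ}
    {p : ℕ → unitInterval} {d : ℕ → ℕ} {δ : ℕ → ℝ}
    (hx : ∀ᶠ n in evenAtTop, 1 + ε ≤ x n)
    (hp : ∀ᶠ n in evenAtTop, (p n : ℝ) = x n * Real.log n / n)
    (hδ : Tendsto δ evenAtTop (𝓝 0))
    (hd : ∀ᶠ n in evenAtTop, (d n : ℝ) ≤ (plantRatio (x n) + δ n) * ((p n : ℝ) * n)) :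
    ∃ e : ℕ → ℝ, Tendsto e atTop (𝓝 0) ∧
      ∀ᶠ n in evenAtTop, MatchingsDominated n (d n) (p n) (e n) := by
  obtain ⟨J, hJ⟩ := exists_dyadic_level hε
  obtain ⟨e₀, he₀, hfar⟩ := exists_matchingsDominated_far
  have hnear := fun j : ℕ => exists_matchingsDominated_near (ε := (1 / 2) ^ j) (by positivity)
    (pow_le_one₀ (by norm_num) (by norm_num))
  choose e he hdom using hnear
  refine ⟨fun n => |e₀ n| + ∑ j ∈ Finset.range (J + 1), |e j n|, ?_, ?_⟩
  · have h1 := tendsto_finsetSum (Finset.range (J + 1)) fun j _ => (he j).abs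
    simpa using he₀.abs.add h1
  have hdom' : ∀ᶠ n in evenAtTop, ∀ j ∈ Finset.range (J + 1), Even n →
      MatchingsDominated n ⌊((1 / 2 : ℝ) ^ j) ^ 2 / 80000 * Real.log n⌋₊
        ((1 + (1 / 2) ^ j) * (Real.log n / n)) (e j n) ∧
      0 ≤ (1 + (1 / 2 : ℝ) ^ j) * (Real.log n / n) :=
    ((Finset.eventually_all _).2 fun j _ => hdom j).filter_mono inf_le_left
  have hη : 0 < ((1 / 2 : ℝ) ^ J) ^ 2 / 10 ^ 15 := by positivity
  filter_upwards [hx, hp, hd, hdom', hfar.filter_mono inf_le_left,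
    hδ.eventually_le_const hη,
    (eventually_ge_atTop 2).filter_mono (inf_le_left : evenAtTop ≤ atTop),
    mem_inf_of_right (mem_principal_self {n : ℕ | Even n})] with n hx hp hd hnear hfar hδ hn2 heven
  have heven : Even n := heven
  have hn : (0 : ℝ) < n := by exact_mod_cast (by omega : 0 < n)
  have hl : 0 < Real.log n := Real.log_pos (by exact_mod_cast (by omega : 1 < n))
  set l := Real.log n with hldef
  have hpn : (p n : ℝ) * n = x n * l := by rw [hp, div_mul_cancel₀ _ hn.ne']
  have hpx : (p n : ℝ) = x n * (l / n) := by rw [hp, mul_div_assoc]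
  have hx1 : 1 ≤ x n := by linarith
  have hln : 0 < l / n := by positivity
  have hsum : ∀ j, 0 ≤ |e j n| := fun j => abs_nonneg _
  have hJ1 : ((1 / 2 : ℝ) ^ J) ^ 2 ≤ 1 := pow_le_one₀ (by positivity)
    (pow_le_one₀ (by norm_num) (by norm_num))
  -- above `10 ^ 9` the pairs are planted; below, the choices at a dyadic level under `x n - 1`
  rcases le_or_gt (10 ^ 9) (x n) with hbig | hsmall
  · refine (hfar heven (p n) ?_ (p n).2.2).mono heven ?_ (p n).2.1 le_rfl (p n).2.2 ?_
    · rw [hpx]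
      gcongr
    · refine Nat.le_floor (hd.trans ?_)
      have h1 := plantRatio_le hx1
      have h2 : 0 ≤ (p n : ℝ) * n := mul_nonneg (p n).2.1 hn.le
      refine mul_le_mul_of_nonneg_right ?_ h2
      have : ((1 / 2 : ℝ) ^ J) ^ 2 / 10 ^ 15 ≤ 1 / 10 ^ 15 := by gcongr
      linarith
    · exact (le_abs_self _).trans (le_add_of_nonneg_right (Finset.sum_nonneg fun j _ => hsum j))
  · obtain ⟨j, hjJ, hjt, hj⟩ := hJ (x n - 1) (by linarith)
    have hjmem : j ∈ Finset.range (J + 1) := Finset.mem_range.2 (by omega)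
    obtain ⟨hD, hD0⟩ := hnear j hjmem heven
    set η : ℝ := (1 / 2) ^ j with hηdef
    have hη0 : 0 < η := by positivity
    have hηJ : ((1 / 2 : ℝ) ^ J) ^ 2 ≤ η ^ 2 := by
      have : (1 / 2 : ℝ) ^ J ≤ η := pow_le_pow_of_le_one (by norm_num) (by norm_num) hjJ
      gcongr
    have ht : x n - 1 ≤ 10 ^ 9 * η := by
      rcases hj with hj | hj
      · linarith
      · rw [hηdef, hj, pow_zero]
        linarith
    refine hD.mono heven ?_ hD0 ?_ (p n).2.2 ?_
    · refine Nat.le_floor (hd.trans ?_)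
      have h1 : plantRatio (x n) ≤ η ^ 2 / (4 * 10 ^ 14) := by
        have h2 : (x n - 1) ^ 2 ≤ (10 ^ 9 * η) ^ 2 := by
          have : 0 ≤ x n - 1 := by linarith
          gcongr
        calc plantRatio (x n) ≤ (x n - 1) ^ 2 / (4 * 10 ^ 32) := plantRatio_le_sq hx1
          _ ≤ (10 ^ 9 * η) ^ 2 / (4 * 10 ^ 32) := by gcongr
          _ = η ^ 2 / (4 * 10 ^ 14) := by ring
      have h3 : δ n ≤ η ^ 2 / 10 ^ 15 := hδ.trans (by gcongr)
      have h4 : 0 < η ^ 2 := by positivity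
      rw [hpn]
      calc (plantRatio (x n) + δ n) * (x n * l) ≤ (η ^ 2 / 10 ^ 14) * (10 ^ 9 * l) := by
            gcongr
            linarith
        _ ≤ η ^ 2 / 80000 * l := by
            have h5 : 0 < η ^ 2 * l := by positivity
            linarith
    · rw [hpx]
      gcongr
      linarith
    · refine (le_abs_self _).trans ((Finset.single_le_sum (f := fun j => |e j n|)
        (fun j _ => hsum j) hjmem).trans (le_add_of_nonneg_left (abs_nonneg _)))

end Threshold

/-- Asymptotics are along even `n`; the sequence `δ` is the `o(1)` term in the bound on `d`.
The measure `π n` is the joint law of the coupled pair of graphs on `Fin n`. -/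
theorem mainTheorem3 :
    ∃ g : ℝ → ℝ,
      ContinuousOn g (Set.Ici 1) ∧ StrictMonoOn g (Set.Ici 1) ∧
      Set.MapsTo g (Set.Ici 1) (Set.Ici 0) ∧
      g 1 = 0 ∧ Tendsto g atTop (𝓝 (1 / 4)) ∧
      ∀ (ε : ℝ), 0 < ε →
      ∀ (x : ℕ → ℝ) (p : ℕ → unitInterval) (d : ℕ → ℕ) (δ : ℕ → ℝ),
        (∀ᶠ n in evenAtTop, 1 + ε ≤ x n) →
        (∀ᶠ n in evenAtTop, (p n : ℝ) = x n * Real.log n / n) →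
        Tendsto δ evenAtTop (𝓝 0) →
        (∀ᶠ n in evenAtTop, (d n : ℝ) ≤ (g (x n) + δ n) * ((p n : ℝ) * n)) →
        ∃ π : (n : ℕ) → Measure (SimpleGraph (Fin n) × SimpleGraph (Fin n)),
          (∀ n, Even n →
            (π n).fst = matchingUnion n (d n) ∧
            (π n).snd = SimpleGraph.binomialRandom (Fin n) (p n)) ∧
          Tendsto (fun n => π n {HG | HG.1 ≤ HG.2}) evenAtTop (𝓝 1) := by
  refine ⟨plantRatio, continuousOn_plantRatio, strictMonoOn_plantRatio,
    fun x _ => plantRatio_nonneg x, plantRatio_one, tendsto_plantRatio, ?_⟩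
  intro ε hε x p d δ hx hp hδ hd
  obtain ⟨e, he, hdom⟩ := exists_matchingsDominated_of_plantRatio hε hx hp hδ hd
  have hex : ∀ n, ∃ π : Measure (SimpleGraph (Fin n) × SimpleGraph (Fin n)), Even n →
      IsProbabilityMeasure π ∧ π.fst = matchingUnion n (d n) ∧
      π.snd = SimpleGraph.binomialRandom (Fin n) (p n) ∧
      (MatchingsDominated n (d n) (p n) (e n) →
        1 - ENNReal.ofReal (e n) ≤ π {HG | HG.1 ≤ HG.2}) := by
    intro n
    by_cases hn : Even n
    · obtain ⟨π, hπ⟩ := exists_coupling_of_matchingsDominated hn (d n) (p n) (e n)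
      exact ⟨π, fun _ => hπ⟩
    · exact ⟨0, fun h => absurd h hn⟩
  choose π hπ using hex
  refine ⟨π, fun n hn => ⟨(hπ n hn).2.1, (hπ n hn).2.2.1⟩, ?_⟩
  have heven : ∀ᶠ n in evenAtTop, Even n :=
    mem_inf_of_right (mem_principal_self {n : ℕ | Even n})
  have hlow : Tendsto (fun n => 1 - ENNReal.ofReal (e n)) evenAtTop (𝓝 1) := by
    have h1 := ENNReal.Tendsto.sub (tendsto_const_nhds (x := (1 : ENNReal)))
      (ENNReal.tendsto_ofReal (he.mono_left (inf_le_left : evenAtTop ≤ atTop)))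
      (Or.inl ENNReal.one_ne_top)
    rwa [ENNReal.ofReal_zero, tsub_zero] at h1
  refine tendsto_of_tendsto_of_tendsto_of_le_of_le' hlow tendsto_const_nhds ?_ ?_
  · filter_upwards [heven, hdom] with n hn h
    exact (hπ n hn).2.2.2 h
  · filter_upwards [heven] with n hn
    have := (hπ n hn).1
    exact prob_le_one
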